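/- **Setting.** Let $\theta_0\in\mathbb R^n$, $\sigma>0$, and let $u(0),u(1),\dots$ be a deterministic real input, with $u(t)=0$ for $t<0$. For every sample size $N$ let $\Phi=\Phi_N\in\mathbb R^{N\times n}$ be the lower triangular Toeplitz matrix with first column $(u(0),\dots,u(N-1))^\top$, and $Y=\Phi\theta_0+E$ with $E\sim\mathcal N(0,\sigma^2I_N)$. Suppose $\Phi^\top\Phi/N\to\Sigma\succ0$. Let $\hat\theta^{ML}=(\Phi^\top\Phi)^{-1}\Phi^\top Y$. For a nonnegative, measurable, possibly improper weighting function $\pi(\theta|\eta)$, $\eta\in\mathcal D\subset\mathbb R^p$, let $$\hat\theta^{EB}(\eta)=\frac{\int\theta\,p(Y|\theta)\pi(\theta|\eta)\,d\theta}{\int p(Y|\theta)\pi(\theta|\eta)\,d\theta},$$ where $p(\cdot|\theta)$ is the density of $\mathcal N(\Phi\theta,\sigma^2I_N)$; for large $N$ it is a function of $\hat\theta^{ML}$. Let $\hat\eta=\hat\eta_N:\mathbb R^n\to\mathcal D$ be measurable, and consider the estimator $\hat\theta^{EB}(\hat\eta(\hat\theta^{ML}))$. Let $\mathrm{MSE}(\hat\theta)=\mathbb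 E\|\hat\theta-\theta_0\|^2$. **Assumptions.** (i) For every $\eta$ in the interior of $\mathcal D$: $\pi(\theta_0|\eta)>0$; $\pi$ is twice continuously differentiable near $(\theta_0,\eta)$; and there are a neighbourhood $U$ of $\eta$, a $c\in\mathbb R$ and an integrable $h$ such that for almost every $\theta$ and every $\eta'\in U$, $\pi(\theta|\cdot)$ is differentiable at $\eta'$ with $\|\partial\pi(\theta|\eta')/\partial\eta'\|e^{-c\|\theta\|^2}\le h(\theta)$. (ii) The integrals defining $\hat\theta^{EB}(\eta)$ converge, with positive denominator, for all large $N$ and all data, for each $\eta$ in the interior of $\mathcal D$, and almost surely for $\eta=\hat\eta(\hat\theta^{ML})$ for all large $N$; and for some $r>2$ the estimators $\hat\theta^{EB}(\hat\eta(\hat\theta^{ML}))$ with $N$ large are bounded in $L^r$. (iii) $\hat\eta_N(\theta_0)\to\eta_\star$, a point of the interior of $\mathcal D$; for large $N$ the function $\hat\eta_N$ is differentiable at $\theta_0$, with Jacobian $\hat\eta_N'(\theta_0)\to D'$; and its first-order Taylor remainder at $\theta_0$ is uniform in $N$: $\|\hat\eta_N(x)-\hat\eta_N(\theta_0)-\hat\eta_N'(\theta_0)(x-\theta_0)\|/\|x-\theta_0\|\to0$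 as $N\to\infty$ and $x\to\theta_0$. **Error terms.** Write $\hat\theta=\hat\theta^{EB}(\hat\eta(\hat\theta^{ML}))$, $\tilde\theta=\hat\theta^{EB}(\hat\eta(\theta_0))$, and $\Upsilon_{Bias}=\mathbb E\tilde\theta-\theta_0$, $\Upsilon_{Var}=\mathrm{Cov}(\tilde\theta-\hat\theta^{ML},\hat\theta^{ML})+\mathrm{Cov}(\hat\theta^{ML},\tilde\theta-\hat\theta^{ML})$, $\Upsilon_{VarHPE}=\mathrm{Cov}(\hat\theta-\tilde\theta,\hat\theta^{ML})+\mathrm{Cov}(\hat\theta^{ML},\hat\theta-\tilde\theta)$, $\Upsilon_{HOT}=\mathrm{Var}(\hat\theta-\hat\theta^{ML})+(\mathbb E\hat\theta-\theta_0)(\mathbb E\hat\theta-\theta_0)^\top-(\mathbb E\tilde\theta-\theta_0)(\mathbb E\tilde\theta-\theta_0)^\top$. **Theorem.** For large $N$, the random vectors $\hat\theta^{ML},\hat\theta,\tilde\theta$ are square integrable, and as $N\to\infty$ $$N\Upsilon_{Bias}\to \mathrm{XBias}=b(\eta_\star),\quad N^2\Upsilon_{Var}\to \mathrm{XVar}=\sigma^2b'_\theta(\eta_\star)\Sigma^{-1}+\bigl(\sigma^2b'_\theta(\eta_\star)\Sigma^{-1}\bigr)^\top,$$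 $$N^2\Upsilon_{VarHPE}\to \mathrm{XVarHPE}=\sigma^2b'_\eta(\eta_\star)D'\Sigma^{-1}+\bigl(\sigma^2b'_\eta(\eta_\star)D'\Sigma^{-1}\bigr)^\top,\quad N^2\Upsilon_{HOT}\to0.$$ Here, for every $\eta$ in the interior of $\mathcal D$ (where for large $N$ the derivatives of $\hat\theta^{EB}$ exist and the limits exist), $$b(\eta)=\lim_N N\bigl[\hat\theta^{EB}(\eta)|_{\hat\theta^{ML}=\theta_0}-\theta_0\bigr]=\sigma^2\Sigma^{-1}\tfrac{\partial\log\pi(\theta|\eta)}{\partial\theta}\Big|_{\theta_0},$$ $$b'_\theta(\eta)=\lim_N N\Bigl[\tfrac{\partial\hat\theta^{EB}(\eta)}{\partial\hat\theta^{ML}}\Big|_{\hat\theta^{ML}=\theta_0}-I_n\Bigr]=\sigma^2\Sigma^{-1}\tfrac{\partial^2\log\pi(\theta|\eta)}{\partial\theta\,\partial\theta^\top}\Big|_{\theta_0},$$ $$b'_\eta(\eta)=\lim_N N\tfrac{\partial\hat\theta^{EB}(\eta)}{\partial\eta}\Big|_{\hat\theta^{ML}=\theta_0}=\sigma^2\Sigma^{-1}\tfrac{\partial^2\log\pi(\theta|\eta)}{\partial\theta\,\partial\eta^\top}\Big|_{\theta_0}.$$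 Moreover $$\lim_{N\to\infty}N^2\bigl[\mathrm{MSE}(\hat\theta)-\mathrm{MSE}(\hat\theta^{ML})\bigr]=\|\mathrm{XBias}\|_2^2+\mathrm{Tr}[\mathrm{XVar}]+\mathrm{Tr}[\mathrm{XVarHPE}].$$ -/

import Mathlib

open MeasureTheory ProbabilityTheory Filter Topology Asymptotics
open scoped Matrix

noncomputable section

/-- `ℝᵐ` with the Euclidean norm and Lebesgue measure. -/
abbrev Vec (m : ℕ) : Type := EuclideanSpace ℝ (Fin m)

/-- Multiplication of a Euclidean vector by a matrix. -/
def mulV {k m : ℕ} (A : Matrix (Fin k) (Fin m) ℝ) (x : Vec m) : Vec k :=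
  WithLp.toLp 2 (A *ᵥ x.ofLp)

/-- Jacobian matrix: the `(i, j)` entry is `∂fᵢ/∂xⱼ`. -/
def jacobian {m k : ℕ} (f : Vec m → Vec k) (x : Vec m) : Matrix (Fin k) (Fin m) ℝ :=
  Matrix.of fun i j => fderiv ℝ f x (EuclideanSpace.single j 1) i

/-- Cross covariance matrix `E[(a - E a)(b - E b)ᵀ]` of random vectors. -/
def crossCov {Ω : Type*} [MeasurableSpace Ω] (μ : Measure Ω) {n : ℕ} (a b : Ω → Vec n) :
    Matrix (Fin n) (Fin n) ℝ :=
  Matrix.of fun i j => covariance (fun ω => a ω i) (fun ω => b ω j) μ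

/-- `v vᵀ`. -/
def outer {n : ℕ} (v : Vec n) : Matrix (Fin n) (Fin n) ℝ := Matrix.vecMulVec v.ofLp v.ofLp

/-! ### The FIR model and the estimators -/

/-- The regression matrix: `N × n`, lower triangular Toeplitz, with first column
`u(0), …, u(N-1)`. -/
def regressor (u : ℕ → ℝ) (n N : ℕ) : Matrix (Fin N) (Fin n) ℝ :=
  Matrix.of fun t k => if k.val ≤ t.val then u (t.val - k.val) else 0

/-- `ΦᵀΦ`. -/
def gram (u : ℕ → ℝ) (n N : ℕ) : Matrix (Fin n) (Fin n) ℝ :=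
  (regressor u n N)ᵀ * regressor u n N

/-- The measured output `Y = Φ θ₀ + E` with sample size `N`; `e t` is the noise in the row `t`. -/
def output {Ω : Type*} (u : ℕ → ℝ) (e : ℕ → Ω → ℝ) {n : ℕ} (θ₀ : Vec n) (N : ℕ) (ω : Ω) : Vec N :=
  mulV (regressor u n N) θ₀ + WithLp.toLp 2 (fun t : Fin N => e t ω)

/-- The maximum likelihood estimate `(ΦᵀΦ)⁻¹ Φᵀ Y`. -/
def mle (u : ℕ → ℝ) (n N : ℕ) (Y : Vec N) : Vec n :=
  mulV ((gram u n N)⁻¹ * (regressor u n N)ᵀ) Y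

/-- The density of `N(Φ θ, σ² I_N)` at `Y`. -/
def likelihood (u : ℕ → ℝ) (σ : ℝ) {n N : ℕ} (Y : Vec N) (θ : Vec n) : ℝ :=
  (2 * Real.pi * σ ^ 2) ^ (-(N : ℝ) / 2) *
    Real.exp (-‖Y - mulV (regressor u n N) θ‖ ^ 2 / (2 * σ ^ 2))

/-- The Bayes estimate for the weighting function `w · η`, at the data `Y`. -/
def ebEstimate (u : ℕ → ℝ) (σ : ℝ) {n p : ℕ} (w : Vec n → Vec p → ℝ) {N : ℕ}
    (Y : Vec N) (η : Vec p) : Vec n :=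
  (∫ θ : Vec n, likelihood u σ Y θ * w θ η)⁻¹ •
    ∫ θ : Vec n, (likelihood u σ Y θ * w θ η) • θ

/-- The integrals in the Bayes estimate exist and its denominator is positive. -/
def EBWellDefined (u : ℕ → ℝ) (σ : ℝ) {n p : ℕ} (w : Vec n → Vec p → ℝ) {N : ℕ}
    (Y : Vec N) (η : Vec p) : Prop :=
  Integrable (fun θ : Vec n => likelihood u σ Y θ * w θ η) ∧
  Integrable (fun θ : Vec n => (likelihood u σ Y θ * w θ η) • θ) ∧
  0 < ∫ θ : Vec n, likelihood u σ Y θ * w θ η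

/-- The Bayes estimate as a function of the value `x` of the maximum likelihood estimate: it is
evaluated at the data `Φ x`, whose maximum likelihood estimate is `x`. It does not matter which
data with this maximum likelihood estimate are taken, see `ebEstimate_eq_ebOfMLE` below. -/
def ebOfMLE (u : ℕ → ℝ) (σ : ℝ) {n p : ℕ} (w : Vec n → Vec p → ℝ) (N : ℕ)
    (x : Vec n) (η : Vec p) : Vec n :=
  ebEstimate u σ w (mulV (regressor u n N) x) η

theorem mulV_mulV {k m l : ℕ} (A : Matrix (Fin k) (Fin m) ℝ) (B : Matrix (Fin m) (Fin l) ℝ)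
    (x : Vec l) : mulV A (mulV B x) = mulV (A * B) x := by
  simp [mulV, Matrix.mulVec_mulVec]

theorem mulV_sub {k m : ℕ} (A : Matrix (Fin k) (Fin m) ℝ) (x y : Vec m) :
    mulV A (x - y) = mulV A x - mulV A y := by
  simp [mulV, Matrix.mulVec_sub]

theorem mle_regressor (u : ℕ → ℝ) {n N : ℕ} (h : IsUnit (gram u n N).det) (x : Vec n) :
    mle u n N (mulV (regressor u n N) x) = x := by
  have h1 : (gram u n N)⁻¹ * (regressor u n N)ᵀ * regressor u n N = 1 := by
    rw [Matrix.mul_assoc]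
    exact Matrix.nonsing_inv_mul _ h
  rw [mle, mulV_mulV, h1]
  simp [mulV]

theorem inner_mulV {k m : ℕ} (A : Matrix (Fin k) (Fin m) ℝ) (y : Vec k) (x : Vec m) :
    inner ℝ y (mulV A x) = inner ℝ (mulV Aᵀ y) x := by
  simp only [mulV, EuclideanSpace.inner_eq_star_dotProduct, star_trivial]
  rw [Matrix.mulVec_transpose, dotProduct_comm, Matrix.dotProduct_mulVec, dotProduct_comm]

theorem likelihood_eq (u : ℕ → ℝ) (σ : ℝ) {n N : ℕ} (h : IsUnit (gram u n N).det) (Y : Vec N)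
    (θ : Vec n) :
    likelihood u σ Y θ =
      Real.exp (-‖Y - mulV (regressor u n N) (mle u n N Y)‖ ^ 2 / (2 * σ ^ 2)) *
        likelihood u σ (mulV (regressor u n N) (mle u n N Y)) θ := by
  set Φ := regressor u n N
  set x := mle u n N Y with hx
  have hne : mulV Φᵀ (Y - mulV Φ x) = 0 := by
    have h1 : gram u n N * ((gram u n N)⁻¹ * Φᵀ) = Φᵀ := by
      rw [← Matrix.mul_assoc, Matrix.mul_nonsing_inv _ h, Matrix.one_mul]
    have h2 : mulV Φᵀ (mulV Φ x) = mulV Φᵀ Y := by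
      rw [mulV_mulV, hx, mle, mulV_mulV]
      change mulV (gram u n N * ((gram u n N)⁻¹ * Φᵀ)) Y = _
      rw [h1]
    rw [mulV_sub, h2, sub_self]
  have horth : inner ℝ (Y - mulV Φ x) (mulV Φ x - mulV Φ θ) = 0 := by
    rw [← mulV_sub, inner_mulV, hne, inner_zero_left]
  have hpyth : ‖Y - mulV Φ θ‖ ^ 2 = ‖Y - mulV Φ x‖ ^ 2 + ‖mulV Φ x - mulV Φ θ‖ ^ 2 := by
    have h3 : Y - mulV Φ θ = (Y - mulV Φ x) + (mulV Φ x - mulV Φ θ) := by abel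
    rw [h3, norm_add_sq_real, horth]
    ring
  have hexp : Real.exp (-‖Y - mulV Φ θ‖ ^ 2 / (2 * σ ^ 2)) =
      Real.exp (-‖Y - mulV Φ x‖ ^ 2 / (2 * σ ^ 2)) *
        Real.exp (-‖mulV Φ x - mulV Φ θ‖ ^ 2 / (2 * σ ^ 2)) := by
    rw [← Real.exp_add, hpyth]
    congr 1
    ring
  change _ * Real.exp (-‖Y - mulV Φ θ‖ ^ 2 / (2 * σ ^ 2)) = _ * (_ * Real.exp _)
  rw [hexp]
  ring

/-- The Bayes estimate depends on the data through the maximum likelihood estimate only. -/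
theorem ebEstimate_eq_ebOfMLE (u : ℕ → ℝ) (σ : ℝ) {n p : ℕ} (w : Vec n → Vec p → ℝ) {N : ℕ}
    (h : IsUnit (gram u n N).det) (Y : Vec N) (η : Vec p) :
    ebEstimate u σ w Y η = ebOfMLE u σ w N (mle u n N Y) η := by
  unfold ebOfMLE ebEstimate
  set c := Real.exp (-‖Y - mulV (regressor u n N) (mle u n N Y)‖ ^ 2 / (2 * σ ^ 2)) with hc
  have hc0 : c ≠ 0 := (Real.exp_pos _).ne'
  have h1 : ∀ θ : Vec n, likelihood u σ Y θ =
      c * likelihood u σ (mulV (regressor u n N) (mle u n N Y)) θ := likelihood_eq u σ h Y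
  simp only [h1, mul_assoc, integral_const_mul, mul_smul, integral_smul]
  rw [mul_inv, smul_smul, mul_right_comm, inv_mul_cancel₀ hc0, one_mul]

/-! ### The estimators as random vectors, their mean squared errors, and the error terms -/

section Random

variable {Ω : Type*} [MeasurableSpace Ω]

/-- The maximum likelihood estimator `θ̂ᴹᴸ`. -/
def mlRV (u : ℕ → ℝ) (e : ℕ → Ω → ℝ) {n : ℕ} (θ₀ : Vec n) (N : ℕ) (ω : Ω) : Vec n :=
  mle u n N (output u e θ₀ N ω)

/-- The empirical Bayes estimator `θ̂ᴱᴮ(η̂(θ̂ᴹᴸ))`. -/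
def ebRV (u : ℕ → ℝ) (e : ℕ → Ω → ℝ) (σ : ℝ) {n p : ℕ} (w : Vec n → Vec p → ℝ)
    (ηhat : ℕ → Vec n → Vec p) (θ₀ : Vec n) (N : ℕ) (ω : Ω) : Vec n :=
  ebEstimate u σ w (output u e θ₀ N ω) (ηhat N (mlRV u e θ₀ N ω))

/-- `θ̂ᴱᴮ(η̂(θ₀))`: the hyper-parameter is frozen at `η̂(θ₀)`. -/
def ebFrozenRV (u : ℕ → ℝ) (e : ℕ → Ω → ℝ) (σ : ℝ) {n p : ℕ} (w : Vec n → Vec p → ℝ)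
    (ηhat : ℕ → Vec n → Vec p) (θ₀ : Vec n) (N : ℕ) (ω : Ω) : Vec n :=
  ebEstimate u σ w (output u e θ₀ N ω) (ηhat N θ₀)

/-- Mean squared error `E ‖θ̂ - θ₀‖²`. -/
def mse (μ : Measure Ω) {n : ℕ} (θ₀ : Vec n) (est : Ω → Vec n) : ℝ :=
  ∫ ω, ‖est ω - θ₀‖ ^ 2 ∂μ

variable (μ : Measure Ω) (u : ℕ → ℝ) (e : ℕ → Ω → ℝ) (σ : ℝ) {n p : ℕ} (w : Vec n → Vec p → ℝ)
  (ηhat : ℕ → Vec n → Vec p) (θ₀ : Vec n) (N : ℕ)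

/-- `Υ_Bias = E[θ̂ᴱᴮ(η̂(θ₀))] - θ₀`. -/
def upsBias : Vec n := (∫ ω, ebFrozenRV u e σ w ηhat θ₀ N ω ∂μ) - θ₀

/-- `Υ_Var`. -/
def upsVar : Matrix (Fin n) (Fin n) ℝ :=
  crossCov μ (fun ω => ebFrozenRV u e σ w ηhat θ₀ N ω - mlRV u e θ₀ N ω) (mlRV u e θ₀ N) +
  crossCov μ (mlRV u e θ₀ N) (fun ω => ebFrozenRV u e σ w ηhat θ₀ N ω - mlRV u e θ₀ N ω)

/-- `Υ_VarHPE`. -/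
def upsVarHPE : Matrix (Fin n) (Fin n) ℝ :=
  crossCov μ (fun ω => ebRV u e σ w ηhat θ₀ N ω - ebFrozenRV u e σ w ηhat θ₀ N ω)
    (mlRV u e θ₀ N) +
  crossCov μ (mlRV u e θ₀ N)
    (fun ω => ebRV u e σ w ηhat θ₀ N ω - ebFrozenRV u e σ w ηhat θ₀ N ω)

/-- `Υ_HOT`. -/
def upsHOT : Matrix (Fin n) (Fin n) ℝ :=
  crossCov μ (fun ω => ebRV u e σ w ηhat θ₀ N ω - mlRV u e θ₀ N ω)
    (fun ω => ebRV u e σ w ηhat θ₀ N ω - mlRV u e θ₀ N ω) +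
  outer ((∫ ω, ebRV u e σ w ηhat θ₀ N ω ∂μ) - θ₀) -
  outer ((∫ ω, ebFrozenRV u e σ w ηhat θ₀ N ω ∂μ) - θ₀)

end Random

/-! ### The limits -/

/-- `b(η) = σ² Σ⁻¹ ∂ log w(θ|η)/∂θ` at `θ₀`. -/
def limB {n p : ℕ} (σ : ℝ) (S : Matrix (Fin n) (Fin n) ℝ) (w : Vec n → Vec p → ℝ)
    (θ₀ : Vec n) (η : Vec p) : Vec n :=
  σ ^ 2 • mulV S⁻¹ (gradient (fun θ => Real.log (w θ η)) θ₀)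

/-- `σ² Σ⁻¹ ∂² log w(θ|η)/∂θ∂θᵀ` at `θ₀`. -/
def limBθ {n p : ℕ} (σ : ℝ) (S : Matrix (Fin n) (Fin n) ℝ) (w : Vec n → Vec p → ℝ)
    (θ₀ : Vec n) (η : Vec p) : Matrix (Fin n) (Fin n) ℝ :=
  σ ^ 2 • (S⁻¹ * jacobian (fun θ => gradient (fun θ' => Real.log (w θ' η)) θ) θ₀)

/-- `σ² Σ⁻¹ ∂² log w(θ|η)/∂θ∂ηᵀ` at `θ₀`. -/
def limBη {n p : ℕ} (σ : ℝ) (S : Matrix (Fin n) (Fin n) ℝ) (w : Vec n → Vec p → ℝ)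
    (θ₀ : Vec n) (η : Vec p) : Matrix (Fin n) (Fin p) ℝ :=
  σ ^ 2 • (S⁻¹ * jacobian (fun η' => gradient (fun θ => Real.log (w θ η')) θ₀) η)

/-- `XBias`. -/
def xBias {n p : ℕ} (σ : ℝ) (S : Matrix (Fin n) (Fin n) ℝ) (w : Vec n → Vec p → ℝ)
    (θ₀ : Vec n) (ηstar : Vec p) : Vec n :=
  limB σ S w θ₀ ηstar

/-- `XVar`, the sum of `σ² b'_θ(η⋆) Σ⁻¹` and its transpose. -/
def xVar {n p : ℕ} (σ : ℝ) (S : Matrix (Fin n) (Fin n) ℝ) (w : Vec n → Vec p → ℝ)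
    (θ₀ : Vec n) (ηstar : Vec p) : Matrix (Fin n) (Fin n) ℝ :=
  σ ^ 2 • (limBθ σ S w θ₀ ηstar * S⁻¹) + (σ ^ 2 • (limBθ σ S w θ₀ ηstar * S⁻¹))ᵀ

/-- `XVarHPE`, the sum of `σ² b'_η(η⋆) D' Σ⁻¹` and its transpose. -/
def xVarHPE {n p : ℕ} (σ : ℝ) (S : Matrix (Fin n) (Fin n) ℝ) (w : Vec n → Vec p → ℝ)
    (θ₀ : Vec n) (ηstar : Vec p) (D' : Matrix (Fin p) (Fin n) ℝ) : Matrix (Fin n) (Fin n) ℝ :=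
  σ ^ 2 • (limBη σ S w θ₀ ηstar * D' * S⁻¹) + (σ ^ 2 • (limBη σ S w θ₀ ηstar * D' * S⁻¹))ᵀ

end

set_option linter.unusedSectionVars false

/-! ### Uniform strict differentiability of a sequence of functions -/

section UnifStrict

variable {E F G : Type*} [NormedAddCommGroup E] [NormedSpace ℝ E] [NormedAddCommGroup F]
  [NormedSpace ℝ F] [NormedAddCommGroup G] [NormedSpace ℝ G]

/-! As a function of the value `x` of the maximum likelihood estimate, the posterior mean is `x`
plus the mean of `θ - x` under a Gaussian kernel centred at `x` and weighted by `w`. The kernel has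
precision `M = σ⁻² ΦᵀΦ`, of order `N`. Integration by parts
(`IsPrecision.map_integral_gaussKernel_smul`) trades the factor `M (θ - x)` for a gradient of the
weight. Hence `N` times the shift is `N M⁻¹`, which tends to `σ² Σ⁻¹`, applied to a ratio of
Gaussian averages of `∂w/∂θ` and `w`. The kernel concentrates at `x`, so the limit is `σ² Σ⁻¹ ∂ log
w/∂θ`.

Limits of values alone do not suffice, since derivatives in `x` and `η` and expansions along a
moving hyper-parameter are needed as well. All of them follow from one mode of convergence,
`UnifStrictDiff`, proved jointly in `(x, η)` in `unifStrictDiff_posterior`. A cutoff splits `w` into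
a compactly supported `C²` part, whose averages are handled by `unifStrictDiff_average`, and a part
vanishing near `θ₀`. The latter contributes an exponentially small amount, which beats the
polynomial growth of the normalizing constant (`unifStrictDiff_far`). Because the integration by
parts comes first, only one derivative of `∂w/∂θ` is used, and `C²` regularity is enough.

On the random side, the error `ξ` of the maximum likelihood estimator is a centred Gaussian of size
`N^(-1/2)`, so the event `δ ≤ ‖ξ‖` has probability smaller than any power of `N`. By Hölder's
inequality this event is negligible for second moments of anything bounded in `Lʳ` with `r > 2`
(`RootConsistent.tailNegligible`). The empirical Bayes estimator has such a bound by assumption; for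
the frozen one, linear growth in `x` (`exists_norm_posterior_le`) does the same job.

On `‖ξ‖ < δ` the deterministic expansion applies. The scaled shifts of both estimators converge to
the same constant `b`, which gives the bias and makes the higher order terms vanish. Up to `o(‖ξ‖)`
the frozen scaled shift is affine in `ξ`, and the scaled difference of the two estimators is linear
in `ξ`. Integrating against `ξ`, whose scaled covariance tends to `σ² Σ⁻¹`, yields the two
covariance limits (`tendsto_integral_mul_coord`). Expanding the square around the maximum likelihood
estimator then gives the excess mean squared error (`tendsto_excess_mse`). -/

/-- Near `x₀` and for large `N`, the functions `φ N` are close to `a`, and they differ from the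
linear map `L` by a function with a small Lipschitz constant. -/
def UnifStrictDiff (φ : ℕ → E → F) (x₀ : E) (a : F) (L : E →L[ℝ] F) : Prop :=
  ∀ ε > 0, ∃ δ > 0, ∀ᶠ N in atTop, ∀ x ∈ Metric.ball x₀ δ,
    ‖φ N x - a‖ ≤ ε ∧ ∀ y ∈ Metric.ball x₀ δ, ‖φ N x - φ N y - L (x - y)‖ ≤ ε * ‖x - y‖

namespace UnifStrictDiff

variable {φ ψ : ℕ → E → F} {x₀ : E} {a b : F} {L K : E →L[ℝ] F}

theorem const {c : ℕ → F} (hc : Tendsto c atTop (𝓝 a)) :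
    UnifStrictDiff (fun N (_ : E) => c N) x₀ a 0 := by
  intro ε hε
  refine ⟨1, one_pos, ?_⟩
  filter_upwards [Metric.tendsto_nhds.1 hc ε hε] with N hN x _
  refine ⟨by rw [← dist_eq_norm]; exact hN.le, fun y _ => ?_⟩
  simp only [sub_self, zero_apply, norm_zero]
  positivity

theorem add (h : UnifStrictDiff φ x₀ a L) (h' : UnifStrictDiff ψ x₀ b K) :
    UnifStrictDiff (fun N x => φ N x + ψ N x) x₀ (a + b) (L + K) := by
  intro ε hε
  obtain ⟨δ, hδ, h1⟩ := h (ε / 2) (by positivity)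
  obtain ⟨δ', hδ', h2⟩ := h' (ε / 2) (by positivity)
  refine ⟨min δ δ', lt_min hδ hδ', ?_⟩
  filter_upwards [h1, h2] with N h1 h2 x hx
  obtain ⟨h3, h4⟩ := h1 x (Metric.ball_subset_ball (min_le_left _ _) hx)
  obtain ⟨h5, h6⟩ := h2 x (Metric.ball_subset_ball (min_le_right _ _) hx)
  refine ⟨?_, fun y hy => ?_⟩
  · calc ‖φ N x + ψ N x - (a + b)‖ = ‖(φ N x - a) + (ψ N x - b)‖ := by congr 1; abel
      _ ≤ ε / 2 + ε / 2 := (norm_add_le _ _).trans (add_le_add h3 h5)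
      _ = ε := by ring
  · have h7 := h4 y (Metric.ball_subset_ball (min_le_left _ _) hy)
    have h8 := h6 y (Metric.ball_subset_ball (min_le_right _ _) hy)
    calc ‖φ N x + ψ N x - (φ N y + ψ N y) - (L + K) (x - y)‖
        = ‖(φ N x - φ N y - L (x - y)) + (ψ N x - ψ N y - K (x - y))‖ := by
          congr 1; rw [add_apply]; abel
      _ ≤ ε / 2 * ‖x - y‖ + ε / 2 * ‖x - y‖ := (norm_add_le _ _).trans (add_le_add h7 h8)
      _ = ε * ‖x - y‖ := by ring

theorem prodMk {ψ : ℕ → E → G} {b : G} {K : E →L[ℝ] G} (h : UnifStrictDiff φ x₀ a L)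
    (h' : UnifStrictDiff ψ x₀ b K) :
    UnifStrictDiff (fun N x => (φ N x, ψ N x)) x₀ (a, b) (L.prod K) := by
  intro ε hε
  obtain ⟨δ, hδ, h1⟩ := h ε hε
  obtain ⟨δ', hδ', h2⟩ := h' ε hε
  refine ⟨min δ δ', lt_min hδ hδ', ?_⟩
  filter_upwards [h1, h2] with N h1 h2 x hx
  obtain ⟨h3, h4⟩ := h1 x (Metric.ball_subset_ball (min_le_left _ _) hx)
  obtain ⟨h5, h6⟩ := h2 x (Metric.ball_subset_ball (min_le_right _ _) hx)
  refine ⟨max_le h3 h5, fun y hy => max_le (h4 y ?_) (h6 y ?_)⟩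
  · exact Metric.ball_subset_ball (min_le_left _ _) hy
  · exact Metric.ball_subset_ball (min_le_right _ _) hy

theorem congr (h : UnifStrictDiff φ x₀ a L) {δ : ℝ} (hδ : 0 < δ)
    (hφ : ∀ᶠ N in atTop, ∀ x ∈ Metric.ball x₀ δ, φ N x = ψ N x) : UnifStrictDiff ψ x₀ a L := by
  intro ε hε
  obtain ⟨δ', hδ', h1⟩ := h ε hε
  refine ⟨min δ δ', lt_min hδ hδ', ?_⟩
  filter_upwards [h1, hφ] with N h1 h2 x hx
  obtain ⟨h3, h4⟩ := h1 x (Metric.ball_subset_ball (min_le_right _ _) hx)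
  rw [← h2 x (Metric.ball_subset_ball (min_le_left _ _) hx)]
  refine ⟨h3, fun y hy => ?_⟩
  rw [← h2 y (Metric.ball_subset_ball (min_le_left _ _) hy)]
  exact h4 y (Metric.ball_subset_ball (min_le_right _ _) hy)

/-- The points `φ N x` and `φ N y` are merely close to `a`, and neither equals it, so `Ψ` must be
strictly differentiable there. The closeness half of the definition places both points where the
strict estimate holds. -/
theorem comp (h : UnifStrictDiff φ x₀ a L) {Ψ : F → G} {Ψ' : F →L[ℝ] G}
    (hΨ : HasStrictFDerivAt Ψ Ψ' a) :
    UnifStrictDiff (fun N x => Ψ (φ N x)) x₀ (Ψ a) (Ψ'.comp L) := by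
  intro ε hε
  -- Half of `ε` is spent on the nonlinearity of `Ψ`, measured against the Lipschitz constant `‖L‖ +
  -- 1` of `φ N`; the other half on the error of `φ N` transported by `Ψ'`.
  set ε₁ : ℝ := ε / (2 * (‖L‖ + 1)) with hε₁
  have hL : 0 < ‖L‖ + 1 := by positivity
  have hε₁0 : 0 < ε₁ := by positivity
  obtain ⟨ρ, hρ, hb⟩ := Metric.eventually_nhds_iff_ball.1 (hΨ.isLittleO.bound hε₁0)
  obtain ⟨ρ', hρ', hb'⟩ := Metric.continuousAt_iff.1 hΨ.continuousAt ε hε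
  -- The bound `1` yields the Lipschitz constant `‖L‖ + 1`, the second entry controls the error
  -- after applying `Ψ'`, and the last two keep the values inside the balls of radius `ρ` and `ρ'`.
  set ε₂ : ℝ := min (min 1 (ε / (2 * (‖Ψ'‖ + 1)))) (min (ρ / 2) (ρ' / 2)) with hε₂
  have hε₂0 : 0 < ε₂ := by positivity
  obtain ⟨δ, hδ, h1⟩ := h ε₂ hε₂0
  refine ⟨δ, hδ, ?_⟩
  filter_upwards [h1] with N h1 x hx
  have hnear : ∀ y ∈ Metric.ball x₀ δ, dist (φ N y) a < ρ ∧ dist (φ N y) a < ρ' := by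
    intro y hy
    rw [dist_eq_norm]
    have := (h1 y hy).1
    have h2 : ε₂ ≤ ρ / 2 := (min_le_right _ _).trans (min_le_left _ _)
    have h3 : ε₂ ≤ ρ' / 2 := (min_le_right _ _).trans (min_le_right _ _)
    constructor <;> linarith
  refine ⟨by rw [← dist_eq_norm]; exact (hb' (hnear x hx).2).le, fun y hy => ?_⟩
  have h2 := (h1 x hx).2 y hy
  have hε₂1 : ε₂ ≤ 1 := (min_le_left _ _).trans (min_le_left _ _)
  have hε₂2 : ε₂ ≤ ε / (2 * (‖Ψ'‖ + 1)) := (min_le_left _ _).trans (min_le_right _ _)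
  have h3 : ‖φ N x - φ N y‖ ≤ (‖L‖ + 1) * ‖x - y‖ := by
    calc ‖φ N x - φ N y‖ = ‖(φ N x - φ N y - L (x - y)) + L (x - y)‖ := by congr 1; abel
      _ ≤ ε₂ * ‖x - y‖ + ‖L‖ * ‖x - y‖ :=
        (norm_add_le _ _).trans (add_le_add h2 (L.le_opNorm _))
      _ ≤ 1 * ‖x - y‖ + ‖L‖ * ‖x - y‖ := by gcongr
      _ = _ := by ring
  have h4 : ‖Ψ (φ N x) - Ψ (φ N y) - Ψ' (φ N x - φ N y)‖ ≤ ε₁ * ‖φ N x - φ N y‖ := by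
    refine hb (φ N x, φ N y) ?_
    rw [Metric.mem_ball, Prod.dist_eq]
    exact max_lt (hnear x hx).1 (hnear y hy).1
  calc ‖Ψ (φ N x) - Ψ (φ N y) - (Ψ'.comp L) (x - y)‖
      = ‖(Ψ (φ N x) - Ψ (φ N y) - Ψ' (φ N x - φ N y)) + Ψ' (φ N x - φ N y - L (x - y))‖ := by
        congr 1
        simp only [ContinuousLinearMap.comp_apply, map_sub]
        abel
    _ ≤ ε₁ * ((‖L‖ + 1) * ‖x - y‖) + ‖Ψ'‖ * (ε₂ * ‖x - y‖) := by
        refine (norm_add_le _ _).trans (add_le_add (h4.trans ?_) ((Ψ'.le_opNorm _).trans ?_))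
        · gcongr
        · gcongr
    _ ≤ ε₁ * ((‖L‖ + 1) * ‖x - y‖) + (‖Ψ'‖ + 1) * (ε / (2 * (‖Ψ'‖ + 1)) * ‖x - y‖) := by
        gcongr
        linarith
    _ = ε * ‖x - y‖ := by
        rw [hε₁]
        have : ‖Ψ'‖ + 1 ≠ 0 := by positivity
        field_simp
        ring

theorem tendsto (h : UnifStrictDiff φ x₀ a L) {x : ℕ → E} (hx : Tendsto x atTop (𝓝 x₀)) :
    Tendsto (fun N => φ N (x N)) atTop (𝓝 a) := by
  refine Metric.tendsto_nhds.2 fun ε hε => ?_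
  obtain ⟨δ, hδ, h1⟩ := h (ε / 2) (by positivity)
  filter_upwards [h1, Metric.tendsto_nhds.1 hx δ hδ] with N h1 h2
  rw [dist_eq_norm]
  linarith [(h1 _ h2).1]

/-- Used for the slices `x ↦ (x, η)` and `y ↦ (θ₀, y)`, which turn joint convergence into
convergence of partial derivatives. -/
theorem comp_affine {H : Type*} [NormedAddCommGroup H] [NormedSpace ℝ H]
    (h : UnifStrictDiff φ x₀ a L) {g : H → E} {A : H →L[ℝ] E} {t₀ : H} (hg0 : g t₀ = x₀)
    (hg : ∀ s t, g s - g t = A (s - t)) :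
    UnifStrictDiff (fun N t => φ N (g t)) t₀ a (L.comp A) := by
  intro ε hε
  have hA : 0 < ‖A‖ + 1 := by positivity
  obtain ⟨δ, hδ, h1⟩ := h (min ε (ε / (‖A‖ + 1))) (by positivity)
  have hle : ∀ s t, ‖g s - g t‖ ≤ (‖A‖ + 1) * ‖s - t‖ := fun s t => by
    rw [hg]
    refine (A.le_opNorm _).trans ?_
    gcongr
    linarith
  have hmem : ∀ t ∈ Metric.ball t₀ (δ / (‖A‖ + 1)), g t ∈ Metric.ball x₀ δ := fun t ht => by
    rw [mem_ball_iff_norm] at ht ⊢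
    rw [← hg0]
    refine (hle _ _).trans_lt ?_
    rwa [lt_div_iff₀' hA] at ht
  refine ⟨δ / (‖A‖ + 1), by positivity, ?_⟩
  filter_upwards [h1] with N h1 t ht
  obtain ⟨h2, h3⟩ := h1 _ (hmem t ht)
  refine ⟨h2.trans (min_le_left _ _), fun s hs => ?_⟩
  have h4 := h3 _ (hmem s hs)
  rw [hg] at h4
  refine h4.trans ?_
  calc min ε (ε / (‖A‖ + 1)) * ‖A (t - s)‖
      ≤ ε / (‖A‖ + 1) * ((‖A‖ + 1) * ‖t - s‖) := by
        gcongr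
        · exact min_le_right _ _
        · rw [← hg]; exact hle _ _
    _ = ε * ‖t - s‖ := by field_simp

/-- A small Lipschitz constant of `φ N - L` near `x₀` bounds its derivative there. Differentiability
is a separate hypothesis because, for a fixed `N`, the definition gives a bound for a given `ε` only
and not an actual derivative. -/
theorem tendsto_fderiv (h : UnifStrictDiff φ x₀ a L)
    (hd : ∀ᶠ N in atTop, DifferentiableAt ℝ (φ N) x₀) :
    Tendsto (fun N => fderiv ℝ (φ N) x₀) atTop (𝓝 L) := by
  refine Metric.tendsto_nhds.2 fun ε hε => ?_
  obtain ⟨δ, hδ, h1⟩ := h (ε / 2) (by positivity)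
  filter_upwards [h1, hd] with N h1 hd
  rw [dist_eq_norm]
  have h2 : HasFDerivAt (fun x => φ N x - L x) (fderiv ℝ (φ N) x₀ - L) x₀ :=
    hd.hasFDerivAt.sub L.hasFDerivAt
  refine lt_of_le_of_lt (h2.le_of_lip' (C := ε / 2) (by positivity) ?_) (by linarith)
  filter_upwards [Metric.ball_mem_nhds x₀ hδ] with x hx
  have h3 := (h1 x hx).2 x₀ (Metric.mem_ball_self hδ)
  rw [map_sub] at h3
  calc ‖φ N x - L x - (φ N x₀ - L x₀)‖ = ‖φ N x - φ N x₀ - (L x - L x₀)‖ := by congr 1; abel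
    _ ≤ _ := h3

end UnifStrictDiff

end UnifStrict

/-! ### The Gaussian kernel with a given precision operator -/

section Kernel

variable {n : ℕ}

/-- The unnormalized centred Gaussian density with precision operator `M`. -/
noncomputable def gaussKernel (M : Vec n →L[ℝ] Vec n) (z : Vec n) : ℝ :=
  Real.exp (-(inner ℝ (M z) z) / 2)

/-- `M` is symmetric, with spectrum in `[a, b]`. -/
structure IsPrecision (M : Vec n →L[ℝ] Vec n) (a b : ℝ) : Prop where
  pos : 0 < a
  pos' : 0 < b
  symm : ∀ x y, inner ℝ (M x) y = inner ℝ x (M y)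
  lower : ∀ z, a * ‖z‖ ^ 2 ≤ inner ℝ (M z) z
  upper : ‖M‖ ≤ b

theorem gaussKernel_pos (M : Vec n →L[ℝ] Vec n) (z : Vec n) : 0 < gaussKernel M z :=
  Real.exp_pos _

theorem continuous_gaussKernel (M : Vec n →L[ℝ] Vec n) : Continuous (gaussKernel M) := by
  unfold gaussKernel
  fun_prop

theorem integral_exp_neg_mul_sq (c : ℝ) (hc : 0 < c) :
    ∫ z : Vec n, Real.exp (-c * ‖z‖ ^ 2) = (Real.pi / c) ^ ((n : ℝ) / 2) := by
  have := GaussianFourier.integral_rexp_neg_mul_sq_norm (V := Vec n) hc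
  simpa using this

/-- The Bochner integral of a non-integrable function is zero, whereas the closed form is positive.
-/
theorem integrable_exp_neg_mul_sq_norm {c : ℝ} (hc : 0 < c) :
    Integrable fun z : Vec n => Real.exp (-c * ‖z‖ ^ 2) := by
  by_contra h
  have h1 := integral_undef h
  rw [integral_exp_neg_mul_sq c hc] at h1
  have : 0 < (Real.pi / c) ^ ((n : ℝ) / 2) := by positivity
  linarith

/-- A differentiable kernel with Gaussian decay. -/
structure HasGaussDecay {V : Type*} [NormedAddCommGroup V] [NormedSpace ℝ V] (k : Vec n → V)
    (a C : ℝ) : Prop where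
  diff : Differentiable ℝ k
  le : ∀ z, ‖k z‖ ≤ C * ((1 + ‖z‖ ^ 2) * Real.exp (-(a / 2) * ‖z‖ ^ 2))
  fderiv_le : ∀ z, ‖fderiv ℝ k z‖ ≤ C * ((1 + ‖z‖ ^ 2) * Real.exp (-(a / 2) * ‖z‖ ^ 2))

namespace IsPrecision

variable {M : Vec n →L[ℝ] Vec n} {a b : ℝ}

theorem gaussKernel_le (h : IsPrecision M a b) (z : Vec n) :
    gaussKernel M z ≤ Real.exp (-(a / 2) * ‖z‖ ^ 2) := by
  refine Real.exp_le_exp.2 ?_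
  linarith [h.lower z]

theorem le_gaussKernel (h : IsPrecision M a b) (z : Vec n) :
    Real.exp (-(b / 2) * ‖z‖ ^ 2) ≤ gaussKernel M z := by
  refine Real.exp_le_exp.2 ?_
  have h1 : inner ℝ (M z) z ≤ b * ‖z‖ ^ 2 := by
    calc inner ℝ (M z) z ≤ ‖M z‖ * ‖z‖ := real_inner_le_norm _ _
      _ ≤ (b * ‖z‖) * ‖z‖ := by
        gcongr
        exact (M.le_opNorm z).trans (by gcongr; exact h.upper)
      _ = b * ‖z‖ ^ 2 := by ring
  linarith

theorem norm_apply_le (h : IsPrecision M a b) (z : Vec n) : ‖M z‖ ≤ b * ‖z‖ :=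
  (M.le_opNorm z).trans (by gcongr; exact h.upper)

theorem integrable_gaussKernel (h : IsPrecision M a b) : Integrable (gaussKernel M) := by
  refine (integrable_exp_neg_mul_sq_norm (half_pos h.pos)).mono'
    (continuous_gaussKernel M).aestronglyMeasurable (ae_of_all _ fun z => ?_)
  rw [Real.norm_of_nonneg (gaussKernel_pos M z).le]
  exact h.gaussKernel_le z

theorem le_integral_gaussKernel (h : IsPrecision M a b) :
    (Real.pi / (b / 2)) ^ ((n : ℝ) / 2) ≤ ∫ z, gaussKernel M z := by
  rw [← integral_exp_neg_mul_sq _ (half_pos h.pos')]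
  exact integral_mono (integrable_exp_neg_mul_sq_norm (half_pos h.pos')) h.integrable_gaussKernel
    h.le_gaussKernel

theorem integral_gaussKernel_pos (h : IsPrecision M a b) : 0 < ∫ z, gaussKernel M z := by
  have := h.pos'
  exact lt_of_lt_of_le (by positivity) h.le_integral_gaussKernel

/-- Half of the exponent pays for the quadratic factor, by `t ≤ exp t` at `t = a / 4 * ‖z‖ ^ 2`. -/
theorem gaussKernel_mul_sq_le (h : IsPrecision M a b) (z : Vec n) :
    gaussKernel M z * ‖z‖ ^ 2 ≤ 4 / a * Real.exp (-(a / 4) * ‖z‖ ^ 2) := by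
  have ha := h.pos
  calc gaussKernel M z * ‖z‖ ^ 2
      ≤ Real.exp (-(a / 2) * ‖z‖ ^ 2) * ‖z‖ ^ 2 := by gcongr; exact h.gaussKernel_le z
    _ = 4 / a * (Real.exp (-(a / 2) * ‖z‖ ^ 2) * (a / 4 * ‖z‖ ^ 2)) := by field_simp
    _ ≤ 4 / a * (Real.exp (-(a / 2) * ‖z‖ ^ 2) * Real.exp (a / 4 * ‖z‖ ^ 2)) := by
        gcongr
        linarith [Real.add_one_le_exp (a / 4 * ‖z‖ ^ 2)]
    _ = 4 / a * Real.exp (-(a / 4) * ‖z‖ ^ 2) := by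
        rw [← Real.exp_add]
        ring_nf

theorem integrable_gaussKernel_mul_sq (h : IsPrecision M a b) :
    Integrable fun z => gaussKernel M z * ‖z‖ ^ 2 := by
  have ha := h.pos
  refine ((integrable_exp_neg_mul_sq_norm (n := n) (c := a / 4) (by positivity)).const_mul
    (4 / a)).mono' ((continuous_gaussKernel M).mul (by fun_prop)).aestronglyMeasurable
    (ae_of_all _ fun z => ?_)
  rw [Real.norm_of_nonneg (mul_nonneg (gaussKernel_pos M z).le (by positivity))]
  exact h.gaussKernel_mul_sq_le z

/-- The constant is `1 / a` times a function of the ratio `b / a`. With the bounds `a * N` and `b *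
N` it is therefore of order `1 / N`, which expresses the concentration of the normalized kernel. -/
theorem integral_gaussKernel_mul_sq_le (h : IsPrecision M a b) :
    ∫ z, gaussKernel M z * ‖z‖ ^ 2 ≤
      4 / a * (2 * b / a) ^ ((n : ℝ) / 2) * ∫ z, gaussKernel M z := by
  have ha := h.pos
  have hb := h.pos'
  calc ∫ z, gaussKernel M z * ‖z‖ ^ 2
      ≤ ∫ z : Vec n, 4 / a * Real.exp (-(a / 4) * ‖z‖ ^ 2) :=
        integral_mono h.integrable_gaussKernel_mul_sq
          ((integrable_exp_neg_mul_sq_norm (by positivity)).const_mul _) h.gaussKernel_mul_sq_le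
    _ = 4 / a * (Real.pi / (a / 4)) ^ ((n : ℝ) / 2) := by
        rw [integral_const_mul, integral_exp_neg_mul_sq _ (by positivity)]
    _ = 4 / a * (2 * b / a) ^ ((n : ℝ) / 2) * (Real.pi / (b / 2)) ^ ((n : ℝ) / 2) := by
        rw [mul_assoc, ← Real.mul_rpow (by positivity) (by positivity)]
        congr 2
        field_simp
        norm_num
    _ ≤ _ := by
        gcongr
        exact h.le_integral_gaussKernel

theorem hasFDerivAt_gaussKernel (h : IsPrecision M a b) (z : Vec n) :
    HasFDerivAt (gaussKernel M) (-(gaussKernel M z) • innerSL ℝ (M z)) z := by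
  have h1 : HasFDerivAt (fun z => inner ℝ (M z) z)
      ((fderivInnerCLM ℝ (M z, z)).comp (M.prod (ContinuousLinearMap.id ℝ _))) z :=
    M.hasFDerivAt.inner ℝ (hasFDerivAt_id z)
  have h2 : HasFDerivAt (gaussKernel M) _ z := ((h1.neg.mul_const (2⁻¹ : ℝ))).exp
  refine h2.congr_fderiv ?_
  ext v
  simp [fderivInnerCLM_apply, gaussKernel, div_eq_mul_inv]
  -- Symmetry of `M` makes the two halves of the derivative of the quadratic form equal, which
  -- cancels the factor `1 / 2`.
  rw [h.symm v z, real_inner_comm]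
  ring

theorem hasGaussDecay (h : IsPrecision M a b) : HasGaussDecay (gaussKernel M) a (1 + b) := by
  have hb := h.pos'
  refine ⟨fun z => (h.hasFDerivAt_gaussKernel z).differentiableAt, fun z => ?_, fun z => ?_⟩
  · rw [Real.norm_of_nonneg (gaussKernel_pos M z).le, ← mul_assoc]
    refine (h.gaussKernel_le z).trans (le_mul_of_one_le_left (Real.exp_pos _).le ?_)
    nlinarith [sq_nonneg ‖z‖]
  · rw [(h.hasFDerivAt_gaussKernel z).fderiv, norm_smul, norm_neg,
      Real.norm_of_nonneg (gaussKernel_pos M z).le, innerSL_apply_norm, ← mul_assoc]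
    calc gaussKernel M z * ‖M z‖
        ≤ Real.exp (-(a / 2) * ‖z‖ ^ 2) * (b * ‖z‖) := by
          gcongr
          · exact h.gaussKernel_le z
          · exact h.norm_apply_le z
      _ ≤ Real.exp (-(a / 2) * ‖z‖ ^ 2) * ((1 + b) * (1 + ‖z‖ ^ 2)) := by
          gcongr
          · linarith
          · nlinarith [sq_nonneg (‖z‖ - 1), norm_nonneg z]
      _ = _ := by ring

theorem hasGaussDecay_smul (h : IsPrecision M a b) :
    HasGaussDecay (fun z => gaussKernel M z • z) a (1 + b) := by
  have hb := h.pos'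
  have hd : ∀ z, HasFDerivAt (fun z => gaussKernel M z • z) _ z := fun z =>
    (h.hasFDerivAt_gaussKernel z).smul (hasFDerivAt_id z)
  refine ⟨fun z => (hd z).differentiableAt, fun z => ?_, fun z => ?_⟩
  · rw [norm_smul, Real.norm_of_nonneg (gaussKernel_pos M z).le, ← mul_assoc]
    calc gaussKernel M z * ‖z‖ ≤ Real.exp (-(a / 2) * ‖z‖ ^ 2) * ((1 + b) * (1 + ‖z‖ ^ 2)) := by
          gcongr
          · exact h.gaussKernel_le z
          · nlinarith [sq_nonneg (‖z‖ - 1), norm_nonneg z, sq_nonneg ‖z‖]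
      _ = _ := by ring
  · rw [(hd z).fderiv]
    refine (norm_add_le _ _).trans ?_
    have h1 : ‖gaussKernel M z • ContinuousLinearMap.id ℝ (Vec n)‖ ≤ gaussKernel M z := by
      rw [norm_smul, Real.norm_of_nonneg (gaussKernel_pos M z).le]
      exact mul_le_of_le_one_right (gaussKernel_pos M z).le ContinuousLinearMap.norm_id_le
    have h2 : ‖(-(gaussKernel M z) • innerSL ℝ (M z)).smulRight (id z)‖ ≤
        gaussKernel M z * (b * ‖z‖) * ‖z‖ := by
      rw [ContinuousLinearMap.norm_smulRight_apply, norm_smul, norm_neg,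
        Real.norm_of_nonneg (gaussKernel_pos M z).le, innerSL_apply_norm, id]
      have := gaussKernel_pos M z
      gcongr
      exact h.norm_apply_le z
    refine (add_le_add h1 h2).trans ?_
    calc gaussKernel M z + gaussKernel M z * (b * ‖z‖) * ‖z‖
        = gaussKernel M z * (1 + b * ‖z‖ ^ 2) := by ring
      _ ≤ Real.exp (-(a / 2) * ‖z‖ ^ 2) * ((1 + b) * (1 + ‖z‖ ^ 2)) := by
          gcongr
          · exact h.gaussKernel_le z
          · nlinarith [sq_nonneg ‖z‖]
      _ = _ := by ring

/-- Integration by parts against the Gaussian kernel. -/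
theorem map_integral_gaussKernel_smul (h : IsPrecision M a b) {f : Vec n → ℝ}
    (hf : ContDiff ℝ 1 f) (hc : HasCompactSupport f) :
    M (∫ z, (gaussKernel M z * f z) • z) = ∫ z, gaussKernel M z • gradient f z := by
  have hκ := continuous_gaussKernel M
  have hf0 := hf.continuous
  have hgrad : Continuous (gradient f) :=
    (InnerProductSpace.toDual ℝ (Vec n)).symm.continuous.comp (hf.continuous_fderiv one_ne_zero)
  have hgc : HasCompactSupport (gradient f) :=
    (hc.fderiv ℝ).comp_left (g := (InnerProductSpace.toDual ℝ (Vec n)).symm) (map_zero _)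
  have i1 : Integrable fun z => (gaussKernel M z * f z) • z :=
    Continuous.integrable_of_hasCompactSupport (by fun_prop) (hc.mul_left.smul_right)
  have i2 : Integrable fun z => gaussKernel M z • gradient f z :=
    Continuous.integrable_of_hasCompactSupport (by fun_prop)
      (HasCompactSupport.smul_left (f := gaussKernel M) (f' := gradient f) hgc)
  -- Pairing with `v` reduces the claim to scalar integration by parts in the direction `v`, along
  -- which the kernel has derivative `-κ ⟨M z, v⟩`.
  refine ext_inner_right ℝ fun v => ?_
  have e1 : inner ℝ (M (∫ z, (gaussKernel M z * f z) • z)) v =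
      ∫ z, (gaussKernel M z * inner ℝ (M z) v) * f z := by
    rw [h.symm, real_inner_comm, ← integral_inner i1]
    congr 1
    ext z
    rw [inner_smul_right, h.symm z v, real_inner_comm]
    ring
  have e2 : inner ℝ (∫ z, gaussKernel M z • gradient f z) v =
      ∫ z, gaussKernel M z * fderiv ℝ f z v := by
    rw [real_inner_comm, ← integral_inner i2]
    congr 1
    ext z
    rw [inner_smul_right, gradient, real_inner_comm, InnerProductSpace.toDual_symm_apply]
  rw [e1, e2, integral_mul_fderiv_eq_neg_fderiv_mul_of_integrable, ← integral_neg]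
  · congr 1
    ext z
    rw [(h.hasFDerivAt_gaussKernel z).fderiv]
    simp
  · simp_rw [(h.hasFDerivAt_gaussKernel _).fderiv]
    refine Continuous.integrable_of_hasCompactSupport ?_ hc.mul_left
    simp only [neg_smul, neg_apply, smul_apply, innerSL_apply_apply, smul_eq_mul]
    fun_prop
  · refine Continuous.integrable_of_hasCompactSupport ?_ (HasCompactSupport.mul_left ?_)
    · exact hκ.mul ((hf.continuous_fderiv one_ne_zero).clm_apply continuous_const)
    · exact (hc.fderiv ℝ).comp_left (g := fun L : Vec n →L[ℝ] ℝ => L v) rfl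
  · exact Continuous.integrable_of_hasCompactSupport (hκ.mul hf0) hc.mul_left
  · exact fun z _ => (h.hasFDerivAt_gaussKernel z).differentiableAt
  · exact fun z _ => hf.differentiable one_ne_zero z

end IsPrecision

end Kernel

/-! ### Gaussian averages of compactly supported functions -/


section Near

variable {n : ℕ} {H V : Type*} [NormedAddCommGroup H] [NormedSpace ℝ H] [NormedAddCommGroup V]
  [NormedSpace ℝ V]

theorem IsPrecision.norm_average_le {M : Vec n →L[ℝ] Vec n} {a b : ℝ} (h : IsPrecision M a b)
    {Ψ : Vec n → V} {ε K : ℝ} (hK : 0 ≤ K) (hΨ : ∀ z, ‖Ψ z‖ ≤ ε + K * ‖z‖ ^ 2) :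
    ‖(∫ z, gaussKernel M z)⁻¹ • ∫ z, gaussKernel M z • Ψ z‖ ≤
      ε + K * (4 / a * (2 * b / a) ^ ((n : ℝ) / 2)) := by
  have hI := h.integral_gaussKernel_pos
  have h1 : ‖∫ z, gaussKernel M z • Ψ z‖ ≤
      ∫ z, (ε * gaussKernel M z + K * (gaussKernel M z * ‖z‖ ^ 2)) := by
    refine norm_integral_le_of_norm_le ((h.integrable_gaussKernel.const_mul _).add
      (h.integrable_gaussKernel_mul_sq.const_mul _)) (ae_of_all _ fun z => ?_)
    rw [norm_smul, Real.norm_of_nonneg (gaussKernel_pos M z).le]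
    calc gaussKernel M z * ‖Ψ z‖ ≤ gaussKernel M z * (ε + K * ‖z‖ ^ 2) := by
          have := gaussKernel_pos M z
          gcongr
          exact hΨ z
      _ = _ := by ring
  rw [integral_add (h.integrable_gaussKernel.const_mul _)
      (h.integrable_gaussKernel_mul_sq.const_mul _), integral_const_mul, integral_const_mul] at h1
  rw [norm_smul, norm_inv, Real.norm_of_nonneg hI.le, inv_mul_le_iff₀ hI]
  refine h1.trans ?_
  have h2 := mul_le_mul_of_nonneg_left h.integral_gaussKernel_mul_sq_le hK
  linarith

/-- Continuity handles small `z`. For large `z` the crude bound `2 * C` is itself dominated by a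
multiple of `‖z‖ ^ 2`, so a single quadratic bound holds for all `z` and the integral needs no
splitting. -/
theorem exists_norm_shift_sub_le {U : Vec n × H → V} (hU : Continuous U)
    (hc : HasCompactSupport U) (X₀ : Vec n × H) {ε : ℝ} (hε : 0 < ε) :
    ∃ δ > 0, ∃ K, 0 ≤ K ∧ ∀ X ∈ Metric.ball X₀ δ, ∀ z : Vec n,
      ‖U (X.1 + z, X.2) - U X₀‖ ≤ ε + K * ‖z‖ ^ 2 := by
  obtain ⟨C, hC⟩ := hc.exists_bound_of_continuous hU
  obtain ⟨δ, hδ, hd⟩ := Metric.continuousAt_iff.1 (hU.continuousAt (x := X₀)) ε hε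
  have hC0 : 0 ≤ C := (norm_nonneg _).trans (hC X₀)
  refine ⟨δ / 2, by positivity, 2 * C / (δ / 2) ^ 2, by positivity, fun X hX z => ?_⟩
  by_cases hz : ‖z‖ < δ / 2
  · have h1 : dist (X.1 + z, X.2) X₀ < δ := by
      have h2 : dist (X.1 + z, X.2) X ≤ ‖z‖ := by
        rw [Prod.dist_eq]
        refine max_le ?_ ?_
        · simp
        · simp
      have h3 := Metric.mem_ball.1 hX
      linarith [dist_triangle (X.1 + z, X.2) X X₀]
    have h2 := (hd h1).le
    rw [dist_eq_norm] at h2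
    have : 0 ≤ 2 * C / (δ / 2) ^ 2 * ‖z‖ ^ 2 := by positivity
    linarith
  · push Not at hz
    have h1 : 2 * C ≤ 2 * C / (δ / 2) ^ 2 * ‖z‖ ^ 2 := by
      rw [div_mul_eq_mul_div, le_div_iff₀ (by positivity)]
      gcongr
    have h2 := norm_sub_le (U (X.1 + z, X.2)) (U X₀)
    linarith [hC (X.1 + z, X.2), hC X₀]

theorem IsPrecision.integrable_gaussKernel_smul_shift {M : Vec n →L[ℝ] Vec n} {a b : ℝ}
    (h : IsPrecision M a b) {U : Vec n × H → V} (hU : Continuous U) (hc : HasCompactSupport U)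
    (X : Vec n × H) : Integrable fun z => gaussKernel M z • U (X.1 + z, X.2) := by
  obtain ⟨C, hC⟩ := hc.exists_bound_of_continuous hU
  have hm : Continuous fun z => gaussKernel M z • U (X.1 + z, X.2) :=
    (continuous_gaussKernel M).smul (hU.comp (by fun_prop))
  refine (h.integrable_gaussKernel.mul_const C).mono' hm.aestronglyMeasurable
    (ae_of_all _ fun z => ?_)
  rw [norm_smul, Real.norm_of_nonneg (gaussKernel_pos M z).le]
  exact mul_le_mul_of_nonneg_left (hC _) (gaussKernel_pos M z).le

theorem IsPrecision.average_const {M : Vec n →L[ℝ] Vec n} {a b : ℝ} [CompleteSpace V]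
    (h : IsPrecision M a b) (v : V) :
    (∫ z, gaussKernel M z)⁻¹ • ∫ z, gaussKernel M z • v = v := by
  rw [integral_smul_const, smul_smul, inv_mul_cancel₀ h.integral_gaussKernel_pos.ne', one_smul]

/-- Mean value inequality on the ball for `X ↦ F (X + (z, 0)) - F'(X₀) X`, with the shift `z`
frozen. -/
theorem norm_shift_sub_sub_le {F : Vec n × H → V} (hF : ContDiff ℝ 1 F) {X₀ : Vec n × H}
    {δ c : ℝ} {z : Vec n}
    (hz : ∀ X ∈ Metric.ball X₀ δ, ‖fderiv ℝ F (X.1 + z, X.2) - fderiv ℝ F X₀‖ ≤ c)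
    {X Y : Vec n × H} (hX : X ∈ Metric.ball X₀ δ) (hY : Y ∈ Metric.ball X₀ δ) :
    ‖F (X.1 + z, X.2) - F (Y.1 + z, Y.2) - fderiv ℝ F X₀ (X - Y)‖ ≤ c * ‖X - Y‖ := by
  have hd : ∀ X : Vec n × H, HasFDerivAt
      (fun X : Vec n × H => F (X + (z, 0)) - fderiv ℝ F X₀ X)
      (fderiv ℝ F (X + (z, 0)) - fderiv ℝ F X₀) X := fun X =>
    (((hF.differentiable one_ne_zero _).hasFDerivAt).comp X
      ((hasFDerivAt_id X).add_const (z, 0))).sub (fderiv ℝ F X₀).hasFDerivAt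
  have e : ∀ X : Vec n × H, X + (z, 0) = (X.1 + z, X.2) := fun X => by ext <;> simp
  have h1 := (convex_ball X₀ δ).norm_image_sub_le_of_norm_hasFDerivWithin_le
    (fun X _ => (hd X).hasFDerivWithinAt) (fun X hX => by rw [e]; exact hz X hX) hY hX
  simp only [e] at h1
  rw [map_sub]
  convert h1 using 2
  abel

variable {M : ℕ → Vec n →L[ℝ] Vec n} {a b : ℝ}

theorem tendsto_const_mul_div_atTop (K c : ℝ) :
    Tendsto (fun N : ℕ => K * (4 / (a * N) * c)) atTop (𝓝 0) := by
  have h : Tendsto (fun N : ℕ => (K * 4 * c / a) * (1 / (N : ℝ))) atTop (𝓝 ((K * 4 * c / a) * 0)) :=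
    tendsto_one_div_atTop_nhds_zero_nat.const_mul _
  rw [mul_zero] at h
  refine h.congr fun N => ?_
  rw [mul_comm a, ← div_div]
  ring

/-- The concentration estimate is applied twice: to `F` for the values and to its derivative for the
increments. Continuity of the derivative is enough, so no rate and no second derivative of `F`
enter. -/
theorem unifStrictDiff_average [CompleteSpace V]
    (hM : ∀ᶠ N : ℕ in atTop, IsPrecision (M N) (a * N) (b * N))
    {F : Vec n × H → V} (hF : ContDiff ℝ 1 F) (hc : HasCompactSupport F) (X₀ : Vec n × H) :
    UnifStrictDiff (fun N (X : Vec n × H) => (∫ z, gaussKernel (M N) z)⁻¹ •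
      ∫ z, gaussKernel (M N) z • F (X.1 + z, X.2)) X₀ (F X₀) (fderiv ℝ F X₀) := by
  intro ε hε
  obtain ⟨δ₁, hδ₁, K₁, hK₁, h1⟩ :=
    exists_norm_shift_sub_le hF.continuous hc X₀ (half_pos hε)
  obtain ⟨δ₂, hδ₂, K₂, hK₂, h2⟩ := exists_norm_shift_sub_le (hF.continuous_fderiv one_ne_zero)
    (hc.fderiv ℝ) X₀ (half_pos hε)
  refine ⟨min δ₁ δ₂, lt_min hδ₁ hδ₂, ?_⟩
  filter_upwards [hM, (tendsto_const_mul_div_atTop (a := a) K₁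
      ((2 * b / a) ^ ((n : ℝ) / 2))).eventually_lt_const (half_pos hε),
    (tendsto_const_mul_div_atTop (a := a) K₂
      ((2 * b / a) ^ ((n : ℝ) / 2))).eventually_lt_const (half_pos hε), eventually_gt_atTop 0]
    with N hM hK1 hK2 hN X hX
  -- The ratio of the spectral bounds does not depend on `N`, so the second moment constant retains
  -- a full factor `1 / N`.
  have hab : 2 * (b * N) / (a * N) = 2 * b / a := by
    have : (N : ℝ) ≠ 0 := by positivity
    have ha : a ≠ 0 := fun h => by simpa [h] using hM.pos
    field_simp
  have hi := fun X => hM.integrable_gaussKernel_smul_shift hF.continuous hc X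
  have hic : ∀ v : V, Integrable fun z => gaussKernel (M N) z • v := fun v =>
    hM.integrable_gaussKernel.smul_const v
  have hij : ∀ X Y : Vec n × H, Integrable fun z =>
      gaussKernel (M N) z • F (X.1 + z, X.2) - gaussKernel (M N) z • F (Y.1 + z, Y.2) :=
    fun X Y => (hi X).sub (hi Y)
  refine ⟨?_, fun Y hY => ?_⟩
  · have h3 := hM.norm_average_le hK₁ (h1 X (Metric.ball_subset_ball (min_le_left _ _) hX))
    simp only [smul_sub] at h3
    rw [integral_sub (hi X) (hic _), smul_sub, hM.average_const, hab] at h3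
    linarith
  · have h3 := hM.norm_average_le (ε := ε / 2 * ‖X - Y‖) (K := K₂ * ‖X - Y‖) (by positivity)
      (Ψ := fun z => F (X.1 + z, X.2) - F (Y.1 + z, Y.2) - fderiv ℝ F X₀ (X - Y)) (fun z => by
        have h4 := norm_shift_sub_sub_le hF (z := z) (δ := min δ₁ δ₂)
          (fun X hX => h2 X (Metric.ball_subset_ball (min_le_right _ _) hX) z) hX hY
        linarith)
    simp only [smul_sub] at h3
    rw [integral_sub (hij X Y) (hic _), smul_sub, hM.average_const,
      integral_sub (hi X) (hi Y), smul_sub, hab] at h3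
    refine h3.trans ?_
    rw [mul_right_comm, ← add_mul]
    gcongr
    linarith

end Near

/-! ### Kernel integrals of functions that vanish near the base point -/

section Far

variable {n p : ℕ} {V : Type*} [NormedAddCommGroup V] [NormedSpace ℝ V]

/-- Since `‖θ‖² ≤ 2‖θ - x‖² + 2‖x‖²`, the growth costs `2 * c` in the exponent; the polynomial
factor costs `1` by `1 + t ≤ exp t`. The condition on `A` says that half of the decay covers both.
-/
theorem exp_mul_sq_mul_decay_le {A c : ℝ} (hc : 0 ≤ c) (hA : 2 * c + 1 ≤ A / 4) (θ x : Vec n) :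
    Real.exp (c * ‖θ‖ ^ 2) * ((1 + ‖θ - x‖ ^ 2) * Real.exp (-(A / 2) * ‖θ - x‖ ^ 2)) ≤
      Real.exp (2 * c * ‖x‖ ^ 2) * Real.exp (-(A / 4) * ‖θ - x‖ ^ 2) := by
  have h1 : ‖θ‖ ≤ ‖θ - x‖ + ‖x‖ := by simpa using norm_add_le (θ - x) x
  have h2 : ‖θ‖ ^ 2 ≤ 2 * ‖θ - x‖ ^ 2 + 2 * ‖x‖ ^ 2 := by
    nlinarith [norm_nonneg θ, sq_nonneg (‖θ - x‖ - ‖x‖)]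
  have h3 : 1 + ‖θ - x‖ ^ 2 ≤ Real.exp (‖θ - x‖ ^ 2) := by
    linarith [Real.add_one_le_exp (‖θ - x‖ ^ 2)]
  calc Real.exp (c * ‖θ‖ ^ 2) * ((1 + ‖θ - x‖ ^ 2) * Real.exp (-(A / 2) * ‖θ - x‖ ^ 2))
      ≤ Real.exp (c * ‖θ‖ ^ 2) *
          (Real.exp (‖θ - x‖ ^ 2) * Real.exp (-(A / 2) * ‖θ - x‖ ^ 2)) := by gcongr
    _ = Real.exp (c * ‖θ‖ ^ 2 + (‖θ - x‖ ^ 2 + -(A / 2) * ‖θ - x‖ ^ 2)) := by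
        rw [Real.exp_add, Real.exp_add]
    _ ≤ Real.exp (2 * c * ‖x‖ ^ 2 + -(A / 4) * ‖θ - x‖ ^ 2) := by
        refine Real.exp_le_exp.2 ?_
        nlinarith [mul_le_mul_of_nonneg_left h2 hc, sq_nonneg ‖θ - x‖]
    _ = _ := Real.exp_add _ _

namespace HasGaussDecay

variable {k : Vec n → V} {A C c : ℝ}

theorem nonneg (hk : HasGaussDecay k A C) : 0 ≤ C := by
  have h := (norm_nonneg _).trans (hk.le 0)
  simpa using h

theorem exp_mul_norm_le (hk : HasGaussDecay k A C) (hc : 0 ≤ c) (hA : 2 * c + 1 ≤ A / 4)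
    (θ x : Vec n) : Real.exp (c * ‖θ‖ ^ 2) * ‖k (θ - x)‖ ≤
      C * (Real.exp (2 * c * ‖x‖ ^ 2) * Real.exp (-(A / 4) * ‖θ - x‖ ^ 2)) := by
  refine (mul_le_mul_of_nonneg_left (hk.le _) (Real.exp_pos _).le).trans ?_
  rw [mul_left_comm]
  exact mul_le_mul_of_nonneg_left (exp_mul_sq_mul_decay_le hc hA θ x) hk.nonneg

theorem exp_mul_norm_fderiv_le (hk : HasGaussDecay k A C) (hc : 0 ≤ c) (hA : 2 * c + 1 ≤ A / 4)
    (θ x : Vec n) : Real.exp (c * ‖θ‖ ^ 2) * ‖fderiv ℝ k (θ - x)‖ ≤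
      C * (Real.exp (2 * c * ‖x‖ ^ 2) * Real.exp (-(A / 4) * ‖θ - x‖ ^ 2)) := by
  refine (mul_le_mul_of_nonneg_left (hk.fderiv_le _) (Real.exp_pos _).le).trans ?_
  rw [mul_left_comm]
  exact mul_le_mul_of_nonneg_left (exp_mul_sq_mul_decay_le hc hA θ x) hk.nonneg

theorem integrable_smul (hk : HasGaussDecay k A C) (hc : 0 ≤ c) (hA : 2 * c + 1 ≤ A / 4)
    {g H : Vec n → ℝ} (hg : AEStronglyMeasurable g) (hH : Integrable H)
    (hgH : ∀ᵐ θ, ‖g θ‖ ≤ Real.exp (c * ‖θ‖ ^ 2) * H θ) (x : Vec n) :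
    Integrable fun θ => g θ • k (θ - x) := by
  have hkc : Continuous fun θ => k (θ - x) := hk.diff.continuous.comp (by fun_prop)
  refine (hH.const_mul (C * Real.exp (2 * c * ‖x‖ ^ 2))).mono'
    (hg.smul hkc.aestronglyMeasurable) ?_
  filter_upwards [hgH] with θ hθ
  have hH0 : 0 ≤ H θ := nonneg_of_mul_nonneg_right ((norm_nonneg _).trans hθ) (Real.exp_pos _)
  have h1 := hk.exp_mul_norm_le hc hA θ x
  have hA0 : 0 ≤ A / 4 := by linarith
  have hC := hk.nonneg
  calc ‖g θ • k (θ - x)‖ ≤ Real.exp (c * ‖θ‖ ^ 2) * H θ * ‖k (θ - x)‖ := by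
        rw [norm_smul]; gcongr
    _ = (Real.exp (c * ‖θ‖ ^ 2) * ‖k (θ - x)‖) * H θ := by ring
    _ ≤ (C * (Real.exp (2 * c * ‖x‖ ^ 2) * 1)) * H θ := by
        refine mul_le_mul_of_nonneg_right (h1.trans ?_) hH0
        gcongr
        refine Real.exp_le_one_iff.2 ?_
        nlinarith [mul_nonneg hA0 (sq_nonneg ‖θ - x‖)]
    _ = _ := by ring

end HasGaussDecay

theorem tendsto_pow_mul_exp_neg_nat (C : ℝ) (m : ℕ) {κ : ℝ} (hκ : 0 < κ) :
    Tendsto (fun N : ℕ => C * ((N : ℝ) ^ m * Real.exp (-(κ * N)))) atTop (𝓝 0) := by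
  have h1 : Tendsto (fun N : ℕ => κ * (N : ℝ)) atTop atTop :=
    tendsto_natCast_atTop_atTop.const_mul_atTop hκ
  have h2 := ((Real.tendsto_pow_mul_exp_neg_atTop_nhds_zero m).comp h1).const_mul (C * (κ ^ m)⁻¹)
  rw [mul_zero] at h2
  refine h2.congr fun N => ?_
  simp only [Function.comp_apply]
  rw [mul_pow]
  field_simp

/-- If `x` stays within `ρ` of `θ₀` and `θ` is at distance at least `4 * ρ` from it, then `‖θ - x‖ ≥
3 * ρ`. There the kernel and its derivative are of size `N exp(-9 a ρ² N / 4)` at most, up to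
constants and the weight `exp (c ‖θ‖²)`, which beats the polynomial prefactor `s`. Values and
Lipschitz constants both tend to zero. -/
theorem unifStrictDiff_far {k : ℕ → Vec n → V} {a b : ℝ} (ha : 0 < a) (hb : 0 < b)
    (hk : ∀ᶠ N : ℕ in atTop, HasGaussDecay (k N) (a * N) (1 + b * N)) {s : ℕ → ℝ} {K : ℝ} {m : ℕ}
    (hK : 0 ≤ K) (hs : ∀ᶠ N : ℕ in atTop, |s N| ≤ K * (N : ℝ) ^ m) {g : Vec n → Vec p → ℝ}
    {H : Vec n → ℝ} {c δ ρ : ℝ} (hc : 0 ≤ c) (hδ : 0 < δ) (hρ : 0 < ρ) {θ₀ : Vec n} {η₀ : Vec p}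
    (hgm : ∀ η ∈ Metric.ball η₀ δ, AEStronglyMeasurable fun θ => g θ η) (hH : Integrable H)
    (hg0 : ∀ θ ∈ Metric.ball θ₀ (4 * ρ), ∀ η ∈ Metric.ball η₀ δ, g θ η = 0)
    (hg : ∀ᵐ θ, ∀ η ∈ Metric.ball η₀ δ, ‖g θ η‖ ≤ Real.exp (c * ‖θ‖ ^ 2) * H θ ∧
      ∀ η' ∈ Metric.ball η₀ δ, ‖g θ η - g θ η'‖ ≤ Real.exp (c * ‖θ‖ ^ 2) * H θ * ‖η - η'‖) :
    UnifStrictDiff (fun N (X : Vec n × Vec p) => s N • ∫ θ, g θ X.2 • k N (θ - X.1))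
      (θ₀, η₀) 0 0 := by
  intro ε hε
  refine ⟨min δ ρ, lt_min hδ hρ, ?_⟩
  set R : ℝ := ‖θ₀‖ + ρ with hR
  -- The factor `2` before `∫ θ, H θ` leaves room for the two variations in the Lipschitz estimate,
  -- of `g` in `η` and of the kernel in `x`.
  set C : ℝ := K * (1 + b) * Real.exp (2 * c * R ^ 2) * (2 * (∫ θ, H θ)) with hC
  have hlim := tendsto_pow_mul_exp_neg_nat C (m + 1) (κ := 9 * a * ρ ^ 2 / 4) (by positivity)
  have hlarge : ∀ᶠ N : ℕ in atTop, 2 * c + 1 ≤ a * N / 4 := by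
    have h1 : Tendsto (fun N : ℕ => a / 4 * (N : ℝ)) atTop atTop :=
      tendsto_natCast_atTop_atTop.const_mul_atTop (by positivity)
    filter_upwards [h1.eventually_ge_atTop (2 * c + 1)] with N hN
    linarith
  filter_upwards [hk, hs, hlim.eventually_lt_const hε, hlarge, eventually_ge_atTop 1] with
    N hk hs hlim hN hN1 X hX
  have hN1' : (1 : ℝ) ≤ N := by exact_mod_cast hN1
  -- This bounds the weight `exp (c ‖θ‖²)` times the kernel, or times its derivative, off the ball
  -- of radius `4 * ρ`.
  set e : ℝ := (1 + b * N) * (Real.exp (2 * c * R ^ 2) * Real.exp (-(9 * a * ρ ^ 2 / 4 * N)))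
    with he
  have he0 : 0 ≤ e := by positivity
  have hball : ∀ Y ∈ Metric.ball (θ₀, η₀) (min δ ρ),
      Y.1 ∈ Metric.ball θ₀ ρ ∧ Y.2 ∈ Metric.ball η₀ δ := fun Y hY => by
    rw [Metric.mem_ball, Prod.dist_eq, max_lt_iff] at hY
    exact ⟨hY.1.trans_le (min_le_right _ _), hY.2.trans_le (min_le_left _ _)⟩
  have hfar : ∀ θ ∉ Metric.ball θ₀ (4 * ρ), ∀ x ∈ Metric.ball θ₀ ρ,
      (1 + b * N) * (Real.exp (2 * c * ‖x‖ ^ 2) * Real.exp (-(a * N / 4) * ‖θ - x‖ ^ 2)) ≤ e := by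
    intro θ hθ x hx
    rw [Metric.mem_ball, not_lt, dist_eq_norm] at hθ
    rw [mem_ball_iff_norm] at hx
    have h1 : 3 * ρ ≤ ‖θ - x‖ := by
      have : ‖θ - θ₀‖ ≤ ‖θ - x‖ + ‖x - θ₀‖ := norm_sub_le_norm_sub_add_norm_sub _ _ _
      linarith
    have h2 : ‖x‖ ≤ R := by
      have : ‖x‖ ≤ ‖x - θ₀‖ + ‖θ₀‖ := by simpa using norm_add_le (x - θ₀) θ₀
      linarith
    have h3 : (3 * ρ) ^ 2 ≤ ‖θ - x‖ ^ 2 := by gcongr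
    rw [he]
    gcongr
    nlinarith [mul_le_mul_of_nonneg_left h3 (by positivity : 0 ≤ a * N / 4)]
  have hkx : ∀ θ ∉ Metric.ball θ₀ (4 * ρ), ∀ x ∈ Metric.ball θ₀ ρ,
      Real.exp (c * ‖θ‖ ^ 2) * ‖k N (θ - x)‖ ≤ e := fun θ hθ x hx =>
    (hk.exp_mul_norm_le hc hN θ x).trans (hfar θ hθ x hx)
  have hkxy : ∀ θ ∉ Metric.ball θ₀ (4 * ρ), ∀ x ∈ Metric.ball θ₀ ρ, ∀ y ∈ Metric.ball θ₀ ρ,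
      Real.exp (c * ‖θ‖ ^ 2) * ‖k N (θ - x) - k N (θ - y)‖ ≤ e * ‖x - y‖ := by
    intro θ hθ x hx y hy
    have hd : ∀ x, HasFDerivAt (fun x => k N (θ - x))
        ((fderiv ℝ (k N) (θ - x)).comp (-(ContinuousLinearMap.id ℝ (Vec n)))) x := fun x =>
      (hk.diff _).hasFDerivAt.comp x ((hasFDerivAt_id x).const_sub θ)
    have h1 := (convex_ball θ₀ ρ).norm_image_sub_le_of_norm_hasFDerivWithin_le
      (C := Real.exp (-(c * ‖θ‖ ^ 2)) * e)
      (fun x _ => (hd x).hasFDerivWithinAt) (fun x hx => by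
        rw [ContinuousLinearMap.comp_neg, norm_neg, ContinuousLinearMap.comp_id, Real.exp_neg,
          le_inv_mul_iff₀ (Real.exp_pos _)]
        exact (hk.exp_mul_norm_fderiv_le hc hN θ x).trans (hfar θ hθ x hx)) hy hx
    rw [Real.exp_neg, mul_assoc, le_inv_mul_iff₀ (Real.exp_pos _)] at h1
    exact h1
  have hsum : |s N| * (e * (2 * ∫ θ, H θ)) ≤ ε := by
    have hH0 : 0 ≤ ∫ θ, H θ := by
      refine integral_nonneg_of_ae ?_
      filter_upwards [hg] with θ hθ
      exact nonneg_of_mul_nonneg_right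
        ((norm_nonneg _).trans (hθ η₀ (Metric.mem_ball_self hδ)).1) (Real.exp_pos _)
    have h1 : 1 + b * N ≤ (1 + b) * N := by nlinarith
    calc |s N| * (e * (2 * ∫ θ, H θ))
        ≤ (K * (N : ℝ) ^ m) * ((((1 + b) * N) *
          (Real.exp (2 * c * R ^ 2) * Real.exp (-(9 * a * ρ ^ 2 / 4 * N)))) *
            (2 * ∫ θ, H θ)) := by
          rw [he]; gcongr
      _ = C * ((N : ℝ) ^ (m + 1) * Real.exp (-(9 * a * ρ ^ 2 / 4 * N))) := by rw [hC]; ring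
      _ ≤ ε := hlim.le
  have hint : ∀ Y ∈ Metric.ball (θ₀, η₀) (min δ ρ),
      Integrable fun θ => g θ Y.2 • k N (θ - Y.1) := fun Y hY =>
    hk.integrable_smul hc hN (hgm _ (hball Y hY).2) hH
      (hg.mono fun θ hθ => (hθ _ (hball Y hY).2).1) Y.1
  refine ⟨?_, fun Y hY => ?_⟩
  · have h1 : ‖∫ θ, g θ X.2 • k N (θ - X.1)‖ ≤ ∫ θ, e * (2 * H θ) := by
      refine norm_integral_le_of_norm_le ((hH.const_mul _).const_mul _) ?_
      filter_upwards [hg] with θ hθ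
      have h2 := (hθ _ (hball X hX).2).1
      have hH0 : 0 ≤ H θ :=
        nonneg_of_mul_nonneg_right ((norm_nonneg _).trans h2) (Real.exp_pos _)
      by_cases hθb : θ ∈ Metric.ball θ₀ (4 * ρ)
      · rw [hg0 θ hθb _ (hball X hX).2, zero_smul, norm_zero]
        positivity
      · rw [norm_smul]
        calc ‖g θ X.2‖ * ‖k N (θ - X.1)‖ ≤ Real.exp (c * ‖θ‖ ^ 2) * H θ * ‖k N (θ - X.1)‖ := by
              gcongr
          _ = (Real.exp (c * ‖θ‖ ^ 2) * ‖k N (θ - X.1)‖) * H θ := by ring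
          _ ≤ e * (2 * H θ) := by
              refine mul_le_mul (hkx θ hθb _ (hball X hX).1) (by linarith) hH0 he0
    rw [integral_const_mul, integral_const_mul] at h1
    rw [sub_zero, norm_smul, Real.norm_eq_abs]
    exact (mul_le_mul_of_nonneg_left h1 (abs_nonneg _)).trans hsum
  · have h1 : ‖∫ θ, (g θ X.2 • k N (θ - X.1) - g θ Y.2 • k N (θ - Y.1))‖ ≤
        ∫ θ, e * (2 * H θ) * ‖X - Y‖ := by
      refine norm_integral_le_of_norm_le (((hH.const_mul _).const_mul _).mul_const _) ?_
      filter_upwards [hg] with θ hθ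
      have h2 := (hθ _ (hball X hX).2).2 _ (hball Y hY).2
      have h3 := (hθ _ (hball Y hY).2).1
      have hH0 : 0 ≤ H θ :=
        nonneg_of_mul_nonneg_right ((norm_nonneg _).trans h3) (Real.exp_pos _)
      by_cases hθb : θ ∈ Metric.ball θ₀ (4 * ρ)
      · rw [hg0 θ hθb _ (hball X hX).2, hg0 θ hθb _ (hball Y hY).2, zero_smul, zero_smul, sub_zero,
          norm_zero]
        positivity
      -- The increment is split into a change of `η` at fixed `x` and a change of `x` at fixed `η`.
      · have h4 : g θ X.2 • k N (θ - X.1) - g θ Y.2 • k N (θ - Y.1) =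
            (g θ X.2 - g θ Y.2) • k N (θ - X.1) +
              g θ Y.2 • (k N (θ - X.1) - k N (θ - Y.1)) := by
          rw [sub_smul, smul_sub]; abel
        have h5 := hkx θ hθb _ (hball X hX).1
        have h6 := hkxy θ hθb _ (hball X hX).1 _ (hball Y hY).1
        have h7 : ‖X.1 - Y.1‖ ≤ ‖X - Y‖ := norm_fst_le (X - Y)
        have h8 : ‖X.2 - Y.2‖ ≤ ‖X - Y‖ := norm_snd_le (X - Y)
        rw [h4]
        refine (norm_add_le _ _).trans ?_
        rw [norm_smul, norm_smul]
        calc ‖g θ X.2 - g θ Y.2‖ * ‖k N (θ - X.1)‖ +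
              ‖g θ Y.2‖ * ‖k N (θ - X.1) - k N (θ - Y.1)‖
            ≤ (Real.exp (c * ‖θ‖ ^ 2) * H θ * ‖X.2 - Y.2‖) * ‖k N (θ - X.1)‖ +
              (Real.exp (c * ‖θ‖ ^ 2) * H θ) * ‖k N (θ - X.1) - k N (θ - Y.1)‖ := by gcongr
          _ = (Real.exp (c * ‖θ‖ ^ 2) * ‖k N (θ - X.1)‖) * (H θ * ‖X.2 - Y.2‖) +
              (Real.exp (c * ‖θ‖ ^ 2) * ‖k N (θ - X.1) - k N (θ - Y.1)‖) * H θ := by ring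
          _ ≤ e * (H θ * ‖X - Y‖) + (e * ‖X - Y‖) * H θ := by
              exact add_le_add (mul_le_mul h5 (by gcongr) (by positivity) he0)
                (mul_le_mul_of_nonneg_right (h6.trans (by gcongr)) hH0)
          _ = _ := by ring
    rw [integral_mul_const, integral_const_mul, integral_const_mul,
      integral_sub (hint X hX) (hint Y hY)] at h1
    rw [zero_apply, sub_zero, ← smul_sub, norm_smul, Real.norm_eq_abs]
    refine (mul_le_mul_of_nonneg_left h1 (abs_nonneg _)).trans ?_
    rw [← mul_assoc]
    gcongr

end Far

/-! ### Differentiability of kernel integrals for a fixed kernel -/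

section Diff

variable {n p : ℕ} {V : Type*} [NormedAddCommGroup V] [NormedSpace ℝ V] [FiniteDimensional ℝ V]

/-- Supplies, for an individual large `N`, the differentiability that
`UnifStrictDiff.tendsto_fderiv` requires. -/
theorem HasGaussDecay.differentiableAt_integral {k : Vec n → V} {A C c : ℝ}
    (hk : HasGaussDecay k A C) (hc : 0 ≤ c) (hA : 2 * c + 1 ≤ A / 4)
    {g H : Vec n → ℝ} (hg : AEStronglyMeasurable g) (hH : Integrable H)
    (hgH : ∀ᵐ θ, ‖g θ‖ ≤ Real.exp (c * ‖θ‖ ^ 2) * H θ) (x₀ : Vec n) :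
    DifferentiableAt ℝ (fun x => ∫ θ, g θ • k (θ - x)) x₀ := by
  have : CompleteSpace V := FiniteDimensional.complete ℝ V
  have hd : ∀ x θ, HasFDerivAt (fun x => g θ • k (θ - x))
      (g θ • (fderiv ℝ k (θ - x)).comp (-(ContinuousLinearMap.id ℝ (Vec n)))) x := fun x θ =>
    ((hk.diff _).hasFDerivAt.comp x ((hasFDerivAt_id x).const_sub θ)).const_smul (g θ)
  borelize V
  have hm : Measurable fun θ => fderiv ℝ k (θ - x₀) :=
    (measurable_fderiv ℝ k).comp (measurable_id.sub_const x₀)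
  refine (hasFDerivAt_integral_of_dominated_of_fderiv_le (s := Metric.ball x₀ 1)
    (bound := fun θ => C * Real.exp (2 * c * (‖x₀‖ + 1) ^ 2) * H θ)
    (F' := fun x θ => g θ • (fderiv ℝ k (θ - x)).comp (-(ContinuousLinearMap.id ℝ (Vec n))))
    (Metric.ball_mem_nhds x₀ one_pos)
    (Eventually.of_forall fun x => (hk.integrable_smul hc hA hg hH hgH x).aestronglyMeasurable)
    (hk.integrable_smul hc hA hg hH hgH x₀) ?_ ?_ (hH.const_mul _)
    (ae_of_all _ fun θ x _ => hd x θ)).differentiableAt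
  · refine hg.smul ?_
    exact ((ContinuousLinearMap.compL ℝ (Vec n) (Vec n) V).flip
      (-(ContinuousLinearMap.id ℝ (Vec n)))).continuous.comp_aestronglyMeasurable
      hm.aestronglyMeasurable
  · filter_upwards [hgH] with θ hθ x hx
    have hH0 : 0 ≤ H θ := nonneg_of_mul_nonneg_right ((norm_nonneg _).trans hθ) (Real.exp_pos _)
    have h1 := hk.exp_mul_norm_fderiv_le hc hA θ x
    have hA0 : 0 ≤ A / 4 := by linarith
    have hC := hk.nonneg
    have hx' : ‖x‖ ≤ ‖x₀‖ + 1 := by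
      have h2 : ‖x‖ ≤ ‖x - x₀‖ + ‖x₀‖ := by simpa using norm_add_le (x - x₀) x₀
      have := mem_ball_iff_norm.1 hx
      linarith
    rw [norm_smul, ContinuousLinearMap.comp_neg, norm_neg, ContinuousLinearMap.comp_id]
    calc ‖g θ‖ * ‖fderiv ℝ k (θ - x)‖
        ≤ Real.exp (c * ‖θ‖ ^ 2) * H θ * ‖fderiv ℝ k (θ - x)‖ := by gcongr
      _ = (Real.exp (c * ‖θ‖ ^ 2) * ‖fderiv ℝ k (θ - x)‖) * H θ := by ring
      _ ≤ (C * (Real.exp (2 * c * (‖x₀‖ + 1) ^ 2) * 1)) * H θ := by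
          refine mul_le_mul_of_nonneg_right (h1.trans ?_) hH0
          gcongr
          refine Real.exp_le_one_iff.2 ?_
          nlinarith [mul_nonneg hA0 (sq_nonneg ‖θ - x‖)]
      _ = _ := by ring

/-- A function of `θ` and a parameter `η` that is differentiable in `η` near `η₀`, with its values
and derivatives dominated by an integrable function times `exp (c ‖θ‖²)`. -/
structure DominatedNear (w : Vec n → Vec p → ℝ) (η₀ : Vec p) (δ c : ℝ) (H : Vec n → ℝ) :
    Prop where
  pos : 0 < δ
  nonneg : 0 ≤ c
  integrable : Integrable H
  meas : ∀ η, Measurable fun θ => w θ η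
  bound : ∀ᵐ θ, ∀ η ∈ Metric.ball η₀ δ, ‖w θ η‖ ≤ Real.exp (c * ‖θ‖ ^ 2) * H θ ∧
    DifferentiableAt ℝ (w θ) η ∧ ‖fderiv ℝ (w θ) η‖ ≤ Real.exp (c * ‖θ‖ ^ 2) * H θ

namespace DominatedNear

variable {w : Vec n → Vec p → ℝ} {η₀ : Vec p} {δ c : ℝ} {H : Vec n → ℝ}

theorem ae_nonneg (h : DominatedNear w η₀ δ c H) : ∀ᵐ θ, 0 ≤ H θ := by
  filter_upwards [h.bound] with θ hθ
  exact nonneg_of_mul_nonneg_right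
    ((norm_nonneg _).trans (hθ η₀ (Metric.mem_ball_self h.pos)).1) (Real.exp_pos _)

theorem ae_norm_le (h : DominatedNear w η₀ δ c H) {η : Vec p} (hη : η ∈ Metric.ball η₀ δ) :
    ∀ᵐ θ, ‖w θ η‖ ≤ Real.exp (c * ‖θ‖ ^ 2) * H θ :=
  h.bound.mono fun _ hθ => (hθ η hη).1

theorem ae_lipschitz (h : DominatedNear w η₀ δ c H) :
    ∀ᵐ θ, ∀ η ∈ Metric.ball η₀ δ, ∀ η' ∈ Metric.ball η₀ δ,
      ‖w θ η - w θ η'‖ ≤ Real.exp (c * ‖θ‖ ^ 2) * H θ * ‖η - η'‖ := by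
  filter_upwards [h.bound] with θ hθ η hη η' hη'
  exact (convex_ball η₀ δ).norm_image_sub_le_of_norm_fderiv_le (𝕜 := ℝ)
    (fun η hη => (hθ η hη).2.1) (fun η hη => (hθ η hη).2.2) hη' hη

/-- Each directional derivative is an almost everywhere limit of measurable difference quotients
with steps `1 / m`, and finitely many basis directions determine the derivative. -/
theorem aestronglyMeasurable_fderiv (h : DominatedNear w η₀ δ c H) :
    AEStronglyMeasurable fun θ => fderiv ℝ (w θ) η₀ := by
  have hv : ∀ v : Vec p, AEStronglyMeasurable fun θ => fderiv ℝ (w θ) η₀ v := fun v => by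
    refine aestronglyMeasurable_of_tendsto_ae atTop
      (f := fun (m : ℕ) θ => (m : ℝ) • (w θ (η₀ + (m : ℝ)⁻¹ • v) - w θ η₀)) (fun m => ?_) ?_
    · exact (((h.meas _).sub (h.meas _)).const_smul (m : ℝ)).aestronglyMeasurable
    · filter_upwards [h.bound] with θ hθ
      have hd := (hθ η₀ (Metric.mem_ball_self h.pos)).2.1.hasFDerivAt
      have hm : Tendsto (fun m : ℕ => ‖(m : ℝ)‖) atTop atTop := by
        simpa using tendsto_natCast_atTop_atTop (R := ℝ)
      exact hd.lim v hm
  have he : (fun θ => fderiv ℝ (w θ) η₀) = fun θ => ∑ j : Fin p,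
      (fderiv ℝ (w θ) η₀ (EuclideanSpace.single j 1)) •
        (EuclideanSpace.proj j : Vec p →L[ℝ] ℝ) := by
    ext θ v
    conv_lhs => rw [← (EuclideanSpace.basisFun (Fin p) ℝ).sum_repr v]
    simp [map_sum, mul_comm]
  rw [he]
  refine Finset.aestronglyMeasurable_fun_sum _ fun j _ => ?_
  exact (hv _).smul_const _

theorem differentiableAt_integral (h : DominatedNear w η₀ δ c H) {k : Vec n → V} {A C : ℝ}
    (hk : HasGaussDecay k A C) (hA : 2 * c + 1 ≤ A / 4) (x₀ : Vec n) :
    DifferentiableAt ℝ (fun η => ∫ θ, w θ η • k (θ - x₀)) η₀ := by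
  have hkc : Continuous fun θ => k (θ - x₀) := hk.diff.continuous.comp (by fun_prop)
  refine (hasFDerivAt_integral_of_dominated_of_fderiv_le (s := Metric.ball η₀ δ)
    (bound := fun θ => C * Real.exp (2 * c * ‖x₀‖ ^ 2) * H θ)
    (F' := fun η θ => (fderiv ℝ (w θ) η).smulRight (k (θ - x₀)))
    (Metric.ball_mem_nhds η₀ h.pos)
    (Eventually.of_forall fun η => ((h.meas η).aestronglyMeasurable.smul
      hkc.aestronglyMeasurable))
    (hk.integrable_smul h.nonneg hA (h.meas η₀).aestronglyMeasurable h.integrable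
      (h.ae_norm_le (Metric.mem_ball_self h.pos)) x₀) ?_ ?_ (h.integrable.const_mul _)
      ?_).differentiableAt
  · exact ((ContinuousLinearMap.smulRightL ℝ (Vec p) V).continuous₂.comp_aestronglyMeasurable
      (h.aestronglyMeasurable_fderiv.prodMk hkc.aestronglyMeasurable))
  · filter_upwards [h.bound, h.ae_nonneg] with θ hθ hH0 η hη
    have h1 := hk.exp_mul_norm_le h.nonneg hA θ x₀
    have hA0 : 0 ≤ A / 4 := by linarith [h.nonneg]
    have hC := hk.nonneg
    rw [ContinuousLinearMap.norm_smulRight_apply]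
    calc ‖fderiv ℝ (w θ) η‖ * ‖k (θ - x₀)‖
        ≤ Real.exp (c * ‖θ‖ ^ 2) * H θ * ‖k (θ - x₀)‖ := by
          gcongr
          exact (hθ η hη).2.2
      _ = (Real.exp (c * ‖θ‖ ^ 2) * ‖k (θ - x₀)‖) * H θ := by ring
      _ ≤ (C * (Real.exp (2 * c * ‖x₀‖ ^ 2) * 1)) * H θ := by
          refine mul_le_mul_of_nonneg_right (h1.trans ?_) hH0
          gcongr
          refine Real.exp_le_one_iff.2 ?_
          nlinarith [mul_nonneg hA0 (sq_nonneg ‖θ - x₀‖)]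
      _ = _ := by ring
  · filter_upwards [h.bound] with θ hθ η hη
    exact (hθ η hη).2.1.hasFDerivAt.smul_const _

end DominatedNear

end Diff

/-! ### The scaled posterior shift -/

section Posterior

variable {n p : ℕ}

/-- Denominator of the posterior mean. -/
noncomputable def postDen (M : Vec n →L[ℝ] Vec n) (w : Vec n → Vec p → ℝ)
    (X : Vec n × Vec p) : ℝ :=
  ∫ θ, w θ X.2 • gaussKernel M (θ - X.1)

/-- Numerator of the posterior mean of `θ - x`. -/
noncomputable def postNum (M : Vec n →L[ℝ] Vec n) (w : Vec n → Vec p → ℝ)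
    (X : Vec n × Vec p) : Vec n :=
  ∫ θ, w θ X.2 • (gaussKernel M (θ - X.1) • (θ - X.1))

/-- The partial gradient with respect to the first variable. -/
noncomputable def partialGrad (f : Vec n × Vec p → ℝ) (X : Vec n × Vec p) : Vec n :=
  (InnerProductSpace.toDual ℝ (Vec n)).symm
    ((fderiv ℝ f X).comp (ContinuousLinearMap.inl ℝ (Vec n) (Vec p)))

theorem hasFDerivAt_slice {f : Vec n × Vec p → ℝ} {X : Vec n × Vec p}
    (hf : DifferentiableAt ℝ f X) : HasFDerivAt (fun θ => f (θ, X.2))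
      ((fderiv ℝ f X).comp (ContinuousLinearMap.inl ℝ (Vec n) (Vec p))) X.1 := by
  have h1 : HasFDerivAt (fun θ : Vec n => (θ, X.2))
      (ContinuousLinearMap.inl ℝ (Vec n) (Vec p)) X.1 := hasFDerivAt_prodMk_left X.1 X.2
  exact HasFDerivAt.comp X.1 (g := f) hf.hasFDerivAt h1

theorem contDiff_partialGrad {f : Vec n × Vec p → ℝ} (hf : ContDiff ℝ 2 f) :
    ContDiff ℝ 1 (partialGrad f) := by
  have h1 : ContDiff ℝ 1 (fderiv ℝ f) := hf.fderiv_right (by norm_num)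
  exact (InnerProductSpace.toDual ℝ (Vec n)).symm.toContinuousLinearEquiv.contDiff.comp
    (((ContinuousLinearMap.compL ℝ (Vec n) (Vec n × Vec p) ℝ).flip
      (ContinuousLinearMap.inl ℝ (Vec n) (Vec p))).contDiff.comp h1)

theorem hasCompactSupport_partialGrad {f : Vec n × Vec p → ℝ} (hf : HasCompactSupport f) :
    HasCompactSupport (partialGrad f) :=
  (hf.fderiv ℝ).comp_left (g := fun L : Vec n × Vec p →L[ℝ] ℝ =>
    (InnerProductSpace.toDual ℝ (Vec n)).symm
      (L.comp (ContinuousLinearMap.inl ℝ (Vec n) (Vec p)))) (by simp)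

/-- Smooth truncation of a function that is `C²` near a point. -/
theorem exists_cutoff {w : Vec n → Vec p → ℝ} {θ₀ : Vec n} {η₀ : Vec p}
    (hw : ContDiffAt ℝ 2 (Function.uncurry w) (θ₀, η₀)) :
    ∃ f : Vec n × Vec p → ℝ, ∃ χ : Vec n → ℝ, ∃ ρ > 0, ContDiff ℝ 2 f ∧ HasCompactSupport f ∧
      Continuous χ ∧ (∀ θ, 0 ≤ χ θ ∧ χ θ ≤ 1) ∧ (∀ θ ∈ Metric.ball θ₀ (4 * ρ), χ θ = 1) ∧
      ∀ θ, ∀ η ∈ Metric.ball η₀ ρ, f (θ, η) = χ θ * w θ η := by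
  obtain ⟨r, hr, hball⟩ := Metric.eventually_nhds_iff_ball.1 (hw.eventually (by simp))
  -- The bumps vanish outside radius `r / 2`, strictly inside the ball of radius `r` where `w` is
  -- `C²`, so the product extends smoothly by zero. The choice `ρ = r / 16` below makes `4 * ρ`
  -- equal to the radius `r / 4` on which they are `1`.
  let χ₁ : ContDiffBump θ₀ := ⟨r / 4, r / 2, by positivity, by linarith⟩
  let χ₂ : ContDiffBump η₀ := ⟨r / 4, r / 2, by positivity, by linarith⟩
  set f : Vec n × Vec p → ℝ := fun X => χ₁ X.1 * χ₂ X.2 * w X.1 X.2 with hf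
  have hsupp : ∀ X ∉ Metric.closedBall (θ₀, η₀) (r / 2), f X = 0 := by
    intro X hX
    rw [Metric.mem_closedBall, Prod.dist_eq, max_le_iff, not_and_or, not_le, not_le] at hX
    rcases hX with h | h
    · simp only [hf]; rw [χ₁.zero_of_le_dist h.le]; ring
    · simp only [hf]; rw [χ₂.zero_of_le_dist h.le]; ring
  refine ⟨f, χ₁, r / 16, by positivity, ?_, ?_, χ₁.continuous, fun θ => ⟨χ₁.nonneg, χ₁.le_one⟩,
    fun θ hθ => χ₁.one_of_mem_closedBall ?_, fun θ η hη => ?_⟩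
  · refine contDiff_iff_contDiffAt.2 fun X => ?_
    by_cases hX : X ∈ Metric.ball (θ₀, η₀) r
    · exact ((χ₁.contDiffAt.comp X contDiffAt_fst).mul (χ₂.contDiffAt.comp X contDiffAt_snd)).mul
        (hball X hX)
    · have h1 : f =ᶠ[𝓝 X] fun _ => 0 := by
        have h2 : X ∈ (Metric.closedBall (θ₀, η₀) (r / 2))ᶜ := fun h =>
          hX (Metric.closedBall_subset_ball (by linarith) h)
        filter_upwards [Metric.isClosed_closedBall.isOpen_compl.mem_nhds h2] with Y hY
        exact hsupp Y hY
      exact contDiffAt_const.congr_of_eventuallyEq h1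
  · exact HasCompactSupport.intro (isCompact_closedBall _ _) hsupp
  · rw [Metric.mem_ball] at hθ
    rw [Metric.mem_closedBall]
    change dist θ θ₀ ≤ r / 4
    linarith
  · have h1 : χ₂ η = 1 := χ₂.one_of_mem_closedBall (by
      rw [Metric.mem_ball] at hη
      rw [Metric.mem_closedBall]
      change dist η η₀ ≤ r / 4
      linarith)
    simp [hf, h1]

/-- The true order is `N ^ (n / 2)`. Any power will do against exponential decay, so the exponent is
rounded up to avoid fractional powers. -/
theorem IsPrecision.inv_integral_gaussKernel_le {M : Vec n →L[ℝ] Vec n} {a b N : ℝ} (hb : 0 < b)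
    (hN : 1 ≤ N) (h : IsPrecision M a (b * N)) :
    (∫ z, gaussKernel M z)⁻¹ ≤ (b + 1) ^ n * N ^ n := by
  have h0 : 0 < Real.pi / (b * N / 2) := by positivity
  have h1 : (∫ z, gaussKernel M z)⁻¹ ≤ ((Real.pi / (b * N / 2)) ^ ((n : ℝ) / 2))⁻¹ :=
    inv_anti₀ (by positivity) h.le_integral_gaussKernel
  refine h1.trans ?_
  rw [← Real.inv_rpow h0.le, ← mul_pow, ← Real.rpow_natCast]
  have h2 : (Real.pi / (b * N / 2))⁻¹ ≤ (b + 1) * N := by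
    rw [inv_div, div_le_iff₀ Real.pi_pos]
    have := Real.pi_gt_three
    nlinarith [mul_pos hb (by linarith : 0 < N)]
  have h3 : 1 ≤ (b + 1) * N := by nlinarith
  calc ((Real.pi / (b * N / 2))⁻¹) ^ ((n : ℝ) / 2) ≤ ((b + 1) * N) ^ ((n : ℝ) / 2) := by
        gcongr
    _ ≤ ((b + 1) * N) ^ (n : ℝ) := by
        refine Real.rpow_le_rpow_of_exponent_le h3 ?_
        have : (0 : ℝ) ≤ n := Nat.cast_nonneg n
        linarith

/-- The gradient of `log w` with respect to the first variable. -/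
noncomputable def logGrad (w : Vec n → Vec p → ℝ) (X : Vec n × Vec p) : Vec n :=
  gradient (fun θ => Real.log (w θ X.2)) X.1

theorem logGrad_eq {w : Vec n → Vec p → ℝ} {f : Vec n × Vec p → ℝ} {X : Vec n × Vec p}
    (hf : DifferentiableAt ℝ f X) (h0 : f X ≠ 0) (h : ∀ᶠ θ in 𝓝 X.1, f (θ, X.2) = w θ X.2) :
    logGrad w X = (f X)⁻¹ • partialGrad f X := by
  have h1 : (fun θ => Real.log (w θ X.2)) =ᶠ[𝓝 X.1] fun θ => Real.log (f (θ, X.2)) := by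
    filter_upwards [h] with θ hθ
    rw [hθ]
  have h2 := (hasFDerivAt_slice hf).log h0
  rw [logGrad, gradient, h1.fderiv_eq, h2.fderiv, partialGrad, map_smul]

variable {M A' : ℕ → Vec n →L[ℝ] Vec n} {A : Vec n →L[ℝ] Vec n} {a b : ℝ}

/-- After translation by `X.1` this is the integration by parts formula. The operator `B` plays the
role of `N M⁻¹`, so the factor `N` disappears and only a gradient average remains. -/
theorem IsPrecision.smul_integral_shift {M B : Vec n →L[ℝ] Vec n} {a b N : ℝ}
    (h : IsPrecision M a b) (hB : ∀ v, B (M v) = N • v) {f : Vec n × Vec p → ℝ}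
    (hf : ContDiff ℝ 2 f) (hc : HasCompactSupport f) (X : Vec n × Vec p) :
    N • ∫ θ, f (θ, X.2) • (gaussKernel M (θ - X.1) • (θ - X.1)) =
      B (∫ z, gaussKernel M z • partialGrad f (X.1 + z, X.2)) := by
  set fX : Vec n → ℝ := fun z => f (X.1 + z, X.2) with hfX
  have h1 : ContDiff ℝ 1 fX := (hf.of_le (by norm_num)).comp (by fun_prop)
  have h2 : HasCompactSupport fX := by
    refine HasCompactSupport.intro (K := (fun Y : Vec n × Vec p => Y.1 - X.1) '' tsupport f)
      (hc.isCompact.image (by fun_prop)) fun z hz => ?_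
    by_contra h3
    exact hz ⟨(X.1 + z, X.2), subset_tsupport f h3, by simp⟩
  have h3 : ∀ z, gradient fX z = partialGrad f (X.1 + z, X.2) := fun z => by
    have h4 := hasFDerivAt_slice (X := (X.1 + z, X.2)) (hf.differentiable (by norm_num) _)
    have h5 : HasFDerivAt fX _ z := HasFDerivAt.comp (g := fun θ => f (θ, X.2))
      (f := fun z => X.1 + z) z h4 ((hasFDerivAt_id z).const_add X.1)
    rw [gradient, h5.fderiv, partialGrad, ContinuousLinearMap.comp_id]
  have h6 := h.map_integral_gaussKernel_smul h1 h2
  simp only [h3] at h6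
  rw [← h6, hB]
  congr 1
  rw [← integral_sub_right_eq_self (fun z => (gaussKernel M z * fX z) • z) X.1]
  congr 1
  ext1 θ
  simp only [hfX, add_sub_cancel]
  rw [smul_smul, mul_comm]

theorem integral_shift_eq (M : Vec n →L[ℝ] Vec n) (f : Vec n × Vec p → ℝ) (X : Vec n × Vec p) :
    ∫ θ, f (θ, X.2) • gaussKernel M (θ - X.1) =
      ∫ z, gaussKernel M z • f (X.1 + z, X.2) := by
  rw [← integral_sub_right_eq_self (fun z => gaussKernel M z • f (X.1 + z, X.2)) X.1]
  congr 1
  ext1 θ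
  simp only [add_sub_cancel, smul_eq_mul]
  rw [mul_comm]

/-- Divided by the mass of the kernel, the scaled numerator tends to `A` applied to the partial
gradient of `f` and the denominator tends to `f`, where `f` is the truncated weight; the quotient
map then produces the logarithmic gradient. The parts of the integrals coming from `w - f` vanish in
the limit together with their Lipschitz constants. -/
theorem unifStrictDiff_posterior (ha : 0 < a) (hb : 0 < b)
    (hM : ∀ᶠ N : ℕ in atTop, IsPrecision (M N) (a * N) (b * N))
    (hA' : ∀ᶠ N : ℕ in atTop, ∀ v, A' N (M N v) = (N : ℝ) • v) (hA : Tendsto A' atTop (𝓝 A))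
    {w : Vec n → Vec p → ℝ} {θ₀ : Vec n} {η₀ : Vec p} {δ c : ℝ} {H : Vec n → ℝ}
    (hw : DominatedNear w η₀ δ c H) (hsm : ContDiffAt ℝ 2 (Function.uncurry w) (θ₀, η₀))
    (h0 : w θ₀ η₀ ≠ 0) :
    DifferentiableAt ℝ (logGrad w) (θ₀, η₀) ∧
    UnifStrictDiff (fun N X => (N : ℝ) • ((postDen (M N) w X)⁻¹ • postNum (M N) w X)) (θ₀, η₀)
      (A (logGrad w (θ₀, η₀))) (A.comp (fderiv ℝ (logGrad w) (θ₀, η₀))) := by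
  obtain ⟨f, χ, ρ, hρ, hf, hfc, hχc, hχ, hχ1, hfw⟩ := exists_cutoff hsm
  set X₀ : Vec n × Vec p := (θ₀, η₀) with hX₀
  have hfw0 : ∀ θ ∈ Metric.ball θ₀ (4 * ρ), ∀ η ∈ Metric.ball η₀ ρ, f (θ, η) = w θ η :=
    fun θ hθ η hη => by rw [hfw θ η hη, hχ1 θ hθ, one_mul]
  have hfX₀ : f X₀ ≠ 0 := by
    rw [hX₀, hfw0 θ₀ (Metric.mem_ball_self (by positivity)) η₀ (Metric.mem_ball_self hρ)]
    exact h0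
  have hfd : Differentiable ℝ f := hf.differentiable (by norm_num)
  -- the logarithmic gradient
  have hlog : logGrad w =ᶠ[𝓝 X₀] fun X => (f X)⁻¹ • partialGrad f X := by
    have h1 : ∀ᶠ X in 𝓝 X₀, X.1 ∈ Metric.ball θ₀ (4 * ρ) ∧ X.2 ∈ Metric.ball η₀ ρ := by
      rw [hX₀, nhds_prod_eq]
      exact prod_mem_prod (Metric.ball_mem_nhds θ₀ (by positivity)) (Metric.ball_mem_nhds η₀ hρ)
    filter_upwards [h1, hf.continuous.continuousAt.eventually_ne hfX₀] with X hX hX0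
    refine logGrad_eq (hfd X) hX0 ?_
    filter_upwards [Metric.isOpen_ball.mem_nhds hX.1] with θ hθ
    exact hfw0 θ hθ _ hX.2
  set Ψ : Vec n × ℝ → Vec n := fun q => q.2⁻¹ • q.1 with hΨ
  have hF1 := contDiff_partialGrad hf
  have hFd : HasFDerivAt (partialGrad f) (fderiv ℝ (partialGrad f) X₀) X₀ :=
    (hF1.differentiable one_ne_zero X₀).hasFDerivAt
  have hΨd : ∀ v : Vec n, HasStrictFDerivAt Ψ (fderiv ℝ Ψ (v, f X₀)) (v, f X₀) := fun v => by
    have h1 : ContDiffAt ℝ 1 Ψ (v, f X₀) :=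
      (contDiffAt_snd.inv hfX₀).smul contDiffAt_fst
    exact h1.hasStrictFDerivAt one_ne_zero
  have hlogd : DifferentiableAt ℝ (logGrad w) X₀ := by
    refine DifferentiableAt.congr_of_eventuallyEq ?_ hlog
    exact ((hfd X₀).inv hfX₀).smul hFd.differentiableAt
  refine ⟨hlogd, ?_⟩
  -- the far part
  set g : Vec n → Vec p → ℝ := fun θ η => w θ η - f (θ, η) with hg
  set δ' := min δ ρ with hδ'
  have hδ'0 : 0 < δ' := lt_min hw.pos hρ
  have hsub : Metric.ball η₀ δ' ⊆ Metric.ball η₀ δ := Metric.ball_subset_ball (min_le_left _ _)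
  have hsub' : Metric.ball η₀ δ' ⊆ Metric.ball η₀ ρ := Metric.ball_subset_ball (min_le_right _ _)
  have hgeq : ∀ θ, ∀ η ∈ Metric.ball η₀ δ', g θ η = (1 - χ θ) * w θ η := fun θ η hη => by
    simp only [hg]
    rw [hfw θ η (hsub' hη)]
    ring
  have hχn : ∀ θ, ‖1 - χ θ‖ ≤ 1 := fun θ => by
    rw [Real.norm_eq_abs, abs_le]
    constructor <;> linarith [(hχ θ).1, (hχ θ).2]
  have hgm : ∀ η, Measurable fun θ => g θ η := fun η =>
    (hw.meas η).sub (hf.continuous.comp (by fun_prop)).measurable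
  have hg0 : ∀ θ ∈ Metric.ball θ₀ (4 * ρ), ∀ η ∈ Metric.ball η₀ δ', g θ η = 0 :=
    fun θ hθ η hη => by rw [hgeq θ η hη, hχ1 θ hθ]; ring
  have hgb : ∀ᵐ θ, ∀ η ∈ Metric.ball η₀ δ', ‖g θ η‖ ≤ Real.exp (c * ‖θ‖ ^ 2) * H θ ∧
      ∀ η' ∈ Metric.ball η₀ δ', ‖g θ η - g θ η'‖ ≤
        Real.exp (c * ‖θ‖ ^ 2) * H θ * ‖η - η'‖ := by
    filter_upwards [hw.bound, hw.ae_lipschitz] with θ h1 h2 η hη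
    refine ⟨?_, fun η' hη' => ?_⟩
    · rw [hgeq θ η hη, norm_mul]
      exact (mul_le_of_le_one_left (norm_nonneg _) (hχn θ)).trans (h1 η (hsub hη)).1
    · rw [hgeq θ η hη, hgeq θ η' hη', ← mul_sub, norm_mul]
      exact (mul_le_of_le_one_left (norm_nonneg _) (hχn θ)).trans (h2 η (hsub hη) η' (hsub hη'))
  have hs : ∀ᶠ N : ℕ in atTop,
      |(∫ z, gaussKernel (M N) z)⁻¹| ≤ (b + 1) ^ n * (N : ℝ) ^ n := by
    filter_upwards [hM, eventually_ge_atTop 1] with N hM hN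
    rw [abs_of_pos (inv_pos.2 hM.integral_gaussKernel_pos)]
    exact hM.inv_integral_gaussKernel_le hb (by exact_mod_cast hN)
  have hs' : ∀ᶠ N : ℕ in atTop,
      |(N : ℝ) * (∫ z, gaussKernel (M N) z)⁻¹| ≤ (b + 1) ^ n * (N : ℝ) ^ (n + 1) := by
    filter_upwards [hs] with N hs
    rw [abs_mul, abs_of_nonneg (Nat.cast_nonneg N), pow_succ]
    nlinarith [mul_le_mul_of_nonneg_left hs (Nat.cast_nonneg (α := ℝ) N)]
  have far1 := unifStrictDiff_far ha hb (hM.mono fun N h => h.hasGaussDecay) (by positivity) hs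
    hw.nonneg hδ'0 hρ (θ₀ := θ₀) (fun η _ => (hgm η).aestronglyMeasurable) hw.integrable hg0 hgb
  have far2 := unifStrictDiff_far ha hb (hM.mono fun N h => h.hasGaussDecay_smul) (by positivity)
    hs' hw.nonneg hδ'0 hρ (θ₀ := θ₀) (fun η _ => (hgm η).aestronglyMeasurable) hw.integrable
    hg0 hgb
  -- the near part
  have near1 := unifStrictDiff_average hM (hf.of_le (by norm_num)) hfc X₀
  have near2 := unifStrictDiff_average hM hF1 (hasCompactSupport_partialGrad hfc) X₀
  -- The operators `A' N` vary with `N`, so they are treated as a second, constant argument of the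
  -- evaluation map.
  have hbil := (isBoundedBilinearMap_apply (𝕜 := ℝ) (E := Vec n) (F := Vec n)).hasStrictFDerivAt
    (A, partialGrad f X₀)
  have near3 := ((UnifStrictDiff.const (x₀ := X₀) hA).prodMk near2).comp hbil
  have key := ((near3.add far2).prodMk (near1.add far1))
  simp only [add_zero] at key
  have key2 := key.comp (hΨd _)
  -- identification of the limits
  have hval : A (logGrad w X₀) = Ψ (A (partialGrad f X₀), f X₀) := by
    rw [hlog.self_of_nhds, map_smul]
  have hder : HasFDerivAt (fun X => A (logGrad w X)) _ X₀ :=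
    ((((hΨd (A (partialGrad f X₀))).hasFDerivAt.comp X₀
      (HasFDerivAt.prodMk (HasFDerivAt.comp X₀ hbil.hasFDerivAt
        ((hasFDerivAt_const A X₀).prodMk hFd)) (hfd X₀).hasFDerivAt)).congr_of_eventuallyEq (by
          filter_upwards [hlog] with X hX
          simp only [Function.comp_apply, hΨ]
          rw [hX, map_smul])))
  have hder2 : HasFDerivAt (fun X => A (logGrad w X)) (A.comp (fderiv ℝ (logGrad w) X₀)) X₀ :=
    A.hasFDerivAt.comp X₀ hlogd.hasFDerivAt
  rw [hval, hder2.unique hder]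
  refine key2.congr hδ'0 ?_
  have hlarge : ∀ᶠ N : ℕ in atTop, 2 * c + 1 ≤ a * N / 4 := by
    have h1 : Tendsto (fun N : ℕ => a / 4 * (N : ℝ)) atTop atTop :=
      tendsto_natCast_atTop_atTop.const_mul_atTop (by positivity)
    filter_upwards [h1.eventually_ge_atTop (2 * c + 1)] with N hN
    linarith
  filter_upwards [hM, hA', hlarge, eventually_gt_atTop 0] with N hM hA' hN hN0 X hX
  have hX2 : X.2 ∈ Metric.ball η₀ δ' := by
    rw [hX₀, Metric.mem_ball, Prod.dist_eq, max_lt_iff] at hX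
    exact hX.2
  have hI := hM.integral_gaussKernel_pos
  have hfint : ∀ {V : Type} [NormedAddCommGroup V] [NormedSpace ℝ V] {k : Vec n → V},
      Continuous k → Integrable fun θ => f (θ, X.2) • k (θ - X.1) := by
    intro V _ _ k hk
    refine Continuous.integrable_of_hasCompactSupport ?_ ?_
    · exact (hf.continuous.comp (by fun_prop)).smul (hk.comp (by fun_prop))
    · refine HasCompactSupport.intro (K := Prod.fst '' tsupport f)
        (hfc.isCompact.image continuous_fst) fun θ hθ => ?_
      have : f (θ, X.2) = 0 := by
        by_contra h3
        exact hθ ⟨(θ, X.2), subset_tsupport f h3, rfl⟩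
      rw [this, zero_smul]
  have hgint : ∀ {V : Type} [NormedAddCommGroup V] [NormedSpace ℝ V] {k : Vec n → V},
      HasGaussDecay k (a * N) (1 + b * N) → Integrable fun θ => g θ X.2 • k (θ - X.1) := by
    intro V _ _ k hk
    exact hk.integrable_smul hw.nonneg hN (hgm _).aestronglyMeasurable hw.integrable
      (hgb.mono fun θ hθ => (hθ _ hX2).1) X.1
  have hsplit : ∀ θ, w θ X.2 = f (θ, X.2) + g θ X.2 := fun θ => by simp [hg]
  have hden : postDen (M N) w X = (∫ z, gaussKernel (M N) z • f (X.1 + z, X.2)) +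
      ∫ θ, g θ X.2 • gaussKernel (M N) (θ - X.1) := by
    rw [postDen, ← integral_shift_eq]
    simp only [hsplit, add_smul]
    exact integral_add (hfint (continuous_gaussKernel _)) (hgint hM.hasGaussDecay)
  have hnum : (N : ℝ) • postNum (M N) w X =
      A' N (∫ z, gaussKernel (M N) z • partialGrad f (X.1 + z, X.2)) +
      (N : ℝ) • ∫ θ, g θ X.2 • (gaussKernel (M N) (θ - X.1) • (θ - X.1)) := by
    rw [postNum, ← hM.smul_integral_shift hA' hf hfc, ← smul_add]
    congr 1
    simp only [hsplit, add_smul]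
    exact integral_add (hfint (k := fun z => gaussKernel (M N) z • z)
      ((continuous_gaussKernel _).smul continuous_id)) (hgint hM.hasGaussDecay_smul)
  simp only [hΨ]
  -- The inverse masses of the kernel, introduced only to make numerator and denominator converge,
  -- cancel in the quotient.
  rw [smul_comm, hnum, hden, ← smul_add, smul_eq_mul, mul_inv, inv_inv]
  rw [map_smul, mul_comm (N : ℝ), ← smul_smul (_)⁻¹ (N : ℝ), ← smul_add, smul_smul]
  congr 1
  field_simp

end Posterior

/-! ### Linear growth of the posterior shift -/

section Growth

variable {n p : ℕ}

/-- Only a ball around `θ₀` on which the weight is at least `m` is kept. Its points lie within `1 +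
‖x - θ₀‖` of `x` because `ρ ≤ 1`. -/
theorem le_postDen {M : Vec n →L[ℝ] Vec n} {a b : ℝ} (hM : IsPrecision M a b)
    {w : Vec n → Vec p → ℝ} {θ₀ : Vec n} {η : Vec p} {ρ m : ℝ} (hρ1 : ρ ≤ 1)
    (hw0 : ∀ θ, 0 ≤ w θ η) (hwm : ∀ θ ∈ Metric.ball θ₀ ρ, m ≤ w θ η) {x : Vec n}
    (hi : Integrable fun θ => w θ η • gaussKernel M (θ - x)) :
    m * volume.real (Metric.ball θ₀ ρ) * Real.exp (-(b / 2) * (1 + ‖x - θ₀‖) ^ 2) ≤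
      postDen M w (x, η) := by
  have hb := hM.pos'
  have h1 : ∀ θ ∈ Metric.ball θ₀ ρ, m * Real.exp (-(b / 2) * (1 + ‖x - θ₀‖) ^ 2) ≤
      w θ η • gaussKernel M (θ - x) := by
    intro θ hθ
    have h2 : ‖θ - x‖ ≤ 1 + ‖x - θ₀‖ := by
      have h3 := mem_ball_iff_norm.1 hθ
      have h4 : ‖θ - x‖ ≤ ‖θ - θ₀‖ + ‖θ₀ - x‖ := norm_sub_le_norm_sub_add_norm_sub _ _ _
      rw [norm_sub_rev θ₀ x] at h4
      linarith
    refine mul_le_mul (hwm θ hθ) (le_trans ?_ (hM.le_gaussKernel _)) (Real.exp_pos _).le (hw0 θ)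
    refine Real.exp_le_exp.2 ?_
    have : ‖θ - x‖ ^ 2 ≤ (1 + ‖x - θ₀‖) ^ 2 := by gcongr
    nlinarith
  calc m * volume.real (Metric.ball θ₀ ρ) * Real.exp (-(b / 2) * (1 + ‖x - θ₀‖) ^ 2)
      = ∫ θ in Metric.ball θ₀ ρ, m * Real.exp (-(b / 2) * (1 + ‖x - θ₀‖) ^ 2) := by
        rw [setIntegral_const, smul_eq_mul]; ring
    _ ≤ ∫ θ in Metric.ball θ₀ ρ, w θ η • gaussKernel M (θ - x) :=
        setIntegral_mono_on (integrableOn_const measure_ball_lt_top.ne)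
          hi.integrableOn Metric.isOpen_ball.measurableSet h1
    _ ≤ _ := setIntegral_le_integral hi
        (ae_of_all _ fun θ => mul_nonneg (hw0 θ) (gaussKernel_pos M _).le)

/-- The integral is split at `‖θ - x‖ = R`. Inside, the integrand is at most `R` times that of the
denominator; outside, half of the Gaussian exponent leaves the factor `exp (-(a / 4) * R ^ 2)`. The
radius is left free so that it can grow with `x`. -/
theorem norm_postNum_le {M : Vec n →L[ℝ] Vec n} {a b c : ℝ} (hM : IsPrecision M a b)
    {w : Vec n → Vec p → ℝ} {η : Vec p} {H : Vec n → ℝ} (hc : 0 ≤ c) (hA : 2 * c + 1 ≤ a / 4)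
    (hw0 : ∀ θ, 0 ≤ w θ η) (hH : Integrable H)
    (hwH : ∀ᵐ θ, ‖w θ η‖ ≤ Real.exp (c * ‖θ‖ ^ 2) * H θ) {x : Vec n}
    (hi : Integrable fun θ => w θ η • gaussKernel M (θ - x)) {R : ℝ} (hR : 0 ≤ R) :
    ‖postNum M w (x, η)‖ ≤ R * postDen M w (x, η) +
      Real.exp (2 * c * ‖x‖ ^ 2) * Real.exp (-(a / 4) * R ^ 2) * ∫ θ, H θ := by
  rw [postDen, ← integral_const_mul, ← integral_const_mul, ← integral_add (hi.const_mul _)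
    (hH.const_mul _)]
  refine norm_integral_le_of_norm_le ((hi.const_mul _).add (hH.const_mul _)) ?_
  filter_upwards [hwH] with θ hθ
  have hH0 : 0 ≤ H θ := nonneg_of_mul_nonneg_right ((norm_nonneg _).trans hθ) (Real.exp_pos _)
  have hκ := gaussKernel_pos M (θ - x)
  have hwκ : 0 ≤ w θ η * gaussKernel M (θ - x) := mul_nonneg (hw0 θ) hκ.le
  have hE : 0 ≤ Real.exp (2 * c * ‖x‖ ^ 2) * Real.exp (-(a / 4) * R ^ 2) * H θ := by positivity
  simp only [smul_eq_mul]
  rw [norm_smul, norm_smul, Real.norm_of_nonneg (hw0 θ), Real.norm_of_nonneg hκ.le]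
  by_cases hz : ‖θ - x‖ ≤ R
  · have := mul_le_mul_of_nonneg_left hz hwκ
    nlinarith
  · push Not at hz
    rw [Real.norm_of_nonneg (hw0 θ)] at hθ
    have ha := hM.pos
    have h2 : R ^ 2 ≤ ‖θ - x‖ ^ 2 := by gcongr
    have h1 : w θ η * (gaussKernel M (θ - x) * ‖θ - x‖) ≤
        Real.exp (2 * c * ‖x‖ ^ 2) * Real.exp (-(a / 4) * R ^ 2) * H θ := by
      calc w θ η * (gaussKernel M (θ - x) * ‖θ - x‖)
          ≤ (Real.exp (c * ‖θ‖ ^ 2) * H θ) *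
            (Real.exp (-(a / 2) * ‖θ - x‖ ^ 2) * (1 + ‖θ - x‖ ^ 2)) := by
            gcongr
            · exact hM.gaussKernel_le _
            · nlinarith [sq_nonneg (‖θ - x‖ - 1), norm_nonneg (θ - x)]
        _ = (Real.exp (c * ‖θ‖ ^ 2) *
            ((1 + ‖θ - x‖ ^ 2) * Real.exp (-(a / 2) * ‖θ - x‖ ^ 2))) * H θ := by ring
        _ ≤ (Real.exp (2 * c * ‖x‖ ^ 2) * Real.exp (-(a / 4) * ‖θ - x‖ ^ 2)) * H θ :=
            mul_le_mul_of_nonneg_right (exp_mul_sq_mul_decay_le hc hA θ x) hH0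
        _ ≤ _ := mul_le_mul_of_nonneg_right (mul_le_mul_of_nonneg_left
            (Real.exp_le_exp.2 (by nlinarith)) (Real.exp_pos _).le) hH0
    have := mul_nonneg hR hwκ
    linarith

/-- For `x` far from `θ₀` the denominator may be as small as `exp(-b N (1 + ‖x - θ₀‖)² / 2)`.
Splitting the numerator at a radius proportional to `1 + ‖x - θ₀‖` makes its tail smaller still, so
the ratio grows at most linearly, uniformly in `N` and in `η` near `η₀`. -/
theorem exists_norm_posterior_le {M : ℕ → Vec n →L[ℝ] Vec n} {a b : ℝ} (ha : 0 < a) (hb : 0 < b)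
    (hM : ∀ᶠ N : ℕ in atTop, IsPrecision (M N) (a * N) (b * N))
    {w : Vec n → Vec p → ℝ} {θ₀ : Vec n} {η₀ : Vec p} {δ c : ℝ} {H : Vec n → ℝ}
    (hw : DominatedNear w η₀ δ c H) (hsm : ContinuousAt (Function.uncurry w) (θ₀, η₀))
    (h0 : 0 < w θ₀ η₀) (hw0 : ∀ η ∈ Metric.ball η₀ δ, ∀ θ, 0 ≤ w θ η) :
    ∃ δ' > 0, ∃ K, 0 ≤ K ∧ ∀ᶠ N : ℕ in atTop, ∀ η ∈ Metric.ball η₀ δ', ∀ x,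
      0 < postDen (M N) w (x, η) ∧
      ‖(postDen (M N) w (x, η))⁻¹ • postNum (M N) w (x, η)‖ ≤ K * (1 + ‖x - θ₀‖) := by
  set m := w θ₀ η₀ / 2 with hm
  have hm0 : 0 < m := by positivity
  have h1 : ∀ᶠ X in 𝓝 (θ₀, η₀), m < Function.uncurry w X :=
    hsm.eventually_const_lt (by simp only [Function.uncurry]; linarith)
  obtain ⟨ρ', hρ', hball⟩ := Metric.eventually_nhds_iff_ball.1 h1
  set ρ := min ρ' 1 with hρ
  have hρ0 : 0 < ρ := by positivity
  have hwm : ∀ η ∈ Metric.ball η₀ ρ, ∀ θ ∈ Metric.ball θ₀ ρ, m ≤ w θ η := fun η hη θ hθ => by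
    refine (hball (θ, η) ?_).le
    rw [Metric.mem_ball, Prod.dist_eq]
    exact max_lt (hθ.trans_le (min_le_left _ _)) (hη.trans_le (min_le_left _ _))
  set v := volume.real (Metric.ball θ₀ ρ) with hv
  have hv0 : 0 < v := ENNReal.toReal_pos (Metric.measure_ball_pos _ _ hρ0).ne'
    measure_ball_lt_top.ne
  set I := ∫ θ, H θ with hI
  have hI0 : 0 ≤ I := integral_nonneg_of_ae hw.ae_nonneg
  -- Chosen so that `a / 4 * B ^ 2` exceeds `b / 2` by at least `1`. The surplus absorbs `exp (2 * c
  -- * ‖x‖ ^ 2)` once `N ≥ 2 * c * (‖θ₀‖ + 1) ^ 2`.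
  set B : ℝ := 1 + 4 * (b / 2 + 1) / a with hB
  have hB0 : 0 < B := by positivity
  have hBsq : b / 2 + 1 ≤ a / 4 * B ^ 2 := by
    have h2 : 4 * (b / 2 + 1) / a ≤ B ^ 2 := by
      have : 0 ≤ 4 * (b / 2 + 1) / a := by positivity
      nlinarith
    rw [div_le_iff₀ ha] at h2
    linarith
  refine ⟨min δ ρ, lt_min hw.pos hρ0, B + I / (m * v), by positivity, ?_⟩
  have hlarge : ∀ᶠ N : ℕ in atTop, 2 * c + 1 ≤ a * N / 4 := by
    have h1 : Tendsto (fun N : ℕ => a / 4 * (N : ℝ)) atTop atTop :=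
      tendsto_natCast_atTop_atTop.const_mul_atTop (by positivity)
    filter_upwards [h1.eventually_ge_atTop (2 * c + 1)] with N hN
    linarith
  filter_upwards [hM, hlarge,
    tendsto_natCast_atTop_atTop.eventually_ge_atTop (2 * c * (‖θ₀‖ + 1) ^ 2)] with
    N hM hN hN2 η hη x
  have hηδ := Metric.ball_subset_ball (min_le_left δ ρ) hη
  have hηρ := Metric.ball_subset_ball (min_le_right δ ρ) hη
  have hi : Integrable fun θ => w θ η • gaussKernel (M N) (θ - x) :=
    hM.hasGaussDecay.integrable_smul hw.nonneg hN (hw.meas η).aestronglyMeasurable hw.integrable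
      (hw.ae_norm_le hηδ) x
  set r := ‖x - θ₀‖ with hr
  have hr0 : 0 ≤ r := norm_nonneg _
  have hD := le_postDen hM (min_le_right _ _) (hw0 η hηδ) (hwm η hηρ) hi
  rw [← hv, ← hr] at hD
  have hD0 : 0 < m * v * Real.exp (-(b * N / 2) * (1 + r) ^ 2) := by positivity
  have hpos := hD0.trans_le hD
  refine ⟨hpos, ?_⟩
  have hnum := norm_postNum_le hM hw.nonneg hN (hw0 η hηδ) hw.integrable (hw.ae_norm_le hηδ) hi
    (R := B * (1 + r)) (by positivity)
  rw [norm_smul, norm_inv, Real.norm_of_nonneg hpos.le, inv_mul_le_iff₀ hpos]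
  refine hnum.trans ?_
  have hx : ‖x‖ ≤ (‖θ₀‖ + 1) * (1 + r) := by
    have : ‖x‖ ≤ r + ‖θ₀‖ := by simpa using norm_add_le (x - θ₀) θ₀
    nlinarith [norm_nonneg θ₀, mul_nonneg (norm_nonneg θ₀) hr0]
  have hexp : Real.exp (2 * c * ‖x‖ ^ 2) * Real.exp (-(a * N / 4) * (B * (1 + r)) ^ 2) ≤
      Real.exp (-(b * N / 2) * (1 + r) ^ 2) := by
    rw [← Real.exp_add]
    refine Real.exp_le_exp.2 ?_
    have h3 : ‖x‖ ^ 2 ≤ ((‖θ₀‖ + 1) * (1 + r)) ^ 2 := by gcongr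
    have h4 : 2 * c * ‖x‖ ^ 2 ≤ N * (1 + r) ^ 2 := by
      calc 2 * c * ‖x‖ ^ 2 ≤ 2 * c * ((‖θ₀‖ + 1) * (1 + r)) ^ 2 := by
            have := hw.nonneg
            gcongr
        _ = 2 * c * (‖θ₀‖ + 1) ^ 2 * (1 + r) ^ 2 := by ring
        _ ≤ _ := by gcongr
    have h5 : (b / 2 + 1) * (N * (1 + r) ^ 2) ≤ a / 4 * B ^ 2 * (N * (1 + r) ^ 2) := by gcongr
    nlinarith
  have h6 : Real.exp (2 * c * ‖x‖ ^ 2) * Real.exp (-(a * N / 4) * (B * (1 + r)) ^ 2) * I ≤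
      I / (m * v) * postDen (M N) w (x, η) := by
    calc _ ≤ Real.exp (-(b * N / 2) * (1 + r) ^ 2) * I := by gcongr
      _ = I / (m * v) * (m * v * Real.exp (-(b * N / 2) * (1 + r) ^ 2)) := by field_simp
      _ ≤ _ := by gcongr
  have h7 : 0 ≤ I / (m * v) * postDen (M N) w (x, η) * r := by positivity
  nlinarith

end Growth

/-! ### The estimators in terms of the Gaussian kernel -/

section Model

variable {n p : ℕ}

/-- The operator `σ⁻² ΦᵀΦ`. -/
noncomputable def precOp (u : ℕ → ℝ) (σ : ℝ) (n N : ℕ) : Vec n →L[ℝ] Vec n :=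
  (σ ^ 2)⁻¹ • Matrix.toEuclideanCLM (𝕜 := ℝ) (gram u n N)

theorem toEuclideanCLM_eq_mulV (A : Matrix (Fin n) (Fin n) ℝ) (x : Vec n) :
    Matrix.toEuclideanCLM (𝕜 := ℝ) A x = mulV A x := rfl

theorem inner_precOp (u : ℕ → ℝ) (σ : ℝ) (n N : ℕ) (x y : Vec n) :
    inner ℝ (precOp u σ n N x) y =
      (σ ^ 2)⁻¹ * inner ℝ (mulV (regressor u n N) x) (mulV (regressor u n N) y) := by
  rw [precOp, smul_apply, real_inner_smul_left, toEuclideanCLM_eq_mulV, gram, ← mulV_mulV,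
    inner_mulV]

/-- With data `Φ x` the residual is `Φ (x - θ)`, so in `θ` the likelihood is a Gaussian kernel
centred at `x`. -/
theorem likelihood_mulV (u : ℕ → ℝ) (σ : ℝ) {n N : ℕ} (x θ : Vec n) :
    likelihood u σ (mulV (regressor u n N) x) θ =
      (2 * Real.pi * σ ^ 2) ^ (-(N : ℝ) / 2) * gaussKernel (precOp u σ n N) (θ - x) := by
  rw [likelihood, gaussKernel, inner_precOp, real_inner_self_eq_norm_sq, mulV_sub, norm_sub_rev]
  congr 2
  ring

theorem exists_coercive {S : Matrix (Fin n) (Fin n) ℝ} (hS : S.PosDef) :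
    ∃ l > 0, ∀ z : Vec n, l * ‖z‖ ^ 2 ≤ inner ℝ (mulV S z) z := by
  have hpos : ∀ z : Vec n, z ≠ 0 → 0 < inner ℝ (mulV S z) z := fun z hz => by
    have h1 : z.ofLp ≠ 0 := fun h => hz (by ext i; simp [h])
    have h2 := hS.dotProduct_mulVec_pos h1
    rw [real_inner_comm]
    simpa [mulV, EuclideanSpace.inner_eq_star_dotProduct, dotProduct_comm] using h2
  rcases subsingleton_or_nontrivial (Vec n) with h | h
  -- In dimension zero the unit sphere is empty and provides no minimizer. In positive dimension the
  -- minimum over the sphere works by homogeneity.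
  · refine ⟨1, one_pos, fun z => ?_⟩
    rw [Subsingleton.elim z 0]
    simp
  have hcont : Continuous fun z : Vec n => inner ℝ (mulV S z) z :=
    (Matrix.toEuclideanCLM (𝕜 := ℝ) S).continuous.inner continuous_id
  obtain ⟨z₀, hz₀, hmin⟩ := (isCompact_sphere (0 : Vec n) 1).exists_isMinOn
    (NormedSpace.sphere_nonempty.2 zero_le_one) hcont.continuousOn
  have hz₀0 : z₀ ≠ 0 := fun h => by simp [h] at hz₀
  refine ⟨inner ℝ (mulV S z₀) z₀, hpos z₀ hz₀0, fun z => ?_⟩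
  by_cases hz : z = 0
  · simp [hz, mulV]
  have hz' : ‖z‖ ≠ 0 := norm_ne_zero_iff.2 hz
  have h1 : ‖z‖⁻¹ • z ∈ Metric.sphere (0 : Vec n) 1 := by
    simp [norm_smul, hz']
  have h2 := isMinOn_iff.1 hmin _ h1
  have h3 : inner ℝ (mulV S (‖z‖⁻¹ • z)) (‖z‖⁻¹ • z) =
      (‖z‖ ^ 2)⁻¹ * inner ℝ (mulV S z) z := by
    rw [← toEuclideanCLM_eq_mulV, map_smul, real_inner_smul_left, real_inner_smul_right,
      toEuclideanCLM_eq_mulV]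
    ring
  rw [h3, le_inv_mul_iff₀ (by positivity)] at h2
  linarith

theorem tendsto_toEuclideanCLM {B : ℕ → Matrix (Fin n) (Fin n) ℝ} {S : Matrix (Fin n) (Fin n) ℝ}
    (h : Tendsto B atTop (𝓝 S)) : Tendsto (fun N => Matrix.toEuclideanCLM (𝕜 := ℝ) (B N)) atTop
      (𝓝 (Matrix.toEuclideanCLM (𝕜 := ℝ) S)) := by
  have h1 : Continuous fun B : Matrix (Fin n) (Fin n) ℝ => Matrix.toEuclideanCLM (𝕜 := ℝ) B :=
    LinearMap.continuous_of_finiteDimensional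
      (Matrix.toEuclideanCLM (n := Fin n) (𝕜 := ℝ)).toAlgEquiv.toLinearMap
  exact (h1.tendsto S).comp h

variable {u : ℕ → ℝ} {σ : ℝ} {S : Matrix (Fin n) (Fin n) ℝ}

theorem precOp_eq {N : ℕ} (hN : N ≠ 0) : precOp u σ n N =
    ((σ ^ 2)⁻¹ * N) • Matrix.toEuclideanCLM (𝕜 := ℝ) ((N : ℝ)⁻¹ • gram u n N) := by
  have : (N : ℝ) ≠ 0 := by exact_mod_cast hN
  rw [map_smul, smul_smul, mul_assoc, mul_inv_cancel₀ this, mul_one, precOp]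

theorem exists_isPrecision (hσ : 0 < σ) (hS : S.PosDef)
    (hgram : Tendsto (fun N : ℕ => (N : ℝ)⁻¹ • gram u n N) atTop (𝓝 S)) :
    ∃ a > 0, ∃ b > 0, ∀ᶠ N : ℕ in atTop, IsPrecision (precOp u σ n N) (a * N) (b * N) := by
  obtain ⟨l, hl, hlow⟩ := exists_coercive hS
  have hB := tendsto_toEuclideanCLM hgram
  set B := Matrix.toEuclideanCLM (𝕜 := ℝ) S with hBdef
  refine ⟨(σ ^ 2)⁻¹ * (l / 2), by positivity, (σ ^ 2)⁻¹ * (‖B‖ + 1), by positivity, ?_⟩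
  -- Operator distance below `l / 2` keeps half of the coercivity of the limit, and distance below
  -- `1` gives the norm bound `‖B‖ + 1`.
  filter_upwards [eventually_gt_atTop 0, Metric.tendsto_nhds.1 hB (min (l / 2) 1)
    (by positivity)] with N hN hd
  rw [dist_eq_norm] at hd
  set BN := Matrix.toEuclideanCLM (𝕜 := ℝ) ((N : ℝ)⁻¹ • gram u n N) with hBN
  have hN' : (0 : ℝ) < N := by exact_mod_cast hN
  refine ⟨by positivity, by positivity, fun x y => ?_, fun z => ?_, ?_⟩
  · rw [inner_precOp, real_inner_comm (precOp u σ n N y) x, inner_precOp, real_inner_comm]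
  · have h1 : inner ℝ (B z) z - inner ℝ (BN z) z ≤ l / 2 * ‖z‖ ^ 2 := by
      rw [← inner_sub_left]
      calc inner ℝ (B z - BN z) z ≤ ‖B z - BN z‖ * ‖z‖ := real_inner_le_norm _ _
        _ ≤ (l / 2 * ‖z‖) * ‖z‖ := by
            gcongr
            rw [norm_sub_rev, ← sub_apply]
            refine ((BN - B).le_opNorm z).trans ?_
            gcongr
            exact hd.le.trans (min_le_left _ _)
        _ = _ := by ring
    have h2 : l * ‖z‖ ^ 2 ≤ inner ℝ (B z) z := hlow z
    rw [precOp_eq hN.ne', smul_apply, real_inner_smul_left, ← hBN]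
    have h3 : l / 2 * ‖z‖ ^ 2 ≤ inner ℝ (BN z) z := by linarith
    calc (σ ^ 2)⁻¹ * (l / 2) * N * ‖z‖ ^ 2 = (σ ^ 2)⁻¹ * N * (l / 2 * ‖z‖ ^ 2) := by ring
      _ ≤ _ := by gcongr
  · rw [precOp_eq hN.ne', norm_smul, Real.norm_of_nonneg (by positivity), ← hBN]
    have h4 : ‖BN‖ ≤ ‖B‖ + 1 := by
      have h5 : ‖BN‖ ≤ ‖BN - B‖ + ‖B‖ := by simpa using norm_add_le (BN - B) B
      linarith [min_le_right (l / 2) 1]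
    calc (σ ^ 2)⁻¹ * N * ‖BN‖ ≤ (σ ^ 2)⁻¹ * N * (‖B‖ + 1) := by gcongr
      _ = _ := by ring

theorem eventually_isUnit_det (hS : S.PosDef)
    (hgram : Tendsto (fun N : ℕ => (N : ℝ)⁻¹ • gram u n N) atTop (𝓝 S)) :
    ∀ᶠ N : ℕ in atTop, IsUnit (gram u n N).det := by
  have h1 : Tendsto (fun N : ℕ => ((N : ℝ)⁻¹ • gram u n N).det) atTop (𝓝 S.det) :=
    ((continuous_id.matrix_det).tendsto S).comp hgram
  filter_upwards [h1.eventually_ne hS.det_pos.ne'] with N hN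
  rw [Matrix.det_smul] at hN
  exact isUnit_iff_ne_zero.2 (right_ne_zero_of_mul hN)

/-- The inverse is the adjugate divided by the determinant. Both are continuous, and the determinant
of the limit is nonzero. -/
theorem tendsto_inv_gram (hS : S.PosDef)
    (hgram : Tendsto (fun N : ℕ => (N : ℝ)⁻¹ • gram u n N) atTop (𝓝 S)) :
    Tendsto (fun N : ℕ => (N : ℝ) • (gram u n N)⁻¹) atTop (𝓝 S⁻¹) := by
  have h1 : Tendsto (fun N : ℕ => ((N : ℝ)⁻¹ • gram u n N).det) atTop (𝓝 S.det) :=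
    ((continuous_id.matrix_det).tendsto S).comp hgram
  have h2 : Tendsto (fun N : ℕ => ((N : ℝ)⁻¹ • gram u n N).adjugate) atTop (𝓝 S.adjugate) :=
    ((continuous_id.matrix_adjugate).tendsto S).comp hgram
  have h3 := (h1.inv₀ hS.det_pos.ne').smul h2
  rw [Matrix.inv_def, Ring.inverse_eq_inv']
  refine h3.congr' ?_
  filter_upwards [eventually_isUnit_det hS hgram, eventually_gt_atTop 0] with N hN hN0
  have hN' : (N : ℝ) ≠ 0 := by positivity
  rw [← Ring.inverse_eq_inv', ← Matrix.inv_def]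
  refine Matrix.inv_eq_left_inv ?_
  rw [Matrix.smul_mul, Matrix.mul_smul, smul_smul, Ring.inverse_eq_inv', mul_inv_cancel₀ hN', one_smul,
    Matrix.nonsing_inv_mul _ hN]

/-- The scaled inverse of `precOp`. -/
noncomputable def scaledCov (u : ℕ → ℝ) (σ : ℝ) (n N : ℕ) : Vec n →L[ℝ] Vec n :=
  σ ^ 2 • Matrix.toEuclideanCLM (𝕜 := ℝ) ((N : ℝ) • (gram u n N)⁻¹)

theorem tendsto_scaledCov (hS : S.PosDef)
    (hgram : Tendsto (fun N : ℕ => (N : ℝ)⁻¹ • gram u n N) atTop (𝓝 S)) :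
    Tendsto (scaledCov u σ n) atTop (𝓝 (σ ^ 2 • Matrix.toEuclideanCLM (𝕜 := ℝ) S⁻¹)) :=
  (tendsto_toEuclideanCLM (tendsto_inv_gram hS hgram)).const_smul _

theorem scaledCov_precOp (hσ : 0 < σ) {N : ℕ} (h : IsUnit (gram u n N).det) (v : Vec n) :
    scaledCov u σ n N (precOp u σ n N v) = (N : ℝ) • v := by
  rw [scaledCov, precOp, smul_apply, smul_apply, map_smul, smul_smul,
    mul_inv_cancel₀ (by positivity), one_smul, map_smul, smul_apply, toEuclideanCLM_eq_mulV,
    toEuclideanCLM_eq_mulV, mulV_mulV, Matrix.nonsing_inv_mul _ h]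
  simp [mulV]

/-- Writing `θ = x + (θ - x)` separates the centre of the kernel from the shift, and the normalizing
constant of the likelihood cancels in the ratio. -/
theorem ebOfMLE_eq (hσ : 0 < σ) {w : Vec n → Vec p → ℝ} {N : ℕ} {x : Vec n} {η : Vec p}
    (h1 : Integrable fun θ => w θ η • gaussKernel (precOp u σ n N) (θ - x))
    (h2 : Integrable fun θ => w θ η • (gaussKernel (precOp u σ n N) (θ - x) • (θ - x)))
    (h3 : postDen (precOp u σ n N) w (x, η) ≠ 0) :
    ebOfMLE u σ w N x η = x + (postDen (precOp u σ n N) w (x, η))⁻¹ •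
      postNum (precOp u σ n N) w (x, η) := by
  set C : ℝ := (2 * Real.pi * σ ^ 2) ^ (-(N : ℝ) / 2) with hC
  have hC0 : C ≠ 0 := (Real.rpow_pos_of_pos (by positivity) _).ne'
  have e1 : ∫ θ, likelihood u σ (mulV (regressor u n N) x) θ * w θ η =
      C * postDen (precOp u σ n N) w (x, η) := by
    rw [postDen, ← integral_const_mul]
    congr 1
    ext θ
    rw [likelihood_mulV, smul_eq_mul]
    ring
  have e2 : ∫ θ, (likelihood u σ (mulV (regressor u n N) x) θ * w θ η) • θ =
      C • (postNum (precOp u σ n N) w (x, η) + postDen (precOp u σ n N) w (x, η) • x) := by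
    rw [postDen, postNum, ← integral_smul_const, ← integral_add h2 (h1.smul_const x),
      ← integral_smul]
    congr 1
    ext1 θ
    rw [likelihood_mulV]
    simp only [smul_eq_mul, smul_smul, smul_sub, sub_add_cancel]
    congr 1
    ring
  rw [ebOfMLE, ebEstimate, e1, e2, smul_smul, mul_inv, mul_comm C⁻¹, inv_mul_cancel_right₀ hC0,
    smul_add, smul_smul, inv_mul_cancel₀ h3, one_smul, add_comm]

/-- The domination hypothesis concerns derivatives in the hyper-parameter only. A bound for `w` at
`η` itself comes from convergence of the denominator for a single `N`, because the kernel is at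
least `exp (-(b * N / 2) * ‖θ‖ ^ 2)`. The mean value inequality carries the bound to nearby
hyper-parameters. -/
theorem exists_dominatedNear (hσ : 0 < σ) {a b : ℝ} (hM : ∀ᶠ N : ℕ in atTop,
      IsPrecision (precOp u σ n N) (a * N) (b * N))
    {Dη : Set (Vec p)} {w : Vec n → Vec p → ℝ} (hw_meas : Measurable (Function.uncurry w))
    {η : Vec p} (hη : η ∈ interior Dη)
    (hw_dom : ∃ U ∈ 𝓝 η, ∃ c : ℝ, ∃ h : Vec n → ℝ, Integrable h ∧
      ∀ᵐ θ : Vec n, ∀ η' ∈ U, DifferentiableAt ℝ (w θ) η' ∧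
        ‖fderiv ℝ (w θ) η'‖ * Real.exp (-c * ‖θ‖ ^ 2) ≤ h θ)
    (hwell : ∀ᶠ N : ℕ in atTop, ∀ Y : Vec N, EBWellDefined u σ w Y η) :
    ∃ δ c H, DominatedNear w η δ c H ∧ Metric.ball η δ ⊆ Dη := by
  obtain ⟨U, hU, c₂, h, hh, hb⟩ := hw_dom
  obtain ⟨N, hM, hN⟩ := (hM.and hwell).exists
  obtain ⟨δ, hδ, hδU⟩ := Metric.mem_nhds_iff.1
    (inter_mem hU (mem_interior_iff_mem_nhds.1 hη))
  have hmeas : ∀ η, Measurable fun θ => w θ η := fun η =>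
    hw_meas.comp (measurable_id.prodMk measurable_const)
  set c₁ := b * N / 2 with hc₁
  have hc₁0 : 0 < c₁ := half_pos hM.pos'
  have hi : Integrable fun θ => Real.exp (-c₁ * ‖θ‖ ^ 2) * ‖w θ η‖ := by
    have h1 := (hN (mulV (regressor u n N) 0)).1
    set C : ℝ := (2 * Real.pi * σ ^ 2) ^ (-(N : ℝ) / 2) with hC
    have hC0 : 0 < C := Real.rpow_pos_of_pos (by positivity) _
    refine (h1.const_mul C⁻¹).mono (Continuous.aestronglyMeasurable (by fun_prop) |>.mul
      (hmeas η).norm.aestronglyMeasurable) (ae_of_all _ fun θ => ?_)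
    rw [likelihood_mulV, sub_zero, ← hC, norm_mul, norm_mul, norm_mul, norm_norm, norm_mul,
      norm_inv, ← mul_assoc, ← mul_assoc, inv_mul_cancel₀ (norm_ne_zero_iff.2 hC0.ne'), one_mul,
      Real.norm_of_nonneg (Real.exp_pos _).le, Real.norm_of_nonneg (gaussKernel_pos _ _).le]
    gcongr
    exact hM.le_gaussKernel θ
  set c := max c₁ c₂ with hc
  -- The factor `δ + 1` exceeds the radius, as the mean value inequality needs, and is at least `1`,
  -- so the same function dominates the derivative too.
  refine ⟨δ, c, fun θ => Real.exp (-c₁ * ‖θ‖ ^ 2) * ‖w θ η‖ + (δ + 1) * ‖h θ‖,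
    ⟨hδ, hc₁0.le.trans (le_max_left _ _), hi.add (hh.norm.const_mul _), hmeas, ?_⟩,
    hδU.trans Set.inter_subset_right⟩
  filter_upwards [hb] with θ hθ η' hη'
  have hE : ∀ c' ≤ c, 1 ≤ Real.exp (c * ‖θ‖ ^ 2) * Real.exp (-c' * ‖θ‖ ^ 2) := fun c' hc' => by
    rw [← Real.exp_add]
    refine Real.one_le_exp ?_
    nlinarith [sq_nonneg ‖θ‖]
  have hd : ∀ η' ∈ Metric.ball η δ,
      ‖fderiv ℝ (w θ) η'‖ ≤ Real.exp (c * ‖θ‖ ^ 2) * ‖h θ‖ := fun η' hη' => by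
    have h1 := (hθ η' (hδU hη').1).2
    calc ‖fderiv ℝ (w θ) η'‖
        ≤ ‖fderiv ℝ (w θ) η'‖ * (Real.exp (c * ‖θ‖ ^ 2) * Real.exp (-c₂ * ‖θ‖ ^ 2)) :=
          le_mul_of_one_le_right (norm_nonneg _) (hE c₂ (le_max_right _ _))
      _ = Real.exp (c * ‖θ‖ ^ 2) * (‖fderiv ℝ (w θ) η'‖ * Real.exp (-c₂ * ‖θ‖ ^ 2)) := by ring
      _ ≤ _ := by
          gcongr
          exact h1.trans (le_abs_self _)
  refine ⟨?_, (hθ η' (hδU hη').1).1, ?_⟩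
  · have h1 := (convex_ball η δ).norm_image_sub_le_of_norm_fderiv_le (𝕜 := ℝ)
      (fun η' hη' => (hθ η' (hδU hη').1).1) hd (Metric.mem_ball_self hδ) hη'
    have h2 : ‖η' - η‖ ≤ δ + 1 := by linarith [mem_ball_iff_norm.1 hη']
    have h3 : ‖w θ η'‖ ≤ ‖w θ η' - w θ η‖ + ‖w θ η‖ := by
      simpa using norm_add_le (w θ η' - w θ η) (w θ η)
    have h4 : ‖w θ η‖ ≤
        Real.exp (c * ‖θ‖ ^ 2) * (Real.exp (-c₁ * ‖θ‖ ^ 2) * ‖w θ η‖) := by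
      rw [← mul_assoc]
      exact le_mul_of_one_le_left (norm_nonneg _) (hE c₁ (le_max_left _ _))
    calc ‖w θ η'‖ ≤ Real.exp (c * ‖θ‖ ^ 2) * ‖h θ‖ * (δ + 1) +
          Real.exp (c * ‖θ‖ ^ 2) * (Real.exp (-c₁ * ‖θ‖ ^ 2) * ‖w θ η‖) := by
          refine h3.trans (add_le_add (h1.trans ?_) h4)
          gcongr
      _ = _ := by ring
  · refine (hd η' hη').trans ?_
    gcongr
    have h1 : 0 ≤ Real.exp (-c₁ * ‖θ‖ ^ 2) * ‖w θ η‖ := by positivity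
    nlinarith [norm_nonneg (h θ), mul_nonneg hδ.le (norm_nonneg (h θ))]

end Model

/-! ### Limits of the posterior mean as a function of the maximum likelihood estimate -/

section Deterministic

variable {n p : ℕ}

/-- `N (θ̂ᴱᴮ(η) - θ̂ᴹᴸ)` as a function of `(θ̂ᴹᴸ, η)`. -/
noncomputable def scaledShift (u : ℕ → ℝ) (σ : ℝ) (w : Vec n → Vec p → ℝ) (N : ℕ)
    (X : Vec n × Vec p) : Vec n :=
  (N : ℝ) • (ebOfMLE u σ w N X.1 X.2 - X.1)

/-- The limit of the derivative of `scaledShift` at `(θ₀, η)`. -/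
noncomputable def shiftDeriv (σ : ℝ) (S : Matrix (Fin n) (Fin n) ℝ) (w : Vec n → Vec p → ℝ)
    (θ₀ : Vec n) (η : Vec p) : Vec n × Vec p →L[ℝ] Vec n :=
  (σ ^ 2 • Matrix.toEuclideanCLM (𝕜 := ℝ) S⁻¹).comp (fderiv ℝ (logGrad w) (θ₀, η))

theorem eventually_le_mul_nat {a : ℝ} (ha : 0 < a) (c : ℝ) :
    ∀ᶠ N : ℕ in atTop, 2 * c + 1 ≤ a * N / 4 := by
  have h1 : Tendsto (fun N : ℕ => a / 4 * (N : ℝ)) atTop atTop :=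
    tendsto_natCast_atTop_atTop.const_mul_atTop (by positivity)
  filter_upwards [h1.eventually_ge_atTop (2 * c + 1)] with N hN
  linarith

/-- Local convergence, linear growth and differentiability of the posterior mean. -/
theorem posterior_facts {u : ℕ → ℝ} {σ : ℝ} (hσ : 0 < σ) {S : Matrix (Fin n) (Fin n) ℝ}
    (hS : S.PosDef) (hgram : Tendsto (fun N : ℕ => (N : ℝ)⁻¹ • gram u n N) atTop (𝓝 S))
    {Dη : Set (Vec p)} {w : Vec n → Vec p → ℝ} (hw_meas : Measurable (Function.uncurry w))
    (hw_nonneg : ∀ θ, ∀ η ∈ Dη, 0 ≤ w θ η) {θ₀ : Vec n} {η : Vec p} (hη : η ∈ interior Dη)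
    (hw_pos : 0 < w θ₀ η) (hw_smooth : ContDiffAt ℝ 2 (Function.uncurry w) (θ₀, η))
    (hw_dom : ∃ U ∈ 𝓝 η, ∃ c : ℝ, ∃ h : Vec n → ℝ, Integrable h ∧
      ∀ᵐ θ : Vec n, ∀ η' ∈ U, DifferentiableAt ℝ (w θ) η' ∧
        ‖fderiv ℝ (w θ) η'‖ * Real.exp (-c * ‖θ‖ ^ 2) ≤ h θ)
    (hwell : ∀ᶠ N : ℕ in atTop, ∀ Y : Vec N, EBWellDefined u σ w Y η) :
    DifferentiableAt ℝ (logGrad w) (θ₀, η) ∧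
    UnifStrictDiff (scaledShift u σ w) (θ₀, η) (limB σ S w θ₀ η) (shiftDeriv σ S w θ₀ η) ∧
    (∃ δ > 0, ∃ K, 0 ≤ K ∧ ∀ᶠ N : ℕ in atTop, ∀ η' ∈ Metric.ball η δ, ∀ x,
      ‖ebOfMLE u σ w N x η' - x‖ ≤ K * (1 + ‖x - θ₀‖)) ∧
    (∀ᶠ N : ℕ in atTop, DifferentiableAt ℝ (fun x => ebOfMLE u σ w N x η) θ₀) ∧
    (∀ᶠ N : ℕ in atTop, DifferentiableAt ℝ (fun η' => ebOfMLE u σ w N θ₀ η') η) := by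
  obtain ⟨a, ha, b, hb, hM⟩ := exists_isPrecision hσ hS hgram
  obtain ⟨δ, c, H, hw, hsub⟩ := exists_dominatedNear hσ hM hw_meas hη hw_dom hwell
  obtain ⟨hlog, husd⟩ := unifStrictDiff_posterior ha hb hM
    (A' := scaledCov u σ n) ((eventually_isUnit_det hS hgram).mono fun N h => scaledCov_precOp hσ h)
    (tendsto_scaledCov hS hgram) hw hw_smooth hw_pos.ne'
  obtain ⟨δ', hδ', K, hK, hgrow⟩ := exists_norm_posterior_le ha hb hM hw
    hw_smooth.continuousAt hw_pos (fun η' hη' θ => hw_nonneg θ η' (hsub hη'))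
  have heq : ∀ᶠ N : ℕ in atTop, ∀ η' ∈ Metric.ball η (min δ δ'), ∀ x,
      ebOfMLE u σ w N x η' = x + (postDen (precOp u σ n N) w (x, η'))⁻¹ •
        postNum (precOp u σ n N) w (x, η') := by
    filter_upwards [hM, hgrow, eventually_le_mul_nat ha c] with N hM hgrow hN η' hη' x
    have hη1 := Metric.ball_subset_ball (min_le_left _ _) hη'
    have hη2 := Metric.ball_subset_ball (min_le_right _ _) hη'
    refine ebOfMLE_eq hσ ?_ ?_ (hgrow η' hη2 x).1.ne'
    · exact hM.hasGaussDecay.integrable_smul hw.nonneg hN (hw.meas η').aestronglyMeasurable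
        hw.integrable (hw.ae_norm_le hη1) x
    · exact hM.hasGaussDecay_smul.integrable_smul hw.nonneg hN (hw.meas η').aestronglyMeasurable
        hw.integrable (hw.ae_norm_le hη1) x
  have hmin : 0 < min δ δ' := lt_min hw.pos hδ'
  refine ⟨hlog, ?_, ⟨min δ δ', hmin, K, hK, ?_⟩, ?_, ?_⟩
  · refine UnifStrictDiff.congr husd hmin ?_
    filter_upwards [heq] with N heq X hX
    have hX2 : X.2 ∈ Metric.ball η (min δ δ') := by
      rw [Metric.mem_ball, Prod.dist_eq, max_lt_iff] at hX
      exact hX.2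
    rw [scaledShift, heq _ hX2, add_sub_cancel_left]
  · filter_upwards [heq, hgrow] with N heq hgrow η' hη' x
    rw [heq η' hη', add_sub_cancel_left]
    exact (hgrow η' (Metric.ball_subset_ball (min_le_right _ _) hη') x).2
  · filter_upwards [hM, heq, hgrow, eventually_le_mul_nat ha c] with N hM heq hgrow hN
    have h1 : (fun x => ebOfMLE u σ w N x η) = fun x => x +
        (postDen (precOp u σ n N) w (x, η))⁻¹ • postNum (precOp u σ n N) w (x, η) := by
      ext1 x
      exact heq η (Metric.mem_ball_self hmin) x
    rw [h1]
    have hb := hw.ae_norm_le (Metric.mem_ball_self hw.pos)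
    have h2 : DifferentiableAt ℝ (fun x => postDen (precOp u σ n N) w (x, η)) θ₀ :=
      hM.hasGaussDecay.differentiableAt_integral hw.nonneg hN (hw.meas η).aestronglyMeasurable
        hw.integrable hb θ₀
    have h3 : DifferentiableAt ℝ (fun x => postNum (precOp u σ n N) w (x, η)) θ₀ :=
      hM.hasGaussDecay_smul.differentiableAt_integral hw.nonneg hN
        (hw.meas η).aestronglyMeasurable hw.integrable hb θ₀
    exact differentiableAt_fun_id.add
      ((h2.inv (hgrow η (Metric.mem_ball_self hδ') θ₀).1.ne').smul h3)
  · filter_upwards [hM, heq, hgrow, eventually_le_mul_nat ha c] with N hM heq hgrow hN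
    have h1 : (fun η' => ebOfMLE u σ w N θ₀ η') =ᶠ[𝓝 η] fun η' => θ₀ +
        (postDen (precOp u σ n N) w (θ₀, η'))⁻¹ • postNum (precOp u σ n N) w (θ₀, η') := by
      filter_upwards [Metric.ball_mem_nhds η hmin] with η' hη'
      exact heq η' hη' θ₀
    refine DifferentiableAt.congr_of_eventuallyEq ?_ h1
    have h2 : DifferentiableAt ℝ (fun η' => postDen (precOp u σ n N) w (θ₀, η')) η :=
      hw.differentiableAt_integral hM.hasGaussDecay hN θ₀
    have h3 : DifferentiableAt ℝ (fun η' => postNum (precOp u σ n N) w (θ₀, η')) η :=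
      hw.differentiableAt_integral hM.hasGaussDecay_smul hN θ₀
    exact (differentiableAt_const θ₀).add
      ((h2.inv (hgrow η (Metric.mem_ball_self hδ') θ₀).1.ne').smul h3)

theorem mulV_apply_eq {k m l : ℕ} (A : Matrix (Fin k) (Fin m) ℝ) (J : Matrix (Fin m) (Fin l) ℝ)
    (v : Vec m) (j : Fin l) (hv : ∀ i, v i = J i j) (i : Fin k) : mulV A v i = (A * J) i j := by
  simp [mulV, Matrix.mulVec, dotProduct, Matrix.mul_apply, hv]

/-- The Jacobian of a slice of `logGrad w` consists of columns of its joint derivative;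
`limBη_apply` is the analogue in the hyper-parameter. -/
theorem limBθ_apply {σ : ℝ} {S : Matrix (Fin n) (Fin n) ℝ} {w : Vec n → Vec p → ℝ} {θ₀ : Vec n}
    {η : Vec p} (h : DifferentiableAt ℝ (logGrad w) (θ₀, η)) (i j : Fin n) :
    limBθ σ S w θ₀ η i j = shiftDeriv σ S w θ₀ η (EuclideanSpace.single j 1, 0) i := by
  have h1 : HasFDerivAt (fun θ => logGrad w (θ, η)) _ θ₀ :=
    HasFDerivAt.comp θ₀ (g := logGrad w) h.hasFDerivAt (hasFDerivAt_prodMk_left θ₀ η)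
  change σ ^ 2 * (S⁻¹ * jacobian (fun θ => logGrad w (θ, η)) θ₀) i j =
    σ ^ 2 * mulV S⁻¹ (fderiv ℝ (logGrad w) (θ₀, η) (EuclideanSpace.single j 1, 0)) i
  congr 1
  refine (mulV_apply_eq _ _ _ j (fun k => ?_) i).symm
  rw [jacobian, Matrix.of_apply, h1.fderiv]
  rfl

theorem limBη_apply {σ : ℝ} {S : Matrix (Fin n) (Fin n) ℝ} {w : Vec n → Vec p → ℝ} {θ₀ : Vec n}
    {η : Vec p} (h : DifferentiableAt ℝ (logGrad w) (θ₀, η)) (i : Fin n) (j : Fin p) :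
    limBη σ S w θ₀ η i j = shiftDeriv σ S w θ₀ η (0, EuclideanSpace.single j 1) i := by
  have h1 : HasFDerivAt (fun η' => logGrad w (θ₀, η')) _ η :=
    HasFDerivAt.comp η (g := logGrad w) h.hasFDerivAt (hasFDerivAt_prodMk_right θ₀ η)
  change σ ^ 2 * (S⁻¹ * jacobian (fun η' => logGrad w (θ₀, η')) η) i j =
    σ ^ 2 * mulV S⁻¹ (fderiv ℝ (logGrad w) (θ₀, η) (0, EuclideanSpace.single j 1)) i
  congr 1
  refine (mulV_apply_eq _ _ _ j (fun k => ?_) i).symm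
  rw [jacobian, Matrix.of_apply, h1.fderiv]
  rfl

theorem tendsto_jacobian_fst {u : ℕ → ℝ} {σ : ℝ} {S : Matrix (Fin n) (Fin n) ℝ}
    {w : Vec n → Vec p → ℝ} {θ₀ : Vec n} {η : Vec p} {a : Vec n}
    (hlog : DifferentiableAt ℝ (logGrad w) (θ₀, η))
    (h : UnifStrictDiff (scaledShift u σ w) (θ₀, η) a (shiftDeriv σ S w θ₀ η))
    (hd : ∀ᶠ N : ℕ in atTop, DifferentiableAt ℝ (fun x => ebOfMLE u σ w N x η) θ₀) :
    Tendsto (fun N : ℕ => (N : ℝ) • (jacobian (fun x => ebOfMLE u σ w N x η) θ₀ - 1)) atTop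
      (𝓝 (limBθ σ S w θ₀ η)) := by
  have h1 := h.comp_affine (g := fun x : Vec n => (x, η)) (t₀ := θ₀)
    (A := ContinuousLinearMap.inl ℝ (Vec n) (Vec p)) rfl (fun s t => by simp)
  have hder : ∀ᶠ N : ℕ in atTop, HasFDerivAt (fun x => scaledShift u σ w N (x, η))
      ((N : ℝ) • (fderiv ℝ (fun x => ebOfMLE u σ w N x η) θ₀ -
        ContinuousLinearMap.id ℝ (Vec n))) θ₀ := by
    filter_upwards [hd] with N hd
    exact (hd.hasFDerivAt.sub (hasFDerivAt_id θ₀)).const_smul (N : ℝ)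
  have h2 := h1.tendsto_fderiv (hder.mono fun N h => h.differentiableAt)
  refine tendsto_pi_nhds.2 fun i => tendsto_pi_nhds.2 fun j => ?_
  rw [limBθ_apply hlog]
  have h3 : Continuous fun L : Vec n →L[ℝ] Vec n => L (EuclideanSpace.single j 1) i := by fun_prop
  refine ((h3.tendsto _).comp h2).congr' ?_
  filter_upwards [hder] with N hder
  simp only [Function.comp_apply]
  rw [hder.fderiv]
  simp [jacobian, Matrix.one_apply]

theorem tendsto_jacobian_snd {u : ℕ → ℝ} {σ : ℝ} {S : Matrix (Fin n) (Fin n) ℝ}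
    {w : Vec n → Vec p → ℝ} {θ₀ : Vec n} {η : Vec p} {a : Vec n}
    (hlog : DifferentiableAt ℝ (logGrad w) (θ₀, η))
    (h : UnifStrictDiff (scaledShift u σ w) (θ₀, η) a (shiftDeriv σ S w θ₀ η))
    (hd : ∀ᶠ N : ℕ in atTop, DifferentiableAt ℝ (fun η' => ebOfMLE u σ w N θ₀ η') η) :
    Tendsto (fun N : ℕ => (N : ℝ) • jacobian (fun η' => ebOfMLE u σ w N θ₀ η') η) atTop
      (𝓝 (limBη σ S w θ₀ η)) := by
  have h1 := h.comp_affine (g := fun y : Vec p => (θ₀, y)) (t₀ := η)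
    (A := ContinuousLinearMap.inr ℝ (Vec n) (Vec p)) rfl (fun s t => by simp)
  have hder : ∀ᶠ N : ℕ in atTop, HasFDerivAt (fun y => scaledShift u σ w N (θ₀, y))
      ((N : ℝ) • fderiv ℝ (fun η' => ebOfMLE u σ w N θ₀ η') η) η := by
    filter_upwards [hd] with N hd
    exact (hd.hasFDerivAt.sub_const θ₀).const_smul (N : ℝ)
  have h2 := h1.tendsto_fderiv (hder.mono fun N h => h.differentiableAt)
  refine tendsto_pi_nhds.2 fun i => tendsto_pi_nhds.2 fun j => ?_
  rw [limBη_apply hlog]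
  have h3 : Continuous fun L : Vec p →L[ℝ] Vec n => L (EuclideanSpace.single j 1) i := by fun_prop
  refine ((h3.tendsto _).comp h2).congr' ?_
  filter_upwards [hder] with N hder
  simp only [Function.comp_apply]
  rw [hder.fderiv]
  simp [jacobian]

end Deterministic

/-! ### Limits of moments for a root-`N` consistent sequence -/

section Prob

variable {Ω : Type*} [MeasurableSpace Ω] {μ : Measure Ω} [IsProbabilityMeasure μ]
  {E F G : Type*} [NormedAddCommGroup E] [NormedSpace ℝ E] [NormedAddCommGroup F]
  [NormedSpace ℝ F] [NormedAddCommGroup G] [NormedSpace ℝ G]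

/-- All moments of `√N ξ_N` are bounded. -/
structure RootConsistent (μ : Measure Ω) (ξ : ℕ → Ω → E) : Prop where
  meas : ∀ᶠ N in atTop, AEStronglyMeasurable (ξ N) μ
  moment : ∀ q : ℕ, ∃ C : ℝ, 0 ≤ C ∧ ∀ᶠ N : ℕ in atTop,
    eLpNorm (ξ N) q μ ≤ ENNReal.ofReal (C / √N)

/-- The second moments of `Y N` on the events `δ ≤ ‖ξ N‖` decay faster than any power of `N`. -/
structure TailNegligible (μ : Measure Ω) (ξ : ℕ → Ω → E) (Y : ℕ → Ω → F) : Prop where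
  memLp : ∀ᶠ N in atTop, MemLp (Y N) 2 μ
  tendsto : ∀ δ > 0, ∀ k : ℕ, Tendsto (fun N : ℕ => (N : ENNReal) ^ k *
    eLpNorm (Y N) 2 (μ.restrict {ω | δ ≤ ‖ξ N ω‖})) atTop (𝓝 0)

namespace RootConsistent

variable {ξ : ℕ → Ω → E}

/-- Markov's inequality with the moment of order `2 * (m + 1)` gives probability `O(N^(-(m + 1)))`.
The order is even so that the powers of `√N` become integral powers of `N`. -/
theorem tendsto_pow_mul_measure (h : RootConsistent μ ξ) {δ : ℝ} (hδ : 0 < δ) (m : ℕ) :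
    Tendsto (fun N : ℕ => (N : ENNReal) ^ m * μ {ω | δ ≤ ‖ξ N ω‖}) atTop (𝓝 0) := by
  obtain ⟨C, hC, hmom⟩ := h.moment (2 * (m + 1))
  set q := 2 * (m + 1) with hq
  set K : ℝ := δ⁻¹ ^ q * C ^ q with hK
  have hlim : Tendsto (fun N : ℕ => ENNReal.ofReal (K * (1 / (N : ℝ)))) atTop (𝓝 0) := by
    have h1 := (tendsto_one_div_atTop_nhds_zero_nat (𝕜 := ℝ)).const_mul K
    rw [mul_zero] at h1
    simpa using ENNReal.tendsto_ofReal h1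
  refine tendsto_of_tendsto_of_tendsto_of_le_of_le' tendsto_const_nhds hlim
    (Eventually.of_forall fun _ => zero_le) ?_
  filter_upwards [hmom, h.meas, eventually_gt_atTop 0] with N hmom hmeas hN
  have hN' : (0 : ℝ) < N := by exact_mod_cast hN
  have hset : {ω | δ ≤ ‖ξ N ω‖} ⊆ {ω | ENNReal.ofReal δ ≤ ‖ξ N ω‖ₑ} := fun ω hω => by
    change ENNReal.ofReal δ ≤ ‖ξ N ω‖ₑ
    rw [← ofReal_norm]
    exact ENNReal.ofReal_le_ofReal hω
  have h1 := meas_ge_le_mul_pow_eLpNorm_enorm μ (p := (q : ENNReal)) (by simp [hq]) (by simp)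
    hmeas (ε := ENNReal.ofReal δ) (by simpa using hδ) (by simp)
  rw [ENNReal.toReal_natCast, ENNReal.rpow_natCast, ENNReal.rpow_natCast] at h1
  calc (N : ENNReal) ^ m * μ {ω | δ ≤ ‖ξ N ω‖}
      ≤ (N : ENNReal) ^ m * ((ENNReal.ofReal δ)⁻¹ ^ q * ENNReal.ofReal (C / √N) ^ q) := by
        gcongr
        exact (measure_mono hset).trans (h1.trans (by gcongr))
    _ = ENNReal.ofReal ((N : ℝ) ^ m * (δ⁻¹ ^ q * (C / √N) ^ q)) := by
        rw [← ENNReal.ofReal_inv_of_pos hδ, ← ENNReal.ofReal_pow (by positivity),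
          ← ENNReal.ofReal_pow (by positivity), ← ENNReal.ofReal_natCast,
          ← ENNReal.ofReal_pow (by positivity), ← ENNReal.ofReal_mul (by positivity),
          ← ENNReal.ofReal_mul (by positivity)]
    _ = ENNReal.ofReal (K * (1 / (N : ℝ))) := by
        congr 1
        have h2 : √(N : ℝ) ^ q = N ^ (m + 1) := by
          rw [hq, pow_mul, Real.sq_sqrt hN'.le]
        rw [div_pow, h2, hK]
        field_simp
        ring

/-- By Hölder's inequality, the `L²` norm on the event is at most the `Lʳ` norm times its
probability to the power `1/2 - 1/r`. This exponent is positive because `r > 2`, and the probability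
decays faster than any power of `N`. -/
theorem tailNegligible (h : RootConsistent μ ξ) {Y : ℕ → Ω → F} {r : ENNReal} (hr : 2 < r)
    {C : NNReal} (hm : ∀ᶠ N in atTop, AEStronglyMeasurable (Y N) μ)
    (hY : ∀ᶠ N in atTop, eLpNorm (Y N) r μ ≤ C) : TailNegligible μ ξ Y := by
  refine ⟨?_, fun δ hδ k => ?_⟩
  · filter_upwards [hm, hY] with N hm hY
    exact MemLp.mono_exponent ⟨hm, hY.trans_lt ENNReal.coe_lt_top⟩ hr.le
  set s : ℝ := 1 / (2 : ENNReal).toReal - 1 / r.toReal with hs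
  have hs0 : 0 < s := by
    rcases eq_or_ne r ⊤ with rfl | hr'
    · simp [hs]
    · have h1 : 2 < r.toReal := by
        have := (ENNReal.toReal_lt_toReal (by simp) hr').2 hr
        simpa using this
      have h2 : 1 / r.toReal < 1 / 2 := one_div_lt_one_div_of_lt (by norm_num) h1
      simp only [hs, ENNReal.toReal_ofNat]
      linarith
  -- With `m * s > k` the factor `N ^ k` can be moved inside the power `s`.
  obtain ⟨m, hms⟩ := exists_nat_gt (k / s)
  have hlim : Tendsto (fun N : ℕ => (C : ENNReal) *
      ((N : ENNReal) ^ m * μ {ω | δ ≤ ‖ξ N ω‖}) ^ s) atTop (𝓝 0) := by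
    have h1 := (h.tendsto_pow_mul_measure hδ m).ennrpow_const s
    rw [ENNReal.zero_rpow_of_pos hs0] at h1
    simpa using ENNReal.Tendsto.const_mul (a := (C : ENNReal)) h1 (Or.inr ENNReal.coe_ne_top)
  refine tendsto_of_tendsto_of_tendsto_of_le_of_le' tendsto_const_nhds hlim
    (Eventually.of_forall fun _ => zero_le) ?_
  filter_upwards [hm, hY, eventually_ge_atTop 1] with N hm hY hN
  have h1 := eLpNorm_le_eLpNorm_mul_rpow_measure_univ (μ := μ.restrict {ω | δ ≤ ‖ξ N ω‖}) hr.le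
    hm.restrict
  rw [Measure.restrict_apply_univ, ← hs] at h1
  have h2 : (N : ENNReal) ^ k ≤ ((N : ENNReal) ^ m) ^ s := by
    rw [← ENNReal.rpow_natCast, ← ENNReal.rpow_natCast, ← ENNReal.rpow_mul]
    refine ENNReal.rpow_le_rpow_of_exponent_le (by exact_mod_cast hN) ?_
    rw [div_lt_iff₀ hs0] at hms
    exact hms.le
  calc (N : ENNReal) ^ k * eLpNorm (Y N) 2 (μ.restrict {ω | δ ≤ ‖ξ N ω‖})
      ≤ ((N : ENNReal) ^ m) ^ s * (C * μ {ω | δ ≤ ‖ξ N ω‖} ^ s) := by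
        gcongr
        refine h1.trans ?_
        gcongr
        exact (eLpNorm_restrict_le _ _ _ _).trans hY
    _ = _ := by
        rw [ENNReal.mul_rpow_of_nonneg _ _ hs0.le]
        ring

theorem tailNegligible_self (h : RootConsistent μ ξ) : TailNegligible μ ξ ξ := by
  obtain ⟨C, hC, hmom⟩ := h.moment 3
  refine h.tailNegligible (r := 3) (by norm_num) (C := C.toNNReal) h.meas ?_
  filter_upwards [hmom, eventually_ge_atTop 1] with N hN hN1
  refine hN.trans ?_
  change ENNReal.ofReal (C / √N) ≤ ENNReal.ofReal C
  refine ENNReal.ofReal_le_ofReal (div_le_self hC ?_)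
  rw [Real.one_le_sqrt]
  exact_mod_cast hN1

theorem tailNegligible_const (h : RootConsistent μ ξ) {c : ℕ → F} {C : ℝ}
    (hc : ∀ᶠ N in atTop, ‖c N‖ ≤ C) : TailNegligible μ ξ (fun N _ => c N) := by
  refine h.tailNegligible (r := 3) (by norm_num) (C := C.toNNReal)
    (Eventually.of_forall fun N => aestronglyMeasurable_const) ?_
  filter_upwards [hc] with N hN
  rw [eLpNorm_const' (c N) (by norm_num) (by norm_num)]
  simp only [measure_univ, ENNReal.one_rpow, mul_one]
  rw [← ofReal_norm]
  exact ENNReal.ofReal_le_ofReal hN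

end RootConsistent

theorem integral_norm_sq_eq {ν : Measure Ω} {Y : Ω → F} (h : MemLp Y 2 ν) :
    ∫ ω, ‖Y ω‖ ^ 2 ∂ν = (eLpNorm Y 2 ν).toReal ^ 2 := by
  have h1 := h.eLpNorm_eq_integral_rpow_norm (by norm_num) (by norm_num)
  have h0 : 0 ≤ ∫ ω, ‖Y ω‖ ^ 2 ∂ν := integral_nonneg fun ω => by positivity
  rw [h1, ENNReal.toReal_ofReal (by positivity)]
  simp only [ENNReal.toReal_ofNat, Real.rpow_ofNat]
  rw [← Real.rpow_natCast, ← Real.rpow_mul h0]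
  norm_num

namespace TailNegligible

variable {ξ : ℕ → Ω → E} {Y Z : ℕ → Ω → F}

theorem tendsto_integral (h : TailNegligible μ ξ Y) {δ : ℝ} (hδ : 0 < δ) :
    Tendsto (fun N : ℕ => ∫ ω in {ω | δ ≤ ‖ξ N ω‖}, ‖Y N ω‖ ^ 2 ∂μ) atTop (𝓝 0) := by
  have h1 := h.tendsto δ hδ 0
  simp only [pow_zero, one_mul] at h1
  have h2 := ((ENNReal.tendsto_toReal ENNReal.zero_ne_top).comp h1).pow 2
  simp only [ENNReal.toReal_zero, ne_eq, OfNat.ofNat_ne_zero, not_false_eq_true, zero_pow] at h2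
  refine h2.congr' ?_
  filter_upwards [h.memLp] with N hN
  exact (integral_norm_sq_eq (hN.restrict _)).symm

theorem add (hY : TailNegligible μ ξ Y) (hZ : TailNegligible μ ξ Z) :
    TailNegligible μ ξ (fun N ω => Y N ω + Z N ω) := by
  refine ⟨?_, fun δ hδ k => ?_⟩
  · filter_upwards [hY.memLp, hZ.memLp] with N h1 h2 using h1.add h2
  have h1 := (hY.tendsto δ hδ k).add (hZ.tendsto δ hδ k)
  rw [add_zero] at h1
  refine tendsto_of_tendsto_of_tendsto_of_le_of_le' tendsto_const_nhds h1
    (Eventually.of_forall fun _ => zero_le) ?_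
  filter_upwards [hY.memLp, hZ.memLp] with N h2 h3
  rw [← mul_add]
  gcongr
  exact eLpNorm_add_le h2.aestronglyMeasurable.restrict h3.aestronglyMeasurable.restrict
    (by norm_num)

theorem neg (hY : TailNegligible μ ξ Y) : TailNegligible μ ξ (fun N ω => -Y N ω) := by
  refine ⟨hY.memLp.mono fun N h => h.neg, fun δ hδ k => ?_⟩
  refine (hY.tendsto δ hδ k).congr fun N => ?_
  congr 1
  exact (eLpNorm_neg _ _ _).symm

theorem sub (hY : TailNegligible μ ξ Y) (hZ : TailNegligible μ ξ Z) :
    TailNegligible μ ξ (fun N ω => Y N ω - Z N ω) := by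
  simpa only [sub_eq_add_neg] using hY.add hZ.neg

theorem nat_smul (hY : TailNegligible μ ξ Y) :
    TailNegligible μ ξ (fun N ω => (N : ℝ) • Y N ω) := by
  refine ⟨hY.memLp.mono fun N h => h.const_smul (N : ℝ), fun δ hδ k => ?_⟩
  refine (hY.tendsto δ hδ (k + 1)).congr fun N => ?_
  have h1 : eLpNorm (fun ω => (N : ℝ) • Y N ω) 2 (μ.restrict {ω | δ ≤ ‖ξ N ω‖}) =
      N * eLpNorm (Y N) 2 (μ.restrict {ω | δ ≤ ‖ξ N ω‖}) := by
    have h2 := eLpNorm_const_smul (N : ℝ) (Y N) 2 (μ.restrict {ω | δ ≤ ‖ξ N ω‖})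
    have h3 : ‖(N : ℝ)‖ₑ = N := by
      rw [← ofReal_norm, Real.norm_of_nonneg (Nat.cast_nonneg N), ENNReal.ofReal_natCast]
    rw [h3] at h2
    exact h2
  rw [h1]
  ring

theorem clm (hY : TailNegligible μ ξ Y) (L : F →L[ℝ] G) :
    TailNegligible μ ξ (fun N ω => L (Y N ω)) := by
  refine ⟨hY.memLp.mono fun N h => L.comp_memLp' h, fun δ hδ k => ?_⟩
  have h1 := ENNReal.Tendsto.const_mul (a := ENNReal.ofReal ‖L‖) (hY.tendsto δ hδ k)
    (Or.inr ENNReal.ofReal_ne_top)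
  rw [mul_zero] at h1
  refine tendsto_of_tendsto_of_tendsto_of_le_of_le tendsto_const_nhds h1 (fun _ => zero_le) ?_
  intro N
  simp only
  rw [mul_left_comm]
  gcongr
  exact eLpNorm_le_mul_eLpNorm_of_ae_le_mul (ae_of_all _ fun ω => L.le_opNorm _) 2

/-- A product tends to zero in `L¹` if it is small where `ξ` is small. -/
theorem tendsto_integral_mul (hξ : RootConsistent μ ξ) {U : ℕ → Ω → F} {V : ℕ → Ω → G}
    (hU : TailNegligible μ ξ U) (hV : TailNegligible μ ξ V) {g : ℕ → Ω → ℝ} {C : ℝ} (hC : 0 ≤ C)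
    (hg0 : ∀ N ω, 0 ≤ g N ω) (hg : ∀ᶠ N in atTop, Integrable (g N) μ ∧ ∫ ω, g N ω ∂μ ≤ C)
    (hloc : ∀ ε > 0, ∃ δ > 0, ∀ᶠ N in atTop, ∀ᵐ ω ∂μ, ‖ξ N ω‖ < δ →
      ‖U N ω‖ * ‖V N ω‖ ≤ ε * g N ω) :
    Tendsto (fun N => ∫ ω, ‖U N ω‖ * ‖V N ω‖ ∂μ) atTop (𝓝 0) := by
  refine Metric.tendsto_nhds.2 fun ε hε => ?_
  obtain ⟨δ, hδ, hl⟩ := hloc (ε / (2 * (C + 1))) (by positivity)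
  have hlim := (hU.tendsto_integral hδ).add (hV.tendsto_integral hδ)
  rw [add_zero] at hlim
  filter_upwards [hl, hg, hU.memLp, hV.memLp, hlim.eventually_lt_const (half_pos hε), hξ.meas]
    with N hl hg hU hV hlim hξ
  set B := {ω | δ ≤ ‖ξ N ω‖} with hB
  have hBm : NullMeasurableSet B μ := nullMeasurableSet_le aemeasurable_const hξ.norm.aemeasurable
  have hint : Integrable (fun ω => ‖U N ω‖ * ‖V N ω‖) μ := hU.norm.integrable_mul hV.norm
  have hU2 : Integrable (fun ω => ‖U N ω‖ ^ 2) μ := hU.integrable_norm_pow two_ne_zero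
  have hV2 : Integrable (fun ω => ‖V N ω‖ ^ 2) μ := hV.integrable_norm_pow two_ne_zero
  have h0 : 0 ≤ ∫ ω, ‖U N ω‖ * ‖V N ω‖ ∂μ := integral_nonneg fun ω => by positivity
  rw [dist_zero_right, Real.norm_of_nonneg h0, ← integral_add_compl₀ hBm hint]
  -- On the tail event the product is bounded by the sum of the squares, whose integrals there tend
  -- to zero.
  have h1 : ∫ ω in B, ‖U N ω‖ * ‖V N ω‖ ∂μ < ε / 2 := by
    refine lt_of_le_of_lt ?_ hlim
    rw [← integral_add hU2.integrableOn hV2.integrableOn]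
    refine integral_mono hint.integrableOn (hU2.integrableOn.add hV2.integrableOn) fun ω => ?_
    simp only
    nlinarith [sq_nonneg (‖U N ω‖ - ‖V N ω‖), sq_nonneg ‖U N ω‖, sq_nonneg ‖V N ω‖]
  have h2 : ∫ ω in Bᶜ, ‖U N ω‖ * ‖V N ω‖ ∂μ ≤ ε / 2 := by
    calc ∫ ω in Bᶜ, ‖U N ω‖ * ‖V N ω‖ ∂μ
        ≤ ∫ ω in Bᶜ, ε / (2 * (C + 1)) * g N ω ∂μ := by
          refine integral_mono_ae hint.integrableOn (hg.1.const_mul _).integrableOn ?_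
          rw [EventuallyLE, ae_restrict_iff'₀ hBm.compl]
          filter_upwards [hl] with ω hω hωB
          exact hω (not_le.1 hωB)
      _ ≤ ∫ ω, ε / (2 * (C + 1)) * g N ω ∂μ :=
          setIntegral_le_integral (hg.1.const_mul _)
            (ae_of_all _ fun ω => mul_nonneg (by positivity) (hg0 N ω))
      _ ≤ ε / (2 * (C + 1)) * C := by
          rw [integral_const_mul]
          gcongr
          exact hg.2
      _ ≤ ε / 2 := by
          rw [div_mul_eq_mul_div, div_le_div_iff₀ (by positivity) (by norm_num)]
          nlinarith
  linarith

end TailNegligible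

end Prob

/-! ### Means, second moments and covariances of locally convergent sequences. -/

section Moments

variable {Ω : Type*} [MeasurableSpace Ω] {μ : Measure Ω} [IsProbabilityMeasure μ] {n : ℕ}
  {ξ Y : ℕ → Ω → Vec n} {b : Vec n}

theorem RootConsistent.exists_integral_sq_le (h : RootConsistent μ ξ) : ∃ C, 0 ≤ C ∧
    ∀ᶠ N : ℕ in atTop, Integrable (fun ω => N * ‖ξ N ω‖ ^ 2) μ ∧
      ∫ ω, N * ‖ξ N ω‖ ^ 2 ∂μ ≤ C := by
  obtain ⟨C, hC, hmom⟩ := h.moment 2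
  refine ⟨C ^ 2, by positivity, ?_⟩
  filter_upwards [hmom, h.tailNegligible_self.memLp, eventually_gt_atTop 0] with N hmom hm hN
  have hN' : (0 : ℝ) < N := by exact_mod_cast hN
  refine ⟨(hm.integrable_norm_pow two_ne_zero).const_mul _, ?_⟩
  rw [integral_const_mul, integral_norm_sq_eq hm]
  have h1 : (eLpNorm (ξ N) 2 μ).toReal ≤ C / √N :=
    ENNReal.toReal_le_of_le_ofReal (by positivity) hmom
  calc (N : ℝ) * (eLpNorm (ξ N) 2 μ).toReal ^ 2 ≤ N * (C / √N) ^ 2 := by gcongr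
    _ = C ^ 2 := by
        rw [div_pow, Real.sq_sqrt hN'.le]
        field_simp

/-- Convergence in probability to the constant `b`, on the events where `ξ` is small. -/
def LocallyTendsto (μ : Measure Ω) (ξ Y : ℕ → Ω → Vec n) (b : Vec n) : Prop :=
  ∀ ε > 0, ∃ δ > 0, ∀ᶠ N in atTop, ∀ᵐ ω ∂μ, ‖ξ N ω‖ < δ → ‖Y N ω - b‖ ≤ ε

theorem LocallyTendsto.tendsto_integral_sq (hξ : RootConsistent μ ξ) (hY : TailNegligible μ ξ Y)
    (h : LocallyTendsto μ ξ Y b) :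
    Tendsto (fun N => ∫ ω, ‖Y N ω - b‖ ^ 2 ∂μ) atTop (𝓝 0) := by
  have hU : TailNegligible μ ξ (fun N ω => Y N ω - b) :=
    hY.sub (hξ.tailNegligible_const (C := ‖b‖) (Eventually.of_forall fun _ => le_rfl))
  have h1 := TailNegligible.tendsto_integral_mul hξ hU hU (g := fun _ _ => 1) zero_le_one
    (fun _ _ => zero_le_one) (Eventually.of_forall fun _ => ⟨integrable_const 1, by simp⟩)
    (fun ε hε => by
      -- Capping at `1` makes the square of the bound at most `ε`.
      obtain ⟨δ, hδ, hl⟩ := h (min ε 1) (by positivity)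
      refine ⟨δ, hδ, hl.mono fun N hl => hl.mono fun ω hω hω' => ?_⟩
      have h2 := hω hω'
      have h3 := h2.trans (min_le_left _ _)
      have h4 := h2.trans (min_le_right _ _)
      rw [mul_one]
      calc ‖Y N ω - b‖ * ‖Y N ω - b‖ ≤ ε * 1 := by gcongr
        _ = ε := mul_one ε)
  simpa only [← sq] using h1

theorem LocallyTendsto.tendsto_integral (hξ : RootConsistent μ ξ) (hY : TailNegligible μ ξ Y)
    (h : LocallyTendsto μ ξ Y b) : Tendsto (fun N => ∫ ω, Y N ω ∂μ) atTop (𝓝 b) := by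
  have hc : TailNegligible μ ξ (fun _ _ => b) :=
    hξ.tailNegligible_const (C := ‖b‖) (Eventually.of_forall fun _ => le_rfl)
  have hU : TailNegligible μ ξ (fun N ω => Y N ω - b) := hY.sub hc
  have hV : TailNegligible μ ξ (fun _ _ => (1 : ℝ)) :=
    hξ.tailNegligible_const (C := 1) (Eventually.of_forall fun _ => by simp)
  have h1 := TailNegligible.tendsto_integral_mul hξ hU hV (g := fun _ _ => 1) zero_le_one
    (fun _ _ => zero_le_one) (Eventually.of_forall fun _ => ⟨integrable_const 1, by simp⟩)
    (fun ε hε => by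
      obtain ⟨δ, hδ, hl⟩ := h ε hε
      refine ⟨δ, hδ, hl.mono fun N hl => hl.mono fun ω hω hω' => ?_⟩
      simpa using hω hω')
  simp only [norm_one, mul_one] at h1
  rw [tendsto_iff_norm_sub_tendsto_zero]
  refine squeeze_zero' (Eventually.of_forall fun _ => norm_nonneg _) ?_ h1
  filter_upwards [hY.memLp] with N hN
  have h2 : (∫ ω, Y N ω ∂μ) - b = ∫ ω, (Y N ω - b) ∂μ := by
    rw [integral_sub (hN.integrable (by norm_num)) (integrable_const b)]
    simp
  rw [h2]
  exact norm_integral_le_integral_norm _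

/-- From `‖Y‖² = ‖Y - b‖² + 2⟨b, Y⟩ - ‖b‖²`, combined with `L²` convergence and convergence of the
mean. -/
theorem LocallyTendsto.tendsto_integral_norm_sq (hξ : RootConsistent μ ξ)
    (hY : TailNegligible μ ξ Y) (h : LocallyTendsto μ ξ Y b) :
    Tendsto (fun N => ∫ ω, ‖Y N ω‖ ^ 2 ∂μ) atTop (𝓝 (‖b‖ ^ 2)) := by
  have h1 := h.tendsto_integral_sq hξ hY
  have h2 : Tendsto (fun N => inner ℝ b (∫ ω, Y N ω ∂μ)) atTop (𝓝 (inner ℝ b b)) :=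
    Tendsto.inner tendsto_const_nhds (h.tendsto_integral hξ hY)
  have h3 := (h1.add (h2.const_mul 2)).sub_const (‖b‖ ^ 2)
  rw [real_inner_self_eq_norm_sq] at h3
  have h4 : 0 + 2 * ‖b‖ ^ 2 - ‖b‖ ^ 2 = ‖b‖ ^ 2 := by ring
  rw [h4] at h3
  refine h3.congr' ?_
  filter_upwards [hY.memLp] with N hN
  have hi := hN.integrable (by norm_num : (1 : ENNReal) ≤ 2)
  have hi2 : Integrable (fun ω => ‖Y N ω‖ ^ 2) μ := hN.integrable_norm_pow two_ne_zero
  have hi3 : Integrable (fun ω => inner ℝ b (Y N ω)) μ := hi.const_inner b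
  have e : ∀ ω, ‖Y N ω - b‖ ^ 2 = ‖Y N ω‖ ^ 2 - 2 * inner ℝ b (Y N ω) + ‖b‖ ^ 2 := fun ω => by
    rw [norm_sub_sq_real, real_inner_comm]
  have hi4 : Integrable (fun ω => ‖Y N ω‖ ^ 2 - 2 * inner ℝ b (Y N ω)) μ :=
    hi2.sub (hi3.const_mul 2)
  simp only [e]
  rw [integral_add hi4 (integrable_const _), integral_sub hi2 (hi3.const_mul 2),
    integral_const_mul, integral_inner hi]
  simp only [integral_const, probReal_univ, one_smul]
  ring

theorem MeasureTheory.MemLp.coord {X : Ω → Vec n} (h : MemLp X 2 μ) (i : Fin n) :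
    MemLp (fun ω => X ω i) 2 μ :=
  (EuclideanSpace.proj i : Vec n →L[ℝ] ℝ).comp_memLp' h

/-- Covariances do not change when `b` is subtracted, and those of `Y - b` are controlled by `E‖Y -
b‖²` and the products of its means. -/
theorem LocallyTendsto.tendsto_crossCov (hξ : RootConsistent μ ξ) (hY : TailNegligible μ ξ Y)
    (h : LocallyTendsto μ ξ Y b) :
    Tendsto (fun N => crossCov μ (Y N) (Y N)) atTop (𝓝 0) := by
  refine tendsto_pi_nhds.2 fun i => tendsto_pi_nhds.2 fun j => ?_
  have h0 : ∀ i, Tendsto (fun N => (∫ ω, Y N ω ∂μ) i - b i) atTop (𝓝 0) := fun i => by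
    have h1 : Tendsto (fun N => (∫ ω, Y N ω ∂μ) i) atTop (𝓝 (b i)) :=
      ((EuclideanSpace.proj i : Vec n →L[ℝ] ℝ).continuous.tendsto b).comp
        (h.tendsto_integral hξ hY)
    simpa using h1.sub_const (b i)
  have hlim := (h.tendsto_integral_sq hξ hY).add ((h0 i).abs.mul (h0 j).abs)
  simp only [abs_zero, mul_zero, add_zero] at hlim
  refine squeeze_zero_norm' ?_ hlim
  filter_upwards [hY.memLp] with N hN
  have hi : ∀ i, MemLp (fun ω => Y N ω i - b i) 2 μ := fun i =>
    (MemLp.coord hN i).sub (memLp_const (b i))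
  have hint := hN.integrable (by norm_num : (1 : ENNReal) ≤ 2)
  have hii : ∀ i, Integrable (fun ω => Y N ω i) μ := fun i =>
    (MemLp.coord hN i).integrable (by norm_num)
  have he : ∀ i, ∫ ω, (Y N ω i - b i) ∂μ = (∫ ω, Y N ω ∂μ) i - b i := fun i => by
    rw [integral_sub (hii i) (integrable_const _)]
    have := (EuclideanSpace.proj i : Vec n →L[ℝ] ℝ).integral_comp_comm hint
    simp only [EuclideanSpace.coe_proj] at this
    rw [this]
    simp
  have h2 : crossCov μ (Y N) (Y N) i j =
      (∫ ω, (Y N ω i - b i) * (Y N ω j - b j) ∂μ) -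
        ((∫ ω, Y N ω ∂μ) i - b i) * ((∫ ω, Y N ω ∂μ) j - b j) := by
    rw [← he i, ← he j, crossCov, Matrix.of_apply,
      ← covariance_sub_const_left (hii i) (b i), ← covariance_sub_const_right (hii j) (b j),
      covariance_eq_sub (hi i) (hi j)]
    rfl
  have h3 : ‖∫ ω, (Y N ω i - b i) * (Y N ω j - b j) ∂μ‖ ≤ ∫ ω, ‖Y N ω - b‖ ^ 2 ∂μ := by
    refine norm_integral_le_of_norm_le
      ((hN.sub (memLp_const b)).integrable_norm_pow two_ne_zero) (ae_of_all _ fun ω => ?_)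
    rw [norm_mul, sq]
    gcongr
    · exact PiLp.norm_apply_le (Y N ω - b) i
    · exact PiLp.norm_apply_le (Y N ω - b) j
  rw [h2]
  refine (norm_sub_le _ _).trans (add_le_add h3 ?_)
  rw [norm_mul, Real.norm_eq_abs, Real.norm_eq_abs]

/-- If `Y` is, up to `o(ξ)`, an affine function of `ξ`, then the covariances of `Y` and `ξ` are
governed by the linear part. -/
theorem tendsto_integral_mul_coord (hξ : RootConsistent μ ξ) (hY : TailNegligible μ ξ Y)
    (h0 : ∀ᶠ N in atTop, ∫ ω, ξ N ω ∂μ = 0) {Q : Matrix (Fin n) (Fin n) ℝ}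
    (hQ : ∀ i j, Tendsto (fun N : ℕ => N * ∫ ω, ξ N ω i * ξ N ω j ∂μ) atTop (𝓝 (Q i j)))
    {c : ℕ → Vec n} {C : ℝ} (hc : ∀ᶠ N in atTop, ‖c N‖ ≤ C) (L : Vec n →L[ℝ] Vec n)
    (hloc : ∀ ε > 0, ∃ δ > 0, ∀ᶠ N in atTop, ∀ᵐ ω ∂μ, ‖ξ N ω‖ < δ →
      ‖Y N ω - c N - L (ξ N ω)‖ ≤ ε * ‖ξ N ω‖) (i j : Fin n) :
    Tendsto (fun N : ℕ => N * ∫ ω, Y N ω i * ξ N ω j ∂μ) atTop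
      (𝓝 (∑ k, L (EuclideanSpace.single k 1) i * Q k j)) := by
  obtain ⟨C', hC', hsq⟩ := hξ.exists_integral_sq_le
  have hξt := hξ.tailNegligible_self
  -- The remainder is paired with `N ξ`. Locally the product is at most `ε * (N * ‖ξ‖²)`, and the
  -- mean of `N * ‖ξ‖²` is bounded.
  have hU : TailNegligible μ ξ (fun N ω => Y N ω - c N - L (ξ N ω)) :=
    (hY.sub (hξ.tailNegligible_const hc)).sub (hξt.clm L)
  have h1 := TailNegligible.tendsto_integral_mul hξ hU hξt.nat_smul
    (g := fun N ω => N * ‖ξ N ω‖ ^ 2) hC' (fun N ω => by positivity) hsq (fun ε hε => by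
      obtain ⟨δ, hδ, hl⟩ := hloc ε hε
      refine ⟨δ, hδ, hl.mono fun N hl => hl.mono fun ω hω hω' => ?_⟩
      rw [norm_smul, Real.norm_of_nonneg (Nat.cast_nonneg N)]
      calc ‖Y N ω - c N - L (ξ N ω)‖ * (N * ‖ξ N ω‖) ≤ (ε * ‖ξ N ω‖) * (N * ‖ξ N ω‖) := by
            gcongr
            exact hω hω'
        _ = _ := by ring)
  have h2 : Tendsto (fun N : ℕ => ∑ k, L (EuclideanSpace.single k 1) i *
      (N * ∫ ω, ξ N ω k * ξ N ω j ∂μ)) atTop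
      (𝓝 (∑ k, L (EuclideanSpace.single k 1) i * Q k j)) :=
    tendsto_finsetSum _ fun k _ => (hQ k j).const_mul _
  refine h2.congr_dist (squeeze_zero' (Eventually.of_forall fun _ => dist_nonneg) ?_ h1)
  filter_upwards [hY.memLp, hξt.memLp, h0, hU.memLp] with N hYm hξm h0 hUm
  have hYi := MemLp.coord hYm i
  have hξi := fun k => MemLp.coord hξm k
  have hprod : Integrable (fun ω => Y N ω i * ξ N ω j) μ := hYi.integrable_mul (hξi j)
  have hprod2 : ∀ k, Integrable (fun ω => ξ N ω k * ξ N ω j) μ := fun k =>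
    (hξi k).integrable_mul (hξi j)
  have hLsum : ∀ ω, L (ξ N ω) i = ∑ k, L (EuclideanSpace.single k 1) i * ξ N ω k := fun ω => by
    conv_lhs => rw [← (EuclideanSpace.basisFun (Fin n) ℝ).sum_repr (ξ N ω)]
    simp [map_sum, mul_comm]
  -- Zero mean removes the constants `c N`, which therefore need only be bounded and not convergent.
  have hmean : ∫ ω, ξ N ω j ∂μ = 0 := by
    have := (EuclideanSpace.proj j : Vec n →L[ℝ] ℝ).integral_comp_comm
      (hξm.integrable (by norm_num))
    simp only [EuclideanSpace.coe_proj] at this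
    rw [this, h0]
    rfl
  have e : (N : ℝ) * (∫ ω, Y N ω i * ξ N ω j ∂μ) -
      ∑ k, L (EuclideanSpace.single k 1) i * (N * ∫ ω, ξ N ω k * ξ N ω j ∂μ) =
      ∫ ω, (Y N ω - c N - L (ξ N ω)) i * (N * ξ N ω j) ∂μ := by
    have e1 : ∀ ω, (Y N ω - c N - L (ξ N ω)) i * (N * ξ N ω j) =
        N * (Y N ω i * ξ N ω j) - N * c N i * ξ N ω j -
          ∑ k, L (EuclideanSpace.single k 1) i * (N * (ξ N ω k * ξ N ω j)) := fun ω => by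
      rw [PiLp.sub_apply, PiLp.sub_apply, hLsum, sub_mul, Finset.sum_mul]
      congr 1
      · ring
      · exact Finset.sum_congr rfl fun k _ => by ring
    simp only [e1]
    have i1 : Integrable (fun ω => N * (Y N ω i * ξ N ω j) - N * c N i * ξ N ω j) μ :=
      (hprod.const_mul _).sub (((hξi j).integrable (by norm_num)).const_mul _)
    have i2 : ∀ k, Integrable (fun ω =>
        L (EuclideanSpace.single k 1) i * (N * (ξ N ω k * ξ N ω j))) μ := fun k =>
      ((hprod2 k).const_mul _).const_mul _
    rw [integral_sub i1 (integrable_finsetSum _ fun k _ => i2 k),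
      integral_sub (hprod.const_mul _) (((hξi j).integrable (by norm_num)).const_mul _),
      integral_finsetSum _ fun k _ => i2 k]
    simp only [integral_const_mul, hmean, mul_zero, sub_zero]
  rw [dist_comm, Real.dist_eq, e, ← Real.norm_eq_abs]
  refine norm_integral_le_of_norm_le (hUm.norm.integrable_mul (hξm.const_smul (N : ℝ)).norm)
    (ae_of_all _ fun ω => ?_)
  rw [norm_mul]
  gcongr
  · exact PiLp.norm_apply_le (Y N ω - c N - L (ξ N ω)) i
  · exact PiLp.norm_apply_le ((N : ℝ) • ξ N ω) j

end Moments

/-! ### The law of the maximum likelihood estimator -/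

section Law

variable {Ω : Type*} [MeasurableSpace Ω] {μ : Measure Ω} [IsProbabilityMeasure μ] {n : ℕ}

/-- A centred Gaussian variable has the law of its standard deviation times a standard normal one,
so one constant for each `q` serves every variance. -/
theorem eLpNorm_of_hasGaussianLaw {X : Ω → ℝ} (hX : HasGaussianLaw X μ) (h0 : ∫ ω, X ω ∂μ = 0)
    (q : ENNReal) : eLpNorm X q μ =
      ENNReal.ofReal √(Var[X; μ]) * eLpNorm (id : ℝ → ℝ) q (gaussianReal 0 1) := by
  have h1 : μ.map X = (gaussianReal 0 1).map (fun x => √(Var[X; μ]) * x) := by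
    rw [hX.map_eq_gaussianReal, h0, gaussianReal_map_const_mul, mul_zero, mul_one]
    congr 1
    ext
    simp [Real.sq_sqrt (variance_nonneg X μ), variance_nonneg X μ]
  have h2 : eLpNorm X q μ = eLpNorm id q (μ.map X) := by
    rw [eLpNorm_map_measure aestronglyMeasurable_id hX.aemeasurable]
    rfl
  rw [h2, h1, eLpNorm_map_measure aestronglyMeasurable_id (by fun_prop)]
  have h3 := eLpNorm_const_smul √(Var[X; μ]) (id : ℝ → ℝ) q (gaussianReal 0 1)
  rw [← ofReal_norm, Real.norm_of_nonneg (Real.sqrt_nonneg _)] at h3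
  exact h3

variable {u : ℕ → ℝ} {σ : ℝ} {e : ℕ → Ω → ℝ} {θ₀ : Vec n} {S : Matrix (Fin n) (Fin n) ℝ}

/-- The matrix of the least squares estimator. -/
noncomputable def lsMatrix (u : ℕ → ℝ) (n N : ℕ) : Matrix (Fin n) (Fin N) ℝ :=
  (gram u n N)⁻¹ * (regressor u n N)ᵀ

theorem lsMatrix_mul_transpose {N : ℕ} (h : IsUnit (gram u n N).det) :
    lsMatrix u n N * (lsMatrix u n N)ᵀ = (gram u n N)⁻¹ := by
  have hs : (gram u n N)ᵀ = gram u n N := by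
    rw [gram, Matrix.transpose_mul, Matrix.transpose_transpose]
  rw [lsMatrix, Matrix.transpose_mul, Matrix.transpose_transpose, Matrix.transpose_nonsing_inv, hs,
    Matrix.mul_assoc, ← Matrix.mul_assoc (regressor u n N)ᵀ]
  change (gram u n N)⁻¹ * (gram u n N * (gram u n N)⁻¹) = _
  rw [Matrix.mul_nonsing_inv _ h, Matrix.mul_one]

theorem mlRV_sub_apply {N : ℕ} (h : IsUnit (gram u n N).det) (ω : Ω) (i : Fin n) :
    (mlRV u e θ₀ N ω - θ₀) i = ∑ t : Fin N, lsMatrix u n N i t * e t ω := by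
  have h1 : mlRV u e θ₀ N ω =
      θ₀ + mulV (lsMatrix u n N) (WithLp.toLp 2 fun t : Fin N => e t ω) := by
    have h2 : mulV (lsMatrix u n N) (mulV (regressor u n N) θ₀) = θ₀ := mle_regressor u h θ₀
    rw [mlRV, mle, output]
    change mulV (lsMatrix u n N) _ = _
    conv_rhs => rw [← h2]
    simp [mulV, Matrix.mulVec_add]
  rw [h1, add_sub_cancel_left]
  simp [mulV, Matrix.mulVec, dotProduct]

theorem noise_hasGaussianLaw
    (he_law : ∀ t, HasLaw (e t) (gaussianReal 0 (Real.toNNReal (σ ^ 2))) μ) (t : ℕ) :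
    HasGaussianLaw (e t) μ :=
  (he_law t).hasGaussianLaw

theorem noise_mean
    (he_law : ∀ t, HasLaw (e t) (gaussianReal 0 (Real.toNNReal (σ ^ 2))) μ) (t : ℕ) :
    ∫ ω, e t ω ∂μ = 0 := by
  rw [(he_law t).integral_eq, integral_id_gaussianReal]

theorem noise_cov (he_indep : iIndepFun e μ)
    (he_law : ∀ t, HasLaw (e t) (gaussianReal 0 (Real.toNNReal (σ ^ 2))) μ) (s t : ℕ) :
    cov[e s, e t; μ] = if s = t then σ ^ 2 else 0 := by
  split_ifs with h
  · subst h
    rw [covariance_self (he_law s).aemeasurable, (he_law s).variance_eq, variance_id_gaussianReal,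
      Real.coe_toNNReal _ (sq_nonneg σ)]
  · exact (he_indep.indepFun h).covariance_eq_zero (noise_hasGaussianLaw he_law s).memLp_two
      (noise_hasGaussianLaw he_law t).memLp_two

theorem mlRV_sub_hasGaussianLaw (he_indep : iIndepFun e μ)
    (he_law : ∀ t, HasLaw (e t) (gaussianReal 0 (Real.toNNReal (σ ^ 2))) μ) {N : ℕ}
    (h : IsUnit (gram u n N).det) (i : Fin n) :
    HasGaussianLaw (fun ω => (mlRV u e θ₀ N ω - θ₀) i) μ := by
  simp only [mlRV_sub_apply h]
  refine iIndepFun.hasGaussianLaw_fun_sum (X := fun (t : Fin N) ω => lsMatrix u n N i t * e t ω)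
    (fun t => (noise_hasGaussianLaw he_law t).fun_smul (lsMatrix u n N i t)) ?_
  exact (he_indep.precomp (g := fun t : Fin N => (t : ℕ)) Fin.val_injective).comp
    (fun t x => lsMatrix u n N i t * x) (fun t => by fun_prop)

theorem mlRV_sub_mean
    (he_law : ∀ t, HasLaw (e t) (gaussianReal 0 (Real.toNNReal (σ ^ 2))) μ) {N : ℕ}
    (h : IsUnit (gram u n N).det) (i : Fin n) :
    ∫ ω, (mlRV u e θ₀ N ω - θ₀) i ∂μ = 0 := by
  simp only [mlRV_sub_apply h]
  rw [integral_finsetSum _ fun (t : Fin N) _ =>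
    ((noise_hasGaussianLaw he_law t).integrable.const_mul (lsMatrix u n N i t))]
  simp [integral_const_mul, noise_mean he_law]

theorem mlRV_sub_cov (he_indep : iIndepFun e μ)
    (he_law : ∀ t, HasLaw (e t) (gaussianReal 0 (Real.toNNReal (σ ^ 2))) μ) {N : ℕ}
    (h : IsUnit (gram u n N).det) (i j : Fin n) :
    cov[fun ω => (mlRV u e θ₀ N ω - θ₀) i, fun ω => (mlRV u e θ₀ N ω - θ₀) j; μ] =
      σ ^ 2 * (gram u n N)⁻¹ i j := by
  have hm : ∀ i (t : Fin N), MemLp (fun ω => lsMatrix u n N i t * e t ω) 2 μ := fun i t =>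
    (noise_hasGaussianLaw he_law t).memLp_two.const_mul _
  simp only [mlRV_sub_apply h]
  rw [covariance_fun_sum_fun_sum (hm i) (hm j), ← lsMatrix_mul_transpose h, Matrix.mul_apply,
    Finset.mul_sum]
  refine Finset.sum_congr rfl fun t _ => ?_
  simp only [covariance_const_mul_left, covariance_const_mul_right, noise_cov he_indep he_law,
    Fin.val_inj, Matrix.transpose_apply]
  rw [Finset.sum_eq_single t (fun s _ hs => by simp [Ne.symm hs]) (by simp)]
  simp
  ring

theorem aestronglyMeasurable_of_coord {X : Ω → Vec n}
    (h : ∀ i, AEMeasurable (fun ω => X ω i) μ) : AEStronglyMeasurable X μ := by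
  have h1 : AEMeasurable (fun ω => WithLp.toLp 2 (fun i => X ω i)) μ :=
    (WithLp.measurable_toLp 2 _).comp_aemeasurable (aemeasurable_pi_lambda _ h)
  exact h1.aestronglyMeasurable

/-- Every coordinate of the error is a centred Gaussian whose variance is `σ²` times a diagonal
entry of `(ΦᵀΦ)⁻¹`, hence of order `1 / N`. Minkowski's inequality combines the coordinates. -/
theorem rootConsistent_mlRV (hS : S.PosDef)
    (hgram : Tendsto (fun N : ℕ => (N : ℝ)⁻¹ • gram u n N) atTop (𝓝 S)) (he_indep : iIndepFun e μ)
    (he_law : ∀ t, HasLaw (e t) (gaussianReal 0 (Real.toNNReal (σ ^ 2))) μ) :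
    RootConsistent μ (fun N ω => mlRV u e θ₀ N ω - θ₀) := by
  have hmeas : ∀ᶠ N in atTop, AEStronglyMeasurable (fun ω => mlRV u e θ₀ N ω - θ₀) μ := by
    filter_upwards [eventually_isUnit_det hS hgram] with N hN
    exact aestronglyMeasurable_of_coord fun i =>
      (mlRV_sub_hasGaussianLaw he_indep he_law hN i).aemeasurable
  refine ⟨hmeas, fun q => ?_⟩
  -- The exponent `0` is set aside because Minkowski's inequality needs `1 ≤ q`; there `eLpNorm` is
  -- zero by convention.
  rcases Nat.eq_zero_or_pos q with rfl | hq
  · exact ⟨0, le_rfl, Eventually.of_forall fun N => by simp⟩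
  set c := (eLpNorm (id : ℝ → ℝ) q (gaussianReal 0 1)).toReal with hc
  have hctop : eLpNorm (id : ℝ → ℝ) q (gaussianReal 0 1) = ENNReal.ofReal c :=
    (ENNReal.ofReal_toReal (memLp_id_gaussianReal' (q : ENNReal) (by simp)).eLpNorm_ne_top).symm
  have hlim := tendsto_inv_gram hS hgram
  have hbd : ∀ i : Fin n, ∃ K, 0 ≤ K ∧ ∀ᶠ N : ℕ in atTop, N * (gram u n N)⁻¹ i i ≤ K := fun i => by
    have h1 : Tendsto (fun N : ℕ => N * (gram u n N)⁻¹ i i) atTop (𝓝 (S⁻¹ i i)) :=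
      (tendsto_pi_nhds.1 (tendsto_pi_nhds.1 hlim i) i)
    refine ⟨|S⁻¹ i i| + 1, by positivity, (h1.eventually_lt_const (u := |S⁻¹ i i| + 1) ?_).mono
      fun N hN => hN.le⟩
    linarith [le_abs_self (S⁻¹ i i)]
  choose K hK0 hK using hbd
  refine ⟨∑ i, √(σ ^ 2 * K i) * c, by positivity, ?_⟩
  filter_upwards [eventually_isUnit_det hS hgram, eventually_all.2 hK, eventually_gt_atTop 0]
    with N hN hK hN0
  have hN' : (0 : ℝ) < N := by exact_mod_cast hN0
  have hG := fun i => mlRV_sub_hasGaussianLaw (θ₀ := θ₀) he_indep he_law hN i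
  have hcoord : ∀ i, eLpNorm (fun ω => (mlRV u e θ₀ N ω - θ₀) i) q μ ≤
      ENNReal.ofReal (√(σ ^ 2 * K i) * c / √N) := fun i => by
    rw [eLpNorm_of_hasGaussianLaw (hG i) (mlRV_sub_mean he_law hN i), hctop,
      ← ENNReal.ofReal_mul (Real.sqrt_nonneg _)]
    refine ENNReal.ofReal_le_ofReal ?_
    have hv : Var[fun ω => (mlRV u e θ₀ N ω - θ₀) i; μ] ≤ σ ^ 2 * K i / N := by
      rw [← covariance_self (hG i).aemeasurable, mlRV_sub_cov he_indep he_law hN, le_div_iff₀ hN']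
      nlinarith [mul_le_mul_of_nonneg_left (hK i) (sq_nonneg σ)]
    calc _ ≤ √(σ ^ 2 * K i / N) * c := by gcongr
      _ = _ := by
        rw [Real.sqrt_div (by have := hK0 i; positivity)]
        ring
  calc eLpNorm (fun ω => mlRV u e θ₀ N ω - θ₀) q μ
      ≤ eLpNorm (∑ i, fun ω => ‖(mlRV u e θ₀ N ω - θ₀) i‖) q μ := by
        refine eLpNorm_mono_real fun ω => ?_
        rw [Finset.sum_apply]
        conv_lhs => rw [← (EuclideanSpace.basisFun (Fin n) ℝ).sum_repr (mlRV u e θ₀ N ω - θ₀)]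
        refine (norm_sum_le _ _).trans (Finset.sum_le_sum fun i _ => ?_)
        simp [norm_smul]
    _ ≤ ∑ i, eLpNorm (fun ω => ‖(mlRV u e θ₀ N ω - θ₀) i‖) q μ :=
        eLpNorm_sum_le (fun i _ => (hG i).aemeasurable.norm.aestronglyMeasurable)
          (by exact_mod_cast hq)
    _ ≤ ∑ i, ENNReal.ofReal (√(σ ^ 2 * K i) * c / √N) := by
        refine Finset.sum_le_sum fun i _ => ?_
        rw [eLpNorm_norm]
        exact hcoord i
    _ = _ := by
        rw [← ENNReal.ofReal_sum_of_nonneg fun i _ => by positivity, Finset.sum_div]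

theorem tendsto_mlRV_cov (hS : S.PosDef)
    (hgram : Tendsto (fun N : ℕ => (N : ℝ)⁻¹ • gram u n N) atTop (𝓝 S)) (he_indep : iIndepFun e μ)
    (he_law : ∀ t, HasLaw (e t) (gaussianReal 0 (Real.toNNReal (σ ^ 2))) μ) (i j : Fin n) :
    Tendsto (fun N : ℕ => N * ∫ ω, (mlRV u e θ₀ N ω - θ₀) i * (mlRV u e θ₀ N ω - θ₀) j ∂μ) atTop
      (𝓝 ((σ ^ 2 • S⁻¹) i j)) := by
  have h1 : Tendsto (fun N : ℕ => σ ^ 2 * (N * (gram u n N)⁻¹ i j)) atTop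
      (𝓝 (σ ^ 2 * S⁻¹ i j)) :=
    (tendsto_pi_nhds.1 (tendsto_pi_nhds.1 (tendsto_inv_gram hS hgram) i) j).const_mul _
  refine h1.congr' ?_
  filter_upwards [eventually_isUnit_det hS hgram] with N hN
  have hG := fun i => (mlRV_sub_hasGaussianLaw (θ₀ := θ₀) he_indep he_law hN i).memLp_two
  have h2 := mlRV_sub_cov (θ₀ := θ₀) he_indep he_law hN i j
  rw [covariance_eq_sub (hG i) (hG j), mlRV_sub_mean he_law hN, zero_mul, sub_zero] at h2
  simp only [Pi.mul_apply] at h2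
  rw [h2]
  ring

end Law

/-! ### Plugging a consistent hyper-parameter into a uniformly strictly differentiable family -/

section Jacobian

variable {n p : ℕ}

/-- Matrices as continuous linear maps between Euclidean spaces. -/
noncomputable def mulVCLM : Matrix (Fin p) (Fin n) ℝ ≃ₗ[ℝ] (Vec n →L[ℝ] Vec p) :=
  (Matrix.toLpLin 2 2).trans LinearMap.toContinuousLinearMap

theorem mulVCLM_single (A : Matrix (Fin p) (Fin n) ℝ) (j : Fin n) (i : Fin p) :
    mulVCLM A (EuclideanSpace.single j 1) i = A i j := by
  change (Matrix.toLpLin 2 2 A) (EuclideanSpace.single j 1) i = A i j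
  simp [Matrix.toLpLin_apply]

theorem mulVCLM_jacobian (f : Vec n → Vec p) (x : Vec n) :
    mulVCLM (jacobian f x) = fderiv ℝ f x := by
  refine ContinuousLinearMap.coe_inj.1 ?_
  refine (EuclideanSpace.basisFun (Fin n) ℝ).toBasis.ext fun j => ?_
  ext i
  simp only [OrthonormalBasis.coe_toBasis, EuclideanSpace.basisFun_apply]
  exact mulVCLM_single _ j i

theorem continuous_mulVCLM : Continuous (mulVCLM : Matrix (Fin p) (Fin n) ℝ → _) :=
  LinearMap.continuous_of_finiteDimensional
    (mulVCLM : Matrix (Fin p) (Fin n) ℝ ≃ₗ[ℝ] (Vec n →L[ℝ] Vec p)).toLinearMap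

end Jacobian

/-! ### Expansions along hyper-parameter functions with a uniform Taylor remainder. -/

section PlugIn

variable {E F G : Type*} [NormedAddCommGroup E] [NormedSpace ℝ E] [NormedAddCommGroup F]
  [NormedSpace ℝ F] [NormedAddCommGroup G] [NormedSpace ℝ G]

/-- `f N` has the derivative `A` at `x₀` in the limit, with a remainder uniform in `N`. -/
def UnifDiffAt (f : ℕ → E → F) (x₀ : E) (A : E →L[ℝ] F) : Prop :=
  ∀ ε > 0, ∃ δ > 0, ∀ᶠ N in atTop, ∀ x, ‖x - x₀‖ < δ →
    ‖f N x - f N x₀ - A (x - x₀)‖ ≤ ε * ‖x - x₀‖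

/-- The product filter provides a radius independent of `N`. Replacing the derivative of `f N` by
its limit costs another `ε / 2 * ‖x - x₀‖`. -/
theorem unifDiffAt_of_isLittleO {f : ℕ → E → F} {x₀ : E} {A : E →L[ℝ] F}
    (hA : Tendsto (fun N => fderiv ℝ (f N) x₀) atTop (𝓝 A))
    (h : (fun q : ℕ × E => f q.1 q.2 - f q.1 x₀ - fderiv ℝ (f q.1) x₀ (q.2 - x₀))
      =o[atTop ×ˢ 𝓝 x₀] fun q => q.2 - x₀) : UnifDiffAt f x₀ A := by
  intro ε hε
  have h1 := h.def (half_pos hε)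
  obtain ⟨U, hU, V, hV, hUV⟩ := eventually_prod_iff.1 h1
  obtain ⟨δ, hδ, hV⟩ := Metric.eventually_nhds_iff.1 hV
  refine ⟨δ, hδ, ?_⟩
  filter_upwards [hU, Metric.tendsto_nhds.1 hA _ (half_pos hε)] with N hN hAN x hx
  have h2 := hUV hN (hV (by rwa [dist_eq_norm]))
  simp only at h2
  rw [dist_eq_norm] at hAN
  have h3 : f N x - f N x₀ - A (x - x₀) =
      (f N x - f N x₀ - fderiv ℝ (f N) x₀ (x - x₀)) + (fderiv ℝ (f N) x₀ - A) (x - x₀) := by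
    simp
  rw [h3]
  calc _ ≤ ε / 2 * ‖x - x₀‖ + ε / 2 * ‖x - x₀‖ := by
        refine (norm_add_le _ _).trans (add_le_add h2 ?_)
        exact ((fderiv ℝ (f N) x₀ - A).le_opNorm _).trans (by gcongr)
    _ = _ := by ring

variable {φ : ℕ → E × F → G} {x₀ : E} {y₀ : F} {b : G} {D : E × F →L[ℝ] G}

theorem UnifDiffAt.eventually_lipschitz {f : ℕ → E → F} {A : E →L[ℝ] F}
    (h : UnifDiffAt f x₀ A) : ∃ δ > 0, ∀ᶠ N in atTop, ∀ x, ‖x - x₀‖ < δ →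
      ‖f N x - f N x₀‖ ≤ (‖A‖ + 1) * ‖x - x₀‖ := by
  obtain ⟨δ, hδ, h⟩ := h 1 one_pos
  refine ⟨δ, hδ, h.mono fun N h x hx => ?_⟩
  have h1 : f N x - f N x₀ = (f N x - f N x₀ - A (x - x₀)) + A (x - x₀) := by abel
  rw [h1]
  refine (norm_add_le _ _).trans ((add_le_add (h x hx) (A.le_opNorm _)).trans ?_)
  linarith

theorem UnifDiffAt.eventually_mem_ball {f : ℕ → E → F} {A : E →L[ℝ] F}
    (h : UnifDiffAt f x₀ A) (hf : Tendsto (fun N => f N x₀) atTop (𝓝 y₀)) {r : ℝ} (hr : 0 < r) :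
    ∃ δ > 0, ∀ᶠ N in atTop, ∀ x, ‖x - x₀‖ < δ → (x, f N x) ∈ Metric.ball (x₀, y₀) r := by
  obtain ⟨δ, hδ, h⟩ := h.eventually_lipschitz
  have hA : 0 < ‖A‖ + 1 := by positivity
  refine ⟨min δ (min r (r / 2 / (‖A‖ + 1))), by positivity, ?_⟩
  filter_upwards [h, Metric.tendsto_nhds.1 hf _ (half_pos hr)] with N h hN x hx
  obtain ⟨h1, h2, h3⟩ : ‖x - x₀‖ < δ ∧ ‖x - x₀‖ < r ∧ ‖x - x₀‖ < r / 2 / (‖A‖ + 1) := by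
    simpa [lt_min_iff] using hx
  rw [lt_div_iff₀ hA] at h3
  rw [← ball_prod_same]
  refine ⟨by simpa [dist_eq_norm] using h2, ?_⟩
  rw [Metric.mem_ball]
  have h4 := h x h1
  calc dist (f N x) y₀ ≤ dist (f N x) (f N x₀) + dist (f N x₀) y₀ := dist_triangle _ _ _
    _ < r / 2 + r / 2 := by
      rw [dist_eq_norm (f N x)]
      refine add_lt_add (h4.trans_lt ?_) hN
      linarith
    _ = r := by ring

/-- Makes a hyper-parameter frozen at `y N` a special case of a plugged-in function. -/
theorem UnifDiffAt.const (y : ℕ → F) : UnifDiffAt (fun N (_ : E) => y N) x₀ 0 := fun ε hε =>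
  ⟨1, one_pos, Eventually.of_forall fun N x _ => by
    simp only [sub_self, zero_apply, norm_zero]
    positivity⟩

theorem UnifStrictDiff.plugIn_tendsto (hφ : UnifStrictDiff φ (x₀, y₀) b D) {f : ℕ → E → F}
    {A : E →L[ℝ] F} (h : UnifDiffAt f x₀ A) (hf : Tendsto (fun N => f N x₀) atTop (𝓝 y₀)) :
    ∀ ε > 0, ∃ δ > 0, ∀ᶠ N in atTop, ∀ x, ‖x - x₀‖ < δ → ‖φ N (x, f N x) - b‖ ≤ ε := by
  intro ε hε
  obtain ⟨r, hr, hφ⟩ := hφ ε hε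
  obtain ⟨δ, hδ, hm⟩ := h.eventually_mem_ball hf hr
  refine ⟨δ, hδ, ?_⟩
  filter_upwards [hφ, hm] with N hφ hm x hx
  exact (hφ _ (hm x hx)).1

/-- Expansion in the first variable. -/
theorem UnifStrictDiff.expand_fst (hφ : UnifStrictDiff φ (x₀, y₀) b D) {y : ℕ → F}
    (hy : Tendsto y atTop (𝓝 y₀)) : ∀ ε > 0, ∃ δ > 0, ∀ᶠ N in atTop, ∀ x, ‖x - x₀‖ < δ →
      ‖φ N (x, y N) - φ N (x₀, y N) - D.comp (ContinuousLinearMap.inl ℝ E F) (x - x₀)‖ ≤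
        ε * ‖x - x₀‖ := by
  intro ε hε
  obtain ⟨r, hr, hφ⟩ := hφ ε hε
  obtain ⟨δ, hδ, hm⟩ := (UnifDiffAt.const (x₀ := x₀) y).eventually_mem_ball hy hr
  refine ⟨δ, hδ, ?_⟩
  filter_upwards [hφ, hm] with N hφ hm x hx
  have h1 := (hφ _ (hm x hx)).2 _ (hm x₀ (by simpa using hδ))
  simpa [Prod.norm_def] using h1

/-- Expansion along the plugged-in function. -/
theorem UnifStrictDiff.expand_snd (hφ : UnifStrictDiff φ (x₀, y₀) b D) {f : ℕ → E → F}
    {A : E →L[ℝ] F} (h : UnifDiffAt f x₀ A) (hf : Tendsto (fun N => f N x₀) atTop (𝓝 y₀)) :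
    ∀ ε > 0, ∃ δ > 0, ∀ᶠ N in atTop, ∀ x, ‖x - x₀‖ < δ →
      ‖φ N (x, f N x) - φ N (x, f N x₀) -
        (D.comp (ContinuousLinearMap.inr ℝ E F)).comp A (x - x₀)‖ ≤ ε * ‖x - x₀‖ := by
  intro ε hε
  set M := ‖D.comp (ContinuousLinearMap.inr ℝ E F)‖ + 1 with hM
  have hM0 : 0 < M := by positivity
  have hA0 : 0 < ‖A‖ + 1 := by positivity
  obtain ⟨r, hr, hφ⟩ := hφ (ε / 2 / (‖A‖ + 1)) (by positivity)
  obtain ⟨δ₁, hδ₁, hm₁⟩ := h.eventually_mem_ball hf hr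
  obtain ⟨δ₂, hδ₂, hm₂⟩ :=
    (UnifDiffAt.const (x₀ := x₀) fun N => f N x₀).eventually_mem_ball hf hr
  obtain ⟨δ₃, hδ₃, h₃⟩ := h.eventually_lipschitz
  obtain ⟨δ₄, hδ₄, h₄⟩ := h (ε / 2 / M) (by positivity)
  refine ⟨min (min δ₁ δ₂) (min δ₃ δ₄), by positivity, ?_⟩
  filter_upwards [hφ, hm₁, hm₂, h₃, h₄] with N hφ hm₁ hm₂ h₃ h₄ x hx
  obtain ⟨⟨hx₁, hx₂⟩, hx₃, hx₄⟩ :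
      (‖x - x₀‖ < δ₁ ∧ ‖x - x₀‖ < δ₂) ∧ ‖x - x₀‖ < δ₃ ∧ ‖x - x₀‖ < δ₄ := by
    simpa only [lt_min_iff] using hx
  -- The two points compared both move with `x`, so an expansion at the base point would leave an
  -- error in `‖x - x₀‖` and `N` mixed together; the two-point bound of `UnifStrictDiff` measures
  -- the error by the change of the hyper-parameter alone.
  have h5 := (hφ _ (hm₁ x hx₁)).2 _ (hm₂ x hx₂)
  simp only [Prod.mk_sub_mk, sub_self, Prod.norm_def, norm_zero, norm_nonneg, sup_of_le_right]
    at h5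
  have h6 : φ N (x, f N x) - φ N (x, f N x₀) -
      (D.comp (ContinuousLinearMap.inr ℝ E F)).comp A (x - x₀) =
      (φ N (x, f N x) - φ N (x, f N x₀) - D (0, f N x - f N x₀)) +
        D.comp (ContinuousLinearMap.inr ℝ E F) (f N x - f N x₀ - A (x - x₀)) := by
    rw [map_sub (D.comp (ContinuousLinearMap.inr ℝ E F)) (f N x - f N x₀)]
    change _ - D (0, A (x - x₀)) = _ + (D (0, f N x - f N x₀) - D (0, A (x - x₀)))
    abel
  rw [h6]
  calc _ ≤ ε / 2 / (‖A‖ + 1) * ((‖A‖ + 1) * ‖x - x₀‖) + M * (ε / 2 / M * ‖x - x₀‖) := by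
        refine (norm_add_le _ _).trans (add_le_add (h5.trans ?_)
          ((ContinuousLinearMap.le_opNorm _ _).trans ?_))
        · gcongr
          exact h₃ x hx₃
        · gcongr
          · rw [hM]
            linarith
          · exact h₄ x hx₄
    _ = _ := by
        field_simp
        ring

end PlugIn

/-! ### Measurability of the estimators -/

section Measurability

variable {n p : ℕ} {u : ℕ → ℝ} {σ : ℝ} {w : Vec n → Vec p → ℝ}

theorem continuous_mulV {k m : ℕ} (A : Matrix (Fin k) (Fin m) ℝ) : Continuous (mulV A) := by
  unfold mulV
  fun_prop

theorem measurable_mle (N : ℕ) : Measurable (mle u n N) :=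
  (continuous_mulV _).measurable

theorem measurable_likelihood (N : ℕ) :
    Measurable fun q : Vec N × Vec n => likelihood u σ q.1 q.2 := by
  have h1 : Continuous (mulV (regressor u n N)) := continuous_mulV _
  have h2 : Continuous fun q : Vec N × Vec n => likelihood u σ q.1 q.2 := by
    unfold likelihood
    fun_prop
  exact h2.measurable

/-- Measurability is joint in data and hyper-parameter, so that a data-dependent hyper-parameter may
be substituted. -/
theorem measurable_ebEstimate (hw : Measurable (Function.uncurry w)) (N : ℕ) :
    Measurable fun q : Vec N × Vec p => ebEstimate u σ w q.1 q.2 := by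
  have h1 : Measurable fun z : (Vec N × Vec p) × Vec n =>
      likelihood u σ z.1.1 z.2 * w z.2 z.1.2 :=
    ((measurable_likelihood N).comp (by fun_prop : Measurable fun z : (Vec N × Vec p) × Vec n =>
      (z.1.1, z.2))).mul (hw.comp (by fun_prop : Measurable fun z : (Vec N × Vec p) × Vec n =>
      (z.2, z.1.2)))
  have h2 : StronglyMeasurable fun q : Vec N × Vec p =>
      ∫ θ : Vec n, likelihood u σ q.1 θ * w θ q.2 :=
    StronglyMeasurable.integral_prod_right
      (f := fun (q : Vec N × Vec p) θ => likelihood u σ q.1 θ * w θ q.2) h1.stronglyMeasurable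
  have h3 : StronglyMeasurable fun q : Vec N × Vec p =>
      ∫ θ : Vec n, (likelihood u σ q.1 θ * w θ q.2) • θ :=
    StronglyMeasurable.integral_prod_right
      (f := fun (q : Vec N × Vec p) θ => (likelihood u σ q.1 θ * w θ q.2) • θ)
      (h1.smul measurable_snd).stronglyMeasurable
  exact h2.measurable.inv.smul h3.measurable

variable {Ω : Type*} [MeasurableSpace Ω] {μ : Measure Ω} {e : ℕ → Ω → ℝ} {θ₀ : Vec n}

theorem aemeasurable_output (he : ∀ t, AEMeasurable (e t) μ) (N : ℕ) :
    AEMeasurable (output u e θ₀ N) μ :=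
  aemeasurable_const.add ((WithLp.measurable_toLp 2 _).comp_aemeasurable
    (aemeasurable_pi_lambda _ fun t : Fin N => he t))

theorem aemeasurable_mlRV (he : ∀ t, AEMeasurable (e t) μ) (N : ℕ) :
    AEMeasurable (mlRV u e θ₀ N) μ :=
  (measurable_mle N).comp_aemeasurable (aemeasurable_output he N)

theorem aemeasurable_ebRV (hw : Measurable (Function.uncurry w)) (he : ∀ t, AEMeasurable (e t) μ)
    {ηhat : ℕ → Vec n → Vec p} (hη : ∀ N, Measurable (ηhat N)) (N : ℕ) :
    AEMeasurable (ebRV u e σ w ηhat θ₀ N) μ := by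
  have h1 : AEMeasurable (fun ω => (output u e θ₀ N ω, ηhat N (mlRV u e θ₀ N ω))) μ :=
    (aemeasurable_output he N).prodMk ((hη N).comp_aemeasurable (aemeasurable_mlRV he N))
  have h2 := (measurable_ebEstimate (u := u) (σ := σ) hw N).comp_aemeasurable h1
  exact h2

theorem aemeasurable_ebFrozenRV (hw : Measurable (Function.uncurry w))
    (he : ∀ t, AEMeasurable (e t) μ) {ηhat : ℕ → Vec n → Vec p} (N : ℕ) :
    AEMeasurable (ebFrozenRV u e σ w ηhat θ₀ N) μ := by
  have h1 : AEMeasurable (fun ω => (output u e θ₀ N ω, ηhat N θ₀)) μ :=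
    (aemeasurable_output he N).prodMk aemeasurable_const
  have h2 := (measurable_ebEstimate (u := u) (σ := σ) hw N).comp_aemeasurable h1
  exact h2

end Measurability

/-! ### Error terms of an estimator close to a root-consistent one -/

section ErrorTerms

variable {Ω : Type*} [MeasurableSpace Ω] {μ : Measure Ω} [IsProbabilityMeasure μ] {n : ℕ}

theorem integral_coord {X : Ω → Vec n} (h : Integrable X μ) (i : Fin n) :
    (∫ ω, X ω ∂μ) i = ∫ ω, X ω i ∂μ :=
  ((EuclideanSpace.proj i : Vec n →L[ℝ] ℝ).integral_comp_comm h).symm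

theorem covariance_coord_of_unbiased {X Z : Ω → Vec n} {θ₀ : Vec n}
    (hX : MemLp (fun ω => X ω - θ₀) 2 μ) (h0 : ∫ ω, (X ω - θ₀) ∂μ = 0) (hZ : MemLp Z 2 μ)
    (i j : Fin n) : cov[fun ω => Z ω i, fun ω => X ω j; μ] = ∫ ω, Z ω i * (X ω - θ₀) j ∂μ := by
  have h1 : cov[fun ω => Z ω i, fun ω => X ω j; μ] =
      cov[fun ω => Z ω i, fun ω => (X ω - θ₀) j; μ] := by
    have h2 : Integrable (fun ω => X ω j) μ := by
      have h3 := ((hX.coord j).integrable (by norm_num)).add (integrable_const (θ₀ j))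
      refine h3.congr (ae_of_all _ fun ω => ?_)
      simp
    exact (covariance_sub_const_right h2 (θ₀ j)).symm
  rw [h1, covariance_eq_sub (hZ.coord i) (hX.coord j),
    ← integral_coord (hX.integrable (by norm_num)) j, h0]
  simp

variable {X T T' : ℕ → Ω → Vec n} {θ₀ b : Vec n}

/-- As `X` is unbiased, each covariance is an uncentred product with `X - θ₀`. One factor `N`
rescales `Z`, the other compensates for the size of the error, and the second covariance is the
transpose of the first. -/
theorem tendsto_crossCov_add_transpose {Z : ℕ → Ω → Vec n}
    (hX : ∀ᶠ N in atTop, MemLp (fun ω => X N ω - θ₀) 2 μ)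
    (h0 : ∀ᶠ N in atTop, ∫ ω, (X N ω - θ₀) ∂μ = 0) (hZ : ∀ᶠ N in atTop, MemLp (Z N) 2 μ)
    {M : Matrix (Fin n) (Fin n) ℝ}
    (h : ∀ i j, Tendsto (fun N : ℕ => N * ∫ ω, ((N : ℝ) • Z N ω) i * (X N ω - θ₀) j ∂μ) atTop
      (𝓝 (M i j))) :
    Tendsto (fun N : ℕ => (N : ℝ) ^ 2 • (crossCov μ (Z N) (X N) + crossCov μ (X N) (Z N))) atTop
      (𝓝 (M + Mᵀ)) := by
  refine tendsto_pi_nhds.2 fun i => tendsto_pi_nhds.2 fun j => ((h i j).add (h j i)).congr' ?_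
  filter_upwards [hX, h0, hZ] with N hX h0 hZ
  simp only [Matrix.smul_apply, Matrix.add_apply, crossCov, Matrix.of_apply, smul_eq_mul,
    PiLp.smul_apply, mul_assoc, integral_const_mul]
  rw [covariance_comm (fun ω => X N ω i), covariance_coord_of_unbiased hX h0 hZ,
    covariance_coord_of_unbiased hX h0 hZ]
  ring

/-- Unbiasedness of `X` makes the bias of `T` equal to the mean of `T - X`. -/
theorem tendsto_scaled_bias
    (h0 : ∀ᶠ N in atTop, ∫ ω, (X N ω - θ₀) ∂μ = 0)
    (hξ : RootConsistent μ fun N ω => X N ω - θ₀)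
    (hT : TailNegligible μ (fun N ω => X N ω - θ₀) fun N ω => T N ω - X N ω)
    (hb : LocallyTendsto μ (fun N ω => X N ω - θ₀) (fun N ω => (N : ℝ) • (T N ω - X N ω)) b) :
    Tendsto (fun N : ℕ => (N : ℝ) • ((∫ ω, T N ω ∂μ) - θ₀)) atTop (𝓝 b) := by
  refine (hb.tendsto_integral hξ hT.nat_smul).congr' ?_
  filter_upwards [h0, hξ.tailNegligible_self.memLp, hT.memLp] with N h0 hX hT
  rw [integral_smul]
  congr 1
  have h1 := hX.integrable (by norm_num : (1 : ENNReal) ≤ 2)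
  have h2 := hT.integrable (by norm_num : (1 : ENNReal) ≤ 2)
  have h3 : ∀ ω, T N ω = (T N ω - X N ω) + ((X N ω - θ₀) + θ₀) := fun ω => by abel
  conv_rhs => rw [integral_congr_ae (ae_of_all μ h3)]
  have h4 : Integrable (fun ω => X N ω - θ₀ + θ₀) μ := h1.add (integrable_const θ₀)
  rw [integral_add h2 h4, integral_add h1 (integrable_const θ₀), h0]
  simp

theorem crossCov_smul (c : ℝ) (Y Z : Ω → Vec n) :
    crossCov μ (fun ω => c • Y ω) (fun ω => c • Z ω) = c ^ 2 • crossCov μ Y Z := by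
  ext i j
  simp only [crossCov, Matrix.of_apply, PiLp.smul_apply, smul_eq_mul, covariance_const_mul_left,
    covariance_const_mul_right, Matrix.smul_apply]
  ring

theorem outer_smul (c : ℝ) (v : Vec n) : outer (c • v) = c ^ 2 • outer v := by
  ext i j
  simp only [outer, Matrix.vecMulVec_apply, PiLp.smul_apply, smul_eq_mul, Matrix.smul_apply]
  ring

theorem continuous_outer : Continuous (outer : Vec n → _) := by
  unfold outer
  fun_prop

/-- The scaled difference `T - X` converges in `L²` to a constant, so its covariance vanishes in the
limit. The scaled biases of `T` and `T'` have the same limit, so their outer products cancel. -/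
theorem tendsto_higher_order_terms
    (h0 : ∀ᶠ N in atTop, ∫ ω, (X N ω - θ₀) ∂μ = 0)
    (hξ : RootConsistent μ fun N ω => X N ω - θ₀)
    (hT : TailNegligible μ (fun N ω => X N ω - θ₀) fun N ω => T N ω - X N ω)
    (hT' : TailNegligible μ (fun N ω => X N ω - θ₀) fun N ω => T' N ω - X N ω)
    (hb : LocallyTendsto μ (fun N ω => X N ω - θ₀) (fun N ω => (N : ℝ) • (T N ω - X N ω)) b)
    (hb' : LocallyTendsto μ (fun N ω => X N ω - θ₀) (fun N ω => (N : ℝ) • (T' N ω - X N ω)) b) :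
    Tendsto (fun N : ℕ => (N : ℝ) ^ 2 • (crossCov μ (fun ω => T N ω - X N ω)
      (fun ω => T N ω - X N ω) + outer ((∫ ω, T N ω ∂μ) - θ₀) - outer ((∫ ω, T' N ω ∂μ) - θ₀)))
      atTop (𝓝 0) := by
  have h1 := hb.tendsto_crossCov hξ hT.nat_smul
  have h2 := (continuous_outer.tendsto b).comp (tendsto_scaled_bias h0 hξ hT hb)
  have h3 := (continuous_outer.tendsto b).comp (tendsto_scaled_bias h0 hξ hT' hb')
  have h4 := (h1.add h2).sub h3
  rw [zero_add, sub_self] at h4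
  refine h4.congr fun N => ?_
  simp only [Function.comp_apply, crossCov_smul, outer_smul]
  rw [smul_sub ((N : ℝ) ^ 2), smul_add ((N : ℝ) ^ 2)]

/-- Expanding `‖(T - X) + (X - θ₀)‖²`, the square of the second summand is the error of `X` and
drops out. The square of the first gives `‖b‖²`, and the cross term gives twice the trace. -/
theorem tendsto_excess_mse
    (hξ : RootConsistent μ fun N ω => X N ω - θ₀)
    (hT : TailNegligible μ (fun N ω => X N ω - θ₀) fun N ω => T N ω - X N ω)
    (hb : LocallyTendsto μ (fun N ω => X N ω - θ₀) (fun N ω => (N : ℝ) • (T N ω - X N ω)) b)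
    {M : Matrix (Fin n) (Fin n) ℝ}
    (h : ∀ i j, Tendsto (fun N : ℕ => N * ∫ ω, ((N : ℝ) • (T N ω - X N ω)) i * (X N ω - θ₀) j ∂μ)
      atTop (𝓝 (M i j))) :
    Tendsto (fun N : ℕ => (N : ℝ) ^ 2 * (mse μ θ₀ (T N) - mse μ θ₀ (X N))) atTop
      (𝓝 (‖b‖ ^ 2 + 2 * M.trace)) := by
  have h1 := (hb.tendsto_integral_norm_sq hξ hT.nat_smul).add
    ((tendsto_finsetSum Finset.univ fun i _ => h i i).const_mul 2)
  refine h1.congr' ?_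
  filter_upwards [hξ.tailNegligible_self.memLp, hT.memLp] with N hX hT
  have h2 : ∀ ω, ‖T N ω - θ₀‖ ^ 2 = ‖T N ω - X N ω‖ ^ 2 +
      2 * ∑ i, (T N ω - X N ω) i * (X N ω - θ₀) i + ‖X N ω - θ₀‖ ^ 2 := fun ω => by
    have h3 : T N ω - θ₀ = (T N ω - X N ω) + (X N ω - θ₀) := by abel
    have h4 : inner ℝ (T N ω - X N ω) (X N ω - θ₀) =
        ∑ i, (T N ω - X N ω) i * (X N ω - θ₀) i := by
      rw [PiLp.inner_apply]
      exact Finset.sum_congr rfl fun i _ => by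
        simp only [RCLike.inner_apply, conj_trivial, mul_comm]
    rw [h3, norm_add_sq_real, h4]
  have hi : ∀ i, Integrable (fun ω => (T N ω - X N ω) i * (X N ω - θ₀) i) μ := fun i =>
    (hT.coord i).integrable_mul (hX.coord i)
  have hs := (integrable_finsetSum Finset.univ fun i _ => hi i).const_mul 2
  have h5 : mse μ θ₀ (T N) = ∫ ω, ‖T N ω - X N ω‖ ^ 2 ∂μ +
      2 * ∑ i, ∫ ω, (T N ω - X N ω) i * (X N ω - θ₀) i ∂μ + mse μ θ₀ (X N) := by
    have h6 : Integrable (fun ω => ‖T N ω - X N ω‖ ^ 2 +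
        2 * ∑ i, (T N ω - X N ω) i * (X N ω - θ₀) i) μ :=
      (hT.integrable_norm_pow two_ne_zero).add hs
    unfold mse
    simp only [h2]
    rw [integral_add h6 (hX.integrable_norm_pow two_ne_zero),
      integral_add (hT.integrable_norm_pow two_ne_zero) hs, integral_const_mul,
      integral_finsetSum _ fun i _ => hi i]
  simp only [h5, norm_smul, mul_pow, Real.norm_natCast, PiLp.smul_apply, smul_eq_mul, mul_assoc,
    integral_const_mul, ← Finset.mul_sum]
  ring

end ErrorTerms

/-! ### Asymptotics of the empirical Bayes estimator -/

section Main

theorem TailNegligible.mono {Ω E F G : Type*} [MeasurableSpace Ω] {μ : Measure Ω}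
    [NormedAddCommGroup E] [NormedAddCommGroup F] [NormedAddCommGroup G]
    {ξ : ℕ → Ω → E} {Z : ℕ → Ω → F} {Y : ℕ → Ω → G} (hZ : TailNegligible μ ξ Z)
    (hm : ∀ᶠ N in atTop, AEStronglyMeasurable (Y N) μ)
    (h : ∀ᶠ N in atTop, ∀ ω, ‖Y N ω‖ ≤ ‖Z N ω‖) : TailNegligible μ ξ Y := by
  refine ⟨?_, fun δ hδ k => ?_⟩
  · filter_upwards [hZ.memLp, hm, h] with N hZ hm h using hZ.mono hm (ae_of_all _ h)
  · refine tendsto_of_tendsto_of_tendsto_of_le_of_le' tendsto_const_nhds (hZ.tendsto δ hδ k)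
      (Eventually.of_forall fun _ => zero_le) ?_
    filter_upwards [h] with N h
    gcongr
    exact eLpNorm_mono h

/-- Serves the frozen estimator, for which no moment bound is assumed. -/
theorem TailNegligible.of_linear_growth {Ω E G : Type*} [MeasurableSpace Ω] {μ : Measure Ω}
    [IsProbabilityMeasure μ] [NormedAddCommGroup E] [NormedSpace ℝ E] [NormedAddCommGroup G]
    [NormedSpace ℝ G]
    {ξ : ℕ → Ω → E} {Y : ℕ → Ω → G} (hξ : RootConsistent μ ξ) {K : ℝ} (hK : 0 ≤ K)
    (hm : ∀ᶠ N in atTop, AEStronglyMeasurable (Y N) μ)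
    (h : ∀ᶠ N in atTop, ∀ ω, ‖Y N ω‖ ≤ K * (1 + ‖ξ N ω‖)) : TailNegligible μ ξ Y := by
  have h1 : TailNegligible μ ξ fun N ω => ‖ξ N ω‖ :=
    hξ.tailNegligible_self.mono (hξ.meas.mono fun N h => h.norm)
      (Eventually.of_forall fun N ω => by simp)
  have h2 : TailNegligible μ ξ fun _ _ => (1 : ℝ) :=
    hξ.tailNegligible_const (C := 1) (Eventually.of_forall fun _ => by simp)
  refine ((h2.add h1).clm (K • ContinuousLinearMap.id ℝ ℝ)).mono hm (h.mono fun N h ω => ?_)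
  refine (h ω).trans (le_of_eq ?_)
  change _ = ‖K * (1 + ‖ξ N ω‖)‖
  rw [Real.norm_of_nonneg (by positivity)]

theorem sum_limBθ_mul {n p : ℕ} {σ : ℝ} {S : Matrix (Fin n) (Fin n) ℝ} {w : Vec n → Vec p → ℝ}
    {θ₀ : Vec n} {η : Vec p} (h : DifferentiableAt ℝ (logGrad w) (θ₀, η)) (i j : Fin n) :
    ∑ k, (shiftDeriv σ S w θ₀ η).comp (ContinuousLinearMap.inl ℝ (Vec n) (Vec p))
        (EuclideanSpace.single k 1) i * (σ ^ 2 • S⁻¹) k j =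
      (σ ^ 2 • (limBθ σ S w θ₀ η * S⁻¹)) i j := by
  rw [← Matrix.mul_smul, Matrix.mul_apply]
  exact Finset.sum_congr rfl fun k _ => by
    rw [limBθ_apply h]
    rfl

theorem sum_limBη_mul {n p : ℕ} {σ : ℝ} {S : Matrix (Fin n) (Fin n) ℝ} {w : Vec n → Vec p → ℝ}
    {θ₀ : Vec n} {η : Vec p} (h : DifferentiableAt ℝ (logGrad w) (θ₀, η))
    (D : Matrix (Fin p) (Fin n) ℝ) (i j : Fin n) :
    ∑ k, ((shiftDeriv σ S w θ₀ η).comp (ContinuousLinearMap.inr ℝ (Vec n) (Vec p))).comp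
        (mulVCLM D) (EuclideanSpace.single k 1) i * (σ ^ 2 • S⁻¹) k j =
      (σ ^ 2 • (limBη σ S w θ₀ η * D * S⁻¹)) i j := by
  rw [← Matrix.mul_smul, Matrix.mul_apply]
  refine Finset.sum_congr rfl fun k _ => ?_
  congr 1
  have h1 : mulVCLM D (EuclideanSpace.single k 1) = ∑ l, D l k • EuclideanSpace.single l (1 : ℝ) := by
    ext l
    rw [mulVCLM_single]
    simp [Finset.sum_apply, Pi.single_apply]
  rw [ContinuousLinearMap.comp_apply, h1, map_sum, Matrix.mul_apply]
  simp only [map_smul, WithLp.ofLp_sum, Finset.sum_apply, PiLp.smul_apply, smul_eq_mul]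
  refine Finset.sum_congr rfl fun l _ => ?_
  rw [limBη_apply h, mul_comm]
  rfl

theorem theorem2 {Ω : Type*} [MeasurableSpace Ω] (μ : Measure Ω) [IsProbabilityMeasure μ]
    (n p : ℕ) (u : ℕ → ℝ) (θ₀ : Vec n) (σ : ℝ) (hσ : 0 < σ)
    -- independent Gaussian noise with variance `σ²`
    (e : ℕ → Ω → ℝ) (he_indep : iIndepFun e μ)
    (he_law : ∀ t, HasLaw (e t) (gaussianReal 0 (Real.toNNReal (σ ^ 2))) μ)
    -- `ΦᵀΦ / N → Σ ≻ 0`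
    (S : Matrix (Fin n) (Fin n) ℝ) (hS : S.PosDef)
    (hgram : Tendsto (fun N : ℕ => (N : ℝ)⁻¹ • gram u n N) atTop (𝓝 S))
    -- the feasible set, the weighting function and the hyper-parameter estimators
    (Dη : Set (Vec p)) (w : Vec n → Vec p → ℝ) (ηhat : ℕ → Vec n → Vec p)
    (hw_meas : Measurable (Function.uncurry w)) (hw_nonneg : ∀ θ, ∀ η ∈ Dη, 0 ≤ w θ η)
    (hη_meas : ∀ N, Measurable (ηhat N)) (hη_mem : ∀ N x, ηhat N x ∈ Dη)
    -- regularity of the weighting function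
    (hw_pos : ∀ η ∈ interior Dη, 0 < w θ₀ η)
    (hw_smooth : ∀ η ∈ interior Dη, ContDiffAt ℝ 2 (Function.uncurry w) (θ₀, η))
    (hw_dom : ∀ η ∈ interior Dη, ∃ U ∈ 𝓝 η, ∃ c : ℝ, ∃ h : Vec n → ℝ, Integrable h ∧
      ∀ᵐ θ : Vec n, ∀ η' ∈ U, DifferentiableAt ℝ (w θ) η' ∧
        ‖fderiv ℝ (w θ) η'‖ * Real.exp (-c * ‖θ‖ ^ 2) ≤ h θ)
    -- the estimators are well defined, and bounded in some `Lʳ` with `r > 2`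
    (hwell : ∀ η ∈ interior Dη, ∀ᶠ N : ℕ in atTop, ∀ Y : Vec N, EBWellDefined u σ w Y η)
    (hwell_hat : ∀ᶠ N : ℕ in atTop, ∀ᵐ ω ∂μ,
      EBWellDefined u σ w (output u e θ₀ N ω) (ηhat N (mlRV u e θ₀ N ω)))
    (hmoment : ∃ r : ENNReal, 2 < r ∧ ∃ C : NNReal, ∀ᶠ N : ℕ in atTop,
      eLpNorm (ebRV u e σ w ηhat θ₀ N) r μ ≤ C)
    -- the limits of `η̂` and of its derivative at `θ₀`, with a Taylor remainder uniform in `N`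
    (ηstar : Vec p) (hηstar : ηstar ∈ interior Dη) (D' : Matrix (Fin p) (Fin n) ℝ)
    (hη_lim : Tendsto (fun N => ηhat N θ₀) atTop (𝓝 ηstar))
    (hη_diff : ∀ᶠ N : ℕ in atTop, DifferentiableAt ℝ (ηhat N) θ₀)
    (hη_deriv : Tendsto (fun N => jacobian (ηhat N) θ₀) atTop (𝓝 D'))
    (hη_unif : (fun q : ℕ × Vec n =>
        ηhat q.1 q.2 - ηhat q.1 θ₀ - fderiv ℝ (ηhat q.1) θ₀ (q.2 - θ₀))
      =o[atTop ×ˢ 𝓝 θ₀] fun q => q.2 - θ₀) :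
    -- all second moments below exist for large `N`
    (∀ᶠ N : ℕ in atTop, MemLp (mlRV u e θ₀ N) 2 μ ∧ MemLp (ebRV u e σ w ηhat θ₀ N) 2 μ ∧
      MemLp (ebFrozenRV u e σ w ηhat θ₀ N) 2 μ) ∧
    -- the limits of the four terms
    Tendsto (fun N : ℕ => (N : ℝ) • upsBias μ u e σ w ηhat θ₀ N) atTop
      (𝓝 (xBias σ S w θ₀ ηstar)) ∧
    Tendsto (fun N : ℕ => (N : ℝ) ^ 2 • upsVar μ u e σ w ηhat θ₀ N) atTop
      (𝓝 (xVar σ S w θ₀ ηstar)) ∧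
    Tendsto (fun N : ℕ => (N : ℝ) ^ 2 • upsVarHPE μ u e σ w ηhat θ₀ N) atTop
      (𝓝 (xVarHPE σ S w θ₀ ηstar D')) ∧
    Tendsto (fun N : ℕ => (N : ℝ) ^ 2 • upsHOT μ u e σ w ηhat θ₀ N) atTop (𝓝 0) ∧
    -- the scaled bias at `θ̂ᴹᴸ = θ₀` and its derivatives
    (∀ η ∈ interior Dη,
      Tendsto (fun N : ℕ => (N : ℝ) • (ebOfMLE u σ w N θ₀ η - θ₀)) atTop
        (𝓝 (limB σ S w θ₀ η)) ∧
      (∀ᶠ N : ℕ in atTop, DifferentiableAt ℝ (fun x => ebOfMLE u σ w N x η) θ₀) ∧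
      Tendsto (fun N : ℕ => (N : ℝ) • (jacobian (fun x => ebOfMLE u σ w N x η) θ₀ - 1)) atTop
        (𝓝 (limBθ σ S w θ₀ η)) ∧
      (∀ᶠ N : ℕ in atTop, DifferentiableAt ℝ (fun η' => ebOfMLE u σ w N θ₀ η') η) ∧
      Tendsto (fun N : ℕ => (N : ℝ) • jacobian (fun η' => ebOfMLE u σ w N θ₀ η') η) atTop
        (𝓝 (limBη σ S w θ₀ η))) ∧
    -- the excess mean squared error
    Tendsto (fun N : ℕ => (N : ℝ) ^ 2 *
        (mse μ θ₀ (ebRV u e σ w ηhat θ₀ N) - mse μ θ₀ (mlRV u e θ₀ N))) atTop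
      (𝓝 (‖xBias σ S w θ₀ ηstar‖ ^ 2 + (xVar σ S w θ₀ ηstar).trace +
        (xVarHPE σ S w θ₀ ηstar D').trace)) := by
  have he : ∀ t, AEMeasurable (e t) μ := fun t => (he_law t).aemeasurable
  have hdet := eventually_isUnit_det hS hgram
  have hξ : RootConsistent μ (fun N ω => mlRV u e θ₀ N ω - θ₀) :=
    rootConsistent_mlRV hS hgram he_indep he_law
  have h0 : ∀ᶠ N in atTop, ∫ ω, (mlRV u e θ₀ N ω - θ₀) ∂μ = 0 := by
    filter_upwards [hdet, hξ.tailNegligible_self.memLp] with N hN hm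
    ext i
    rw [integral_coord (hm.integrable (by norm_num)) i, mlRV_sub_mean he_law hN]
    rfl
  have hQ := tendsto_mlRV_cov (θ₀ := θ₀) hS hgram he_indep he_law
  have hfacts := fun η (hη : η ∈ interior Dη) => posterior_facts hσ hS hgram hw_meas hw_nonneg hη
    (hw_pos η hη) (hw_smooth η hη) (hw_dom η hη) (hwell η hη)
  obtain ⟨hlog, hφ, ⟨δ, hδ, K, hK, hgrow⟩, -, -⟩ := hfacts ηstar hηstar
  have hη' : UnifDiffAt ηhat θ₀ (mulVCLM D') := by
    refine unifDiffAt_of_isLittleO ?_ hη_unif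
    have h1 := (continuous_mulVCLM.tendsto D').comp hη_deriv
    simpa only [Function.comp_def, mulVCLM_jacobian] using h1
  have hconst : UnifDiffAt (fun N (_ : Vec n) => ηhat N θ₀) θ₀ (0 : Vec n →L[ℝ] Vec p) :=
    UnifDiffAt.const _
  -- tails
  have hX : TailNegligible μ (fun N ω => mlRV u e θ₀ N ω - θ₀) (mlRV u e θ₀) := by
    have h1 := hξ.tailNegligible_self.add
      (hξ.tailNegligible_const (c := fun _ => θ₀) (Eventually.of_forall fun _ => le_rfl))
    simpa only [sub_add_cancel] using h1
  -- Away from `θ₀` the selected hyper-parameter may be anywhere in `Dη`, so the local growth bound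
  -- does not apply and the assumed `Lʳ` bound takes its place.
  have hT : TailNegligible μ (fun N ω => mlRV u e θ₀ N ω - θ₀) (ebRV u e σ w ηhat θ₀) := by
    obtain ⟨r, hr, C, hC⟩ := hmoment
    exact hξ.tailNegligible hr (Eventually.of_forall fun N =>
      (aemeasurable_ebRV hw_meas he hη_meas N).aestronglyMeasurable) hC
  have hTX := hT.sub hX
  have hT'X : TailNegligible μ (fun N ω => mlRV u e θ₀ N ω - θ₀)
      (fun N ω => ebFrozenRV u e σ w ηhat θ₀ N ω - mlRV u e θ₀ N ω) := by
    refine TailNegligible.of_linear_growth hξ hK (Eventually.of_forall fun N =>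
      ((aemeasurable_ebFrozenRV hw_meas he N).sub
        (aemeasurable_mlRV he N)).aestronglyMeasurable) ?_
    filter_upwards [hgrow, hdet, Metric.tendsto_nhds.1 hη_lim δ hδ] with N hgrow hN hηN ω
    have h1 := hgrow (ηhat N θ₀) hηN (mlRV u e θ₀ N ω)
    rwa [mlRV, ← ebEstimate_eq_ebOfMLE u σ w hN] at h1
  have hT' : TailNegligible μ (fun N ω => mlRV u e θ₀ N ω - θ₀) (ebFrozenRV u e σ w ηhat θ₀) := by
    have h1 := hT'X.add hX
    simpa only [sub_add_cancel] using h1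
  have hTT' := hT.sub hT'
  -- the scaled shifts
  have hβ : ∀ᶠ N : ℕ in atTop, ∀ ω, (N : ℝ) • (ebRV u e σ w ηhat θ₀ N ω - mlRV u e θ₀ N ω) =
      scaledShift u σ w N (mlRV u e θ₀ N ω, ηhat N (mlRV u e θ₀ N ω)) := by
    filter_upwards [hdet] with N hN ω
    rw [scaledShift, ebRV, ebEstimate_eq_ebOfMLE u σ w hN]
    rfl
  have hβ' : ∀ᶠ N : ℕ in atTop, ∀ ω,
      (N : ℝ) • (ebFrozenRV u e σ w ηhat θ₀ N ω - mlRV u e θ₀ N ω) =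
      scaledShift u σ w N (mlRV u e θ₀ N ω, ηhat N θ₀) := by
    filter_upwards [hdet] with N hN ω
    rw [scaledShift, ebFrozenRV, ebEstimate_eq_ebOfMLE u σ w hN]
    rfl
  have hb : LocallyTendsto μ (fun N ω => mlRV u e θ₀ N ω - θ₀)
      (fun N ω => (N : ℝ) • (ebRV u e σ w ηhat θ₀ N ω - mlRV u e θ₀ N ω))
      (limB σ S w θ₀ ηstar) := by
    intro ε hε
    obtain ⟨δ, hδ, h⟩ := hφ.plugIn_tendsto hη' hη_lim ε hε
    refine ⟨δ, hδ, ?_⟩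
    filter_upwards [h, hβ] with N h hβ
    refine ae_of_all _ fun ω hω => ?_
    rw [hβ]
    exact h _ hω
  have hb' : LocallyTendsto μ (fun N ω => mlRV u e θ₀ N ω - θ₀)
      (fun N ω => (N : ℝ) • (ebFrozenRV u e σ w ηhat θ₀ N ω - mlRV u e θ₀ N ω))
      (limB σ S w θ₀ ηstar) := by
    intro ε hε
    obtain ⟨δ, hδ, h⟩ := hφ.plugIn_tendsto hconst hη_lim ε hε
    refine ⟨δ, hδ, ?_⟩
    filter_upwards [h, hβ'] with N h hβ
    refine ae_of_all _ fun ω hω => ?_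
    rw [hβ]
    exact h _ hω
  -- correlations with the maximum likelihood estimator
  have hVar : ∀ i j, Tendsto (fun N : ℕ => N * ∫ ω,
      ((N : ℝ) • (ebFrozenRV u e σ w ηhat θ₀ N ω - mlRV u e θ₀ N ω)) i *
        (mlRV u e θ₀ N ω - θ₀) j ∂μ) atTop
      (𝓝 ((σ ^ 2 • (limBθ σ S w θ₀ ηstar * S⁻¹)) i j)) := fun i j => by
    have hc : Tendsto (fun N => scaledShift u σ w N (θ₀, ηhat N θ₀)) atTop
        (𝓝 (limB σ S w θ₀ ηstar)) :=
      hφ.tendsto (tendsto_const_nhds.prodMk_nhds hη_lim)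
    have h1 := tendsto_integral_mul_coord hξ hT'X.nat_smul h0 hQ
      (hc.norm.eventually_le_const (lt_add_one _))
      ((shiftDeriv σ S w θ₀ ηstar).comp (ContinuousLinearMap.inl ℝ (Vec n) (Vec p)))
      (fun ε hε => by
        obtain ⟨δ, hδ, h⟩ := hφ.expand_fst hη_lim ε hε
        refine ⟨δ, hδ, ?_⟩
        filter_upwards [h, hβ'] with N h hβ
        refine ae_of_all _ fun ω hω => ?_
        rw [hβ]
        exact h _ hω) i j
    rwa [sum_limBθ_mul hlog] at h1
  have hHPE : ∀ i j, Tendsto (fun N : ℕ => N * ∫ ω,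
      ((N : ℝ) • (ebRV u e σ w ηhat θ₀ N ω - ebFrozenRV u e σ w ηhat θ₀ N ω)) i *
        (mlRV u e θ₀ N ω - θ₀) j ∂μ) atTop
      (𝓝 ((σ ^ 2 • (limBη σ S w θ₀ ηstar * D' * S⁻¹)) i j)) := fun i j => by
    -- The affine part has no constant term because the two hyper-parameters coincide when the
    -- maximum likelihood estimate equals `θ₀`.
    have h1 := tendsto_integral_mul_coord hξ hTT'.nat_smul h0 hQ (c := fun _ => 0) (C := 0)
      (Eventually.of_forall fun _ => by simp)
      (((shiftDeriv σ S w θ₀ ηstar).comp (ContinuousLinearMap.inr ℝ (Vec n) (Vec p))).comp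
        (mulVCLM D'))
      (fun ε hε => by
        obtain ⟨δ, hδ, h⟩ := hφ.expand_snd hη' hη_lim ε hε
        refine ⟨δ, hδ, ?_⟩
        filter_upwards [h, hβ, hβ'] with N h hβ hβ'
        refine ae_of_all _ fun ω hω => ?_
        have h2 := h _ hω
        rwa [← hβ, ← hβ', ← smul_sub, sub_sub_sub_cancel_right, ← sub_zero (_ • _)] at h2) i j
    rwa [sum_limBη_mul hlog] at h1
  have hTot : ∀ i j, Tendsto (fun N : ℕ => N * ∫ ω,
      ((N : ℝ) • (ebRV u e σ w ηhat θ₀ N ω - mlRV u e θ₀ N ω)) i *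
        (mlRV u e θ₀ N ω - θ₀) j ∂μ) atTop
      (𝓝 ((σ ^ 2 • (limBθ σ S w θ₀ ηstar * S⁻¹) +
        σ ^ 2 • (limBη σ S w θ₀ ηstar * D' * S⁻¹)) i j)) := fun i j => by
    -- The total shift is the frozen shift plus the effect of estimating the hyper-parameter, and
    -- the integrals add up.
    refine ((hVar i j).add (hHPE i j)).congr' ?_
    filter_upwards [hT'X.nat_smul.memLp, hTT'.nat_smul.memLp, hξ.tailNegligible_self.memLp]
      with N h1 h2 h3
    rw [← mul_add]
    congr 1
    refine (integral_add ((h1.coord i).integrable_mul (h3.coord j))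
      ((h2.coord i).integrable_mul (h3.coord j))).symm.trans ?_
    refine integral_congr_ae (ae_of_all _ fun ω => ?_)
    simp only [Pi.mul_apply, PiLp.smul_apply, PiLp.sub_apply, smul_eq_mul]
    ring
  have hξ2 := hξ.tailNegligible_self.memLp
  have hLimBias := tendsto_scaled_bias h0 hξ hT'X hb'
  have hLimVar := tendsto_crossCov_add_transpose hξ2 h0 hT'X.memLp hVar
  have hLimHPE := tendsto_crossCov_add_transpose hξ2 h0 hTT'.memLp hHPE
  have hLimHOT := tendsto_higher_order_terms h0 hξ hTX hT'X hb hb'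
  simp only [upsBias, upsVar, upsVarHPE, upsHOT, xBias, xVar, xVarHPE]
  refine ⟨?_, hLimBias, hLimVar, hLimHPE, hLimHOT, fun η hη => ?_, ?_⟩
  · filter_upwards [hX.memLp, hT.memLp, hT'.memLp] with N h1 h2 h3 using ⟨h1, h2, h3⟩
  · obtain ⟨hlog, hφ, -, hd, hd'⟩ := hfacts η hη
    have h1 := hφ.tendsto (x := fun _ => (θ₀, η)) tendsto_const_nhds
    exact ⟨h1, hd, tendsto_jacobian_fst hlog hφ hd, hd',
      tendsto_jacobian_snd hlog hφ hd'⟩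
  · have h1 := tendsto_excess_mse hξ hTX hb hTot
    -- A matrix and its transpose have equal trace, so twice the trace of the sum of the linear
    -- limits equals the traces of the two symmetrized matrices.
    convert h1 using 2
    simp only [Matrix.trace_add, Matrix.trace_transpose]
    ring

end Main
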